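/- **Triangulations.** Let $X$ be a finite simplicial cell complex, pure of dimension $4$, in the broad sense that several simplices may have the same vertices; its vertices are labelled by distinct elements of a linearly ordered set, a simplex has distinct vertices, and it has exactly one face for each nonempty subset of its vertex set. Let $X$ be closed and coherently oriented: each tetrahedron is a 3-face of exactly two pentachora (4-simplices), which induce opposite orientations on it. (In particular, $X$ may be a triangulation of a closed oriented PL 4-manifold $M$.) Let $\varepsilon_u=\pm1$ compare the orientation of a pentachoron $u$ with the order of its vertices. For an edge $b$, let $\delta b\in Z^2(X,\mathbb C)$ be the coboundary of the 1-cochain that is $1$ on $b$ (oriented by the order of its vertices) and $0$ on all other edges. **Edge operators.** Let $\omega\in Z^2(X,\mathbb C)$ be a 2-cocycle with $\omega_s\neq0$ for all 2-faces $s$, and fix square roots $q_s$, $q_s^2=\omega_s$. In a tetrahedron $t$ number the 2-faces $0,1,2,3$ so that the $n$-th is opposite to the $n$-th vertex in increasing order; let $c_n$, $\omega_n$, $q_n$ be the values on the $n$-th 2-face, $x_n=c_n/\omega_n$, $x'_n=c'_n/\omega_n$, $K_t=q_0q_1q_2q_3$. The linear functionals $\beta_t,\gamma_t$ on the cocycles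 of $t$ are defined, up to $(\beta_t,\gamma_t)\mapsto(\lambda\beta_t,\lambda^{-1}\gamma_t)$ with $\lambda\ne0$, by $$\beta_t(c)\gamma_t(c')=\tfrac12\Bigl(\sum_{n=0}^3(-1)^n\omega_nx_nx'_n+\tfrac{K_t}{\omega_0}\bigl[(x_1x_2'-x_2x_1')+(x_2x_3'-x_3x_2')+(x_3x_1'-x_1x_3')\bigr]\Bigr).$$ For a pentachoron $u$, let $t_n$ be its 3-face opposite to its $n$-th vertex ($n=0,\dots,4$, increasing order). Assume that, for each $u$, the vectors $(\beta_{t_m}(\delta b))_{m=0}^4$, $b$ running over the edges, span $\mathbb C^5$, so that there is a unique matrix $F^{(u)}$ with $$\varepsilon_u(-1)^n\gamma_{t_n}(\delta b)=\sum_{m}\beta_{t_m}(\delta b)F^{(u)}_{mn}\qquad\text{for all } b,n$$ (that is, the edge operators of $u$ annihilate the Grassmann–Gaussian weight $\exp(-\frac12\sum F^{(u)}_{mn}\vartheta_{t_m}\vartheta_{t_n})$). Let $H_u$ be the number such that, for each even permutation $(i,j,k,l,m)$ of $(0,1,2,3,4)$ with $i<j$, $$H_u\,\bigl(F^{(u)}_{jl}F^{(u)}_{ik}-F^{(u)}_{jk}F^{(u)}_{il}\bigr)=\beta_{t_m}(\delta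 b_{ij})\,q_{\{ijk\}}q_{\{ijl\}}q_{\{ijm\}}q_{\{klm\}},$$ where the indices refer to the vertices of $u$; it is assumed to exist. Choose $\eta_u$ with $\eta_u^2=H_u$. **The complex and the invariant.** Assume that $Z^2(X,\mathbb C)$ has a basis consisting of $\delta b$ for all edges $b$ outside of a maximal tree of the 1-skeleton and of some further cocycles $z_1,\dots,z_r$ (so $X$ is connected, $H^1(X,\mathbb C)=0$, and $z_1,\dots,z_r$ represent a basis of $H^2(X,\mathbb C)$), and fix such a basis. Consider the complex $$0\to\mathbb C\xrightarrow{f_1}Z^2(X,\mathbb C)\xrightarrow{f_2}\mathbb C^{\{\text{tetrahedra}\}}\xrightarrow{f_3}\mathbb C^{\{\text{tetrahedra}\}}\xrightarrow{f_4}Z^2(X,\mathbb C)^*\xrightarrow{f_5}\mathbb C\to0,$$ $f_1(1)=\omega$, $f_2(c)=(\beta_t(c|_t))_t$, $f_3=\sum_uF^{(u)}$ (a skew-symmetric matrix), $f_4=f_2^*$, $f_5=f_1^*$. If it is acyclic, let $$\sqrt\tau=\frac{\operatorname{minor}f_1\cdot\operatorname{Pfaffian}(\text{submatrix of }f_3)}{\operatorname{minor}f_2},\qquad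 I=\prod_{\text{2-faces }s}q_s^{-1}\prod_{\text{pentachora }u}\eta_u\cdot\sqrt\tau .$$ Here $\operatorname{minor}f_1$ is a coordinate of $\omega$, $\operatorname{minor}f_2$ is a minor of $f_2$ containing all columns except the one with the number of that coordinate, the submatrix of $f_3$ consists of the rows and columns that correspond to the tetrahedra not used as rows in $\operatorname{minor}f_2$, and the two minors and the determinant of the submatrix are nonzero. Rows and columns may be ordered arbitrarily, and $I$ is considered up to a sign. **The second move 0–2.** Let $t$ be a tetrahedron of $X$ and let $a$ be a label that is not used in $X$. The move yields the complex $X'$ as follows. Add a second copy $t'$ of $t$ with the same boundary as $t$, and let $t'$ replace $t$ as a 3-face of one of the two pentachora that contain $t$. Add the new vertex $a$ and the cones with apex $a$ over all proper faces of $t$ (four edges, six 2-faces, four tetrahedra). Add two pentachora with vertex $a$ and the vertices of $t$, one containing $t$ and the other containing $t'$, and sharing their other four 3-faces. They are oriented oppositely to each other and coherently with the old pentachora. **Theorem.** Let data as above be given on $X$ and on $X'$, such that the square roots $q_s$ (hence also $\omega_s$) are the same on all old 2-faces $s$, and each further basis cocycle $z'_k$ on $X'$ restricts on the old 2-faces to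 a cocycle cohomologous to $z_k$, $k=1,\dots,r$. All other choices (rescaling of $\beta_t,\gamma_t$, signs of $\eta_u$, maximal trees, minors, orders of rows and columns, the square roots $q_s$ on the new 2-faces) are made independently on $X$ and $X'$. If the complex for $X$ is acyclic, then so is the complex for $X'$, the quantities $I(X)$ and $I(X')$ are defined, and $$I(X')=\pm I(X).$$ -/

import Mathlib

universe u v

/-- A finite complex of simplices of dimension at most four, in the broad sense: several simplices
may share the same vertices.  The vertices are labelled by elements of a linearly ordered set `Λ`;
`verts σ` is the set of vertices of `σ`, and `face σ A` is the face of `σ` spanned by the vertices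
in `A` (only meaningful if `A ⊆ verts σ` is nonempty). -/
structure TriComplex (Λ : Type v) [LinearOrder Λ] where
  Cell : Type u
  fintypeCell : Fintype Cell
  verts : Cell → Finset Λ
  face : Cell → Finset Λ → Cell
  verts_nonempty : ∀ σ, (verts σ).Nonempty
  card_verts_le : ∀ σ, (verts σ).card ≤ 5
  face_verts : ∀ σ, face σ (verts σ) = σ
  verts_face : ∀ σ A, A ⊆ verts σ → A.Nonempty → verts (face σ A) = A
  face_face : ∀ σ A B, B ⊆ A → A ⊆ verts σ → B.Nonempty → face (face σ A) B = face σ B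
  vertex_unique : ∀ σ τ, (verts σ).card = 1 → verts σ = verts τ → σ = τ

namespace TriComplex

variable {Λ : Type v} [LinearOrder Λ]

noncomputable instance (X : TriComplex.{u} Λ) : Fintype X.Cell := X.fintypeCell

/-- The `k`-dimensional simplices. -/
def Simp (X : TriComplex.{u} Λ) (k : ℕ) : Type u := {σ : X.Cell // (X.verts σ).card = k + 1}

noncomputable instance (X : TriComplex.{u} Λ) (k : ℕ) : Fintype (X.Simp k) := by
  unfold Simp
  exact Fintype.ofFinite _

/-- The `n`-th vertex of a `k`-simplex, in increasing order. -/
def vtx (X : TriComplex.{u} Λ) {k : ℕ} (σ : X.Simp k) : Fin (k + 1) ↪o Λ :=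
  (X.verts σ.1).orderEmbOfFin σ.2

theorem map_vtx_subset (X : TriComplex.{u} Λ) {k : ℕ} (σ : X.Simp k) (s : Finset (Fin (k + 1))) :
    s.map (X.vtx σ).toEmbedding ⊆ X.verts σ.1 := by
  intro x hx
  obtain ⟨n, -, rfl⟩ := Finset.mem_map.1 hx
  exact Finset.orderEmbOfFin_mem _ _ _

/-- The `j`-dimensional face of a `k`-simplex spanned by the vertices with numbers in `s`. -/
def sub (X : TriComplex.{u} Λ) {k j : ℕ} (σ : X.Simp k) (s : Finset (Fin (k + 1)))
    (hs : s.card = j + 1) : X.Simp j :=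
  ⟨X.face σ.1 (s.map (X.vtx σ).toEmbedding), by
    rw [X.verts_face _ _ (X.map_vtx_subset σ s), Finset.card_map, hs]
    rw [← Finset.card_pos, Finset.card_map, hs]
    exact Nat.succ_pos j⟩

/-- The face opposite to the `n`-th vertex. -/
def d (X : TriComplex.{u} Λ) {k : ℕ} (σ : X.Simp (k + 1)) (n : Fin (k + 2)) : X.Simp k :=
  X.sub σ (Finset.univ.erase n) (by simp)

/-- The simplicial coboundary of cochains with complex values. -/
noncomputable def coboundary (X : TriComplex.{u} Λ) (k : ℕ) :
    (X.Simp k → ℂ) →ₗ[ℂ] (X.Simp (k + 1) → ℂ) where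
  toFun c := fun σ => ∑ n : Fin (k + 2), (-1 : ℂ) ^ (n : ℕ) * c (X.d σ n)
  map_add' c c' := by
    funext σ
    simp [mul_add, Finset.sum_add_distrib]
  map_smul' r c := by
    funext σ
    simp only [Pi.smul_apply, smul_eq_mul, RingHom.id_apply, Finset.mul_sum]
    exact Finset.sum_congr rfl fun n _ => by ring

/-- The space of 2-cocycles. -/
noncomputable def Z2 (X : TriComplex.{u} Λ) : Submodule ℂ (X.Simp 2 → ℂ) :=
  LinearMap.ker (X.coboundary 2)

open Classical in
/-- The coboundary of the 1-cochain equal to `1` on the edge `b` and to `0` elsewhere. -/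
noncomputable def edgeCob (X : TriComplex.{u} Λ) (b : X.Simp 1) : X.Simp 2 → ℂ :=
  X.coboundary 1 (Pi.single b 1)

/-- `X` is closed, pure of dimension four, and coherently oriented by the signs `ε` of its
pentachora (the sign compares the orientation of a pentachoron with the order of its vertices):
each tetrahedron is a 3-face of exactly two pentachora, which induce opposite orientations on it. -/
def IsClosedOriented (X : TriComplex.{u} Λ) (ε : X.Simp 4 → ℤˣ) : Prop :=
  (∀ σ : X.Cell, ∃ p : X.Simp 4, ∃ A ⊆ X.verts p.1, A.Nonempty ∧ X.face p.1 A = σ) ∧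
  ∀ t : X.Simp 3, ∃ p p' : X.Simp 4 × Fin 5, p ≠ p' ∧
    (∀ r : X.Simp 4 × Fin 5, X.d r.1 r.2 = t ↔ r = p ∨ r = p') ∧
    ε p.1 * (-1) ^ (p.2 : ℕ) = -(ε p'.1 * (-1) ^ (p'.2 : ℕ))

/-- `T` is (the set of edges of) a maximal tree in the 1-skeleton. -/
def IsSpanningTree (X : TriComplex.{u} Λ) (T : Set (X.Simp 1)) : Prop :=
  Set.InjOn (fun e => (X.d e 0, X.d e 1)) T ∧
  (SimpleGraph.fromRel fun v w : X.Simp 0 => ∃ e ∈ T, X.d e 0 = v ∧ X.d e 1 = w).IsTree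

/-- A distinguished basis of the space of 2-cocycles: the coboundaries of the edges outside of a
maximal tree, and `r` further cocycles (which represent a basis of second cohomology). -/
structure CocycleBasis (X : TriComplex.{u} Λ) (r : ℕ) where
  tree : Set (X.Simp 1)
  isSpanningTree : X.IsSpanningTree tree
  basis : Module.Basis ({b : X.Simp 1 // b ∉ tree} ⊕ Fin r) ℂ X.Z2
  basis_inl : ∀ b : {b : X.Simp 1 // b ∉ tree},
    ((basis (Sum.inl b) : X.Z2) : X.Simp 2 → ℂ) = X.edgeCob b.1

/-- The values of a 2-cochain on the four 2-faces of a tetrahedron; the `n`-th one is opposite to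
the `n`-th vertex. -/
def res (X : TriComplex.{u} Λ) (t : X.Simp 3) : (X.Simp 2 → ℂ) →ₗ[ℂ] (Fin 4 → ℂ) where
  toFun c := fun n => c (X.d t n)
  map_add' _ _ := rfl
  map_smul' _ _ := rfl

end TriComplex

/-- The cocycle condition within one tetrahedron. -/
def IsTetCocycle (c : Fin 4 → ℂ) : Prop := ∑ n : Fin 4, (-1 : ℂ) ^ (n : ℕ) * c n = 0

/-- The bilinear form on the cocycles of a tetrahedron with 2-faces coloured by `q n`, where
`(q n) ^ 2` are the values of the cocycle `ω`.  With `x n = c n / ω n` and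
`K = q 0 * q 1 * q 2 * q 3`, its symmetric part is half of `∑ ± ω n * x n * x' n`, and its
antisymmetric part is half of `K` times the natural area form. -/
noncomputable def tetForm (q c c' : Fin 4 → ℂ) : ℂ :=
  let x : Fin 4 → ℂ := fun n => c n / q n ^ 2
  let x' : Fin 4 → ℂ := fun n => c' n / q n ^ 2
  1 / 2 * (∑ n : Fin 4, (-1 : ℂ) ^ (n : ℕ) * (q n ^ 2 * x n * x' n)
    + (∏ n : Fin 4, q n) / q 0 ^ 2 *
      ((x 1 * x' 2 - x 2 * x' 1) + (x 2 * x' 3 - x 3 * x' 2) + (x 3 * x' 1 - x 1 * x' 3)))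

/-- The Pfaffian of a matrix of even size. -/
noncomputable def pfaffian {m : ℕ} (A : Matrix (Fin (2 * m)) (Fin (2 * m)) ℂ) : ℂ :=
  (2 ^ m * (m.factorial : ℂ))⁻¹ * ∑ σ : Equiv.Perm (Fin (2 * m)), ((Equiv.Perm.sign σ : ℤ) : ℂ) *
    ∏ i : Fin m, A (σ ⟨2 * i, by omega⟩) (σ ⟨2 * i + 1, by omega⟩)

namespace TriComplex

variable {Λ : Type v} [LinearOrder Λ]

/-- All the quantities from which the invariant is composed. -/
structure Coloring (X : TriComplex.{u} Λ) (ε : X.Simp 4 → ℤˣ) where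
  /-- The square roots of the values of the cocycle `ω`. -/
  q : X.Simp 2 → ℂ
  q_ne_zero : ∀ s, q s ≠ 0
  sq_mem : (fun s => q s ^ 2) ∈ X.Z2
  /-- The operator `d_c` has the component `β_t(c) ∂_t + γ_t(c) ϑ_t` in the tetrahedron `t` taken
  with the orientation given by the order of its vertices.  The two linear functionals are the
  factors of the form `tetForm` of rank one, and are thus determined up to the rescaling of the
  Grassmann generator `ϑ_t`. -/
  β : X.Simp 3 → (Fin 4 → ℂ) →ₗ[ℂ] ℂ
  γ : X.Simp 3 → (Fin 4 → ℂ) →ₗ[ℂ] ℂ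
  β_mul_γ : ∀ t c c', IsTetCocycle c → IsTetCocycle c' →
    β t c * γ t c' = tetForm (X.res t q) c c'
  /-- The edge operators of a pentachoron span a space of the maximal dimension five, and no nonzero
  element of that space is free of differentiations. -/
  span_eq_top : ∀ p : X.Simp 4, Submodule.span ℂ (Set.range fun b : X.Simp 1 =>
    fun m : Fin 5 => β (X.d p m) (X.res (X.d p m) (X.edgeCob b))) = ⊤
  /-- `F p m n` is the matrix element between the 3-faces of the pentachoron `p` that are opposite
  to its `m`-th and `n`-th vertices. -/
  F : X.Simp 4 → Matrix (Fin 5) (Fin 5) ℂ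
  /-- The edge operators of `p` annihilate the Grassmann-Gaussian weight
  `exp (-1/2 * ∑ F p m n * ϑ_m * ϑ_n)` of `p`. -/
  annihilate : ∀ (p : X.Simp 4) (b : X.Simp 1) (n : Fin 5),
    ((ε p : ℤ) : ℂ) * (-1) ^ (n : ℕ) * γ (X.d p n) (X.res (X.d p n) (X.edgeCob b)) =
      ∑ m : Fin 5, β (X.d p m) (X.res (X.d p m) (X.edgeCob b)) * F p m n
  /-- The square roots of the quantities `H_p`. -/
  η : X.Simp 4 → ℂ
  /-- `H_p` is the ratio of the right-hand side to the second factor on the left, the same for all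
  edges `ij`, `i < j`, and tetrahedra `ijkl`, where `ijklm` is an even permutation of the vertices
  of `p`. -/
  η_sq : ∀ (p : X.Simp 4) (σ : Equiv.Perm (Fin 5)), Equiv.Perm.sign σ = 1 → σ 0 < σ 1 →
    η p ^ 2 * (F p (σ 1) (σ 3) * F p (σ 0) (σ 2) - F p (σ 1) (σ 2) * F p (σ 0) (σ 3)) =
      β (X.d p (σ 4)) (X.res (X.d p (σ 4))
        (X.edgeCob (X.sub p (({0, 1} : Finset (Fin 5)).map σ.toEmbedding) (by simp)))) *
      q (X.sub p (({0, 1, 2} : Finset (Fin 5)).map σ.toEmbedding) (by simp)) *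
      q (X.sub p (({0, 1, 3} : Finset (Fin 5)).map σ.toEmbedding) (by simp)) *
      q (X.sub p (({0, 1, 4} : Finset (Fin 5)).map σ.toEmbedding) (by simp)) *
      q (X.sub p (({2, 3, 4} : Finset (Fin 5)).map σ.toEmbedding) (by simp))

namespace Coloring

variable {X : TriComplex.{u} Λ} {ε : X.Simp 4 → ℤˣ}

/-- The cocycle `ω`. -/
noncomputable def ω (D : X.Coloring ε) : X.Z2 := ⟨fun s => D.q s ^ 2, D.sq_mem⟩

open Classical in
/-- The skew-symmetric matrix `f₃`, the sum of the matrices `F` of all pentachora. -/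
noncomputable def f3Matrix (D : X.Coloring ε) : Matrix (X.Simp 3) (X.Simp 3) ℂ :=
  fun t t' => ∑ p : X.Simp 4, ∑ m : Fin 5, ∑ n : Fin 5,
    if X.d p m = t ∧ X.d p n = t' then D.F p m n else 0

/-- The maps of the chain complex
`0 → ℂ → Z² → ℂ^{tetrahedra} → ℂ^{tetrahedra} → (Z²)* → ℂ → 0`. -/
noncomputable def f1 (D : X.Coloring ε) : ℂ →ₗ[ℂ] X.Z2 := LinearMap.toSpanSingleton ℂ X.Z2 D.ω

/-- The components of `f₂ c` are the coefficients of the differentiations in the operator `D_c`. -/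
noncomputable def f2 (D : X.Coloring ε) : X.Z2 →ₗ[ℂ] (X.Simp 3 → ℂ) :=
  LinearMap.pi fun t => (D.β t ∘ₗ X.res t) ∘ₗ X.Z2.subtype

noncomputable def f3 (D : X.Coloring ε) : (X.Simp 3 → ℂ) →ₗ[ℂ] (X.Simp 3 → ℂ) :=
  D.f3Matrix.mulVecLin

noncomputable def f4 (D : X.Coloring ε) : (X.Simp 3 → ℂ) →ₗ[ℂ] Module.Dual ℂ X.Z2 where
  toFun w := ∑ t : X.Simp 3, w t • (LinearMap.proj t ∘ₗ D.f2)
  map_add' w w' := by simp [add_smul, Finset.sum_add_distrib]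
  map_smul' r w := by simp [mul_smul, Finset.smul_sum]

noncomputable def f5 (D : X.Coloring ε) : Module.Dual ℂ X.Z2 →ₗ[ℂ] ℂ := Module.Dual.eval ℂ X.Z2 D.ω

/-- Acyclicity of the chain complex. -/
def IsAcyclic (D : X.Coloring ε) : Prop :=
  Function.Injective D.f1 ∧ Function.Exact D.f1 D.f2 ∧ Function.Exact D.f2 D.f3 ∧
  Function.Exact D.f3 D.f4 ∧ Function.Exact D.f4 D.f5 ∧ Function.Surjective D.f5

/-- `y` is one of the values of the square root of the torsion,
`minor f₁ * Pfaffian (submatrix of f₃) / minor f₂`.  The minor of `f₁` uses the row `i₀`, the minor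
of `f₂` uses all the columns except `i₀` and the rows in `R`, the submatrix of `f₃` uses the rows
and the columns not in `R`; rows and columns are enumerated in an arbitrary way. -/
def IsSqrtTorsion (D : X.Coloring ε) {r : ℕ} (Z : X.CocycleBasis r) (y : ℂ) : Prop :=
  ∃ (i₀ : {b : X.Simp 1 // b ∉ Z.tree} ⊕ Fin r) (R : Set (X.Simp 3)) (k m : ℕ)
    (col : Fin k ≃ {i : {b : X.Simp 1 // b ∉ Z.tree} ⊕ Fin r // i ≠ i₀})
    (row : Fin k ≃ {t : X.Simp 3 // t ∈ R}) (rest : Fin (2 * m) ≃ {t : X.Simp 3 // t ∉ R}),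
    let minor₁ : ℂ := Z.basis.repr D.ω i₀
    let minor₂ : ℂ := (Matrix.of fun a b => D.f2 (Z.basis (col b).1) (row a).1).det
    let S : Matrix (Fin (2 * m)) (Fin (2 * m)) ℂ :=
      D.f3Matrix.submatrix (fun a => (rest a).1) (fun a => (rest a).1)
    minor₁ ≠ 0 ∧ minor₂ ≠ 0 ∧ S.det ≠ 0 ∧ y = minor₁ * pfaffian S / minor₂

/-- `I` is one of the values of the invariant. -/
def IsInvariant (D : X.Coloring ε) {r : ℕ} (Z : X.CocycleBasis r) (I : ℂ) : Prop :=
  ∃ y, D.IsSqrtTorsion Z y ∧ I = (∏ s : X.Simp 2, (D.q s)⁻¹) * (∏ p : X.Simp 4, D.η p) * y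

end Coloring

/-- The place of a second move 0--2: a tetrahedron `t`, a pentachoron `p` having `t` as a 3-face,
and the label `a` of the new vertex. -/
structure Site (X : TriComplex.{u} Λ) where
  t : X.Simp 3
  p : X.Simp 4
  subset : X.verts t.1 ⊆ X.verts p.1
  face_eq : X.face p.1 (X.verts t.1) = t.1
  a : Λ
  a_notMem : ∀ σ, a ∉ X.verts σ

/-- The simplices after the move: the old ones; the cones, with the new vertex as the apex, over the
proper faces of the tetrahedron (including the empty face); the second copy of the tetrahedron;
the two new pentachora. -/
inductive InflatedCell (C : Type u) (A : Finset Λ) : Type (max u v)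
  | old : C → InflatedCell C A
  | cone : {B : Finset Λ // B ∈ A.ssubsets} → InflatedCell C A
  | copy : InflatedCell C A
  | pent₁ : InflatedCell C A
  | pent₂ : InflatedCell C A

namespace Site

variable {X : TriComplex.{u} Λ} (P : X.Site)

/-- The vertices of the tetrahedron. -/
def A : Finset Λ := X.verts P.t.1

abbrev NewCell : Type (max u v) := InflatedCell X.Cell P.A

instance : Finite P.NewCell := by
  let f : P.NewCell → X.Cell ⊕ ({B : Finset Λ // B ∈ P.A.ssubsets} ⊕ Fin 3) := fun c =>
    match c with
    | .old σ => .inl σ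
    | .cone B => .inr (.inl B)
    | .copy => .inr (.inr 0)
    | .pent₁ => .inr (.inr 1)
    | .pent₂ => .inr (.inr 2)
  refine Finite.of_injective f ?_
  intro c c' h
  cases c <;> cases c' <;> simp_all [f]

def newVerts : P.NewCell → Finset Λ
  | .old σ => X.verts σ
  | .cone B => insert P.a B.1
  | .copy => P.A
  | .pent₁ => insert P.a P.A
  | .pent₂ => insert P.a P.A

/-- The cone over `B`; if `B` is not a proper face of the tetrahedron, the value is irrelevant. -/
def mkCone (B : Finset Λ) : P.NewCell :=
  if h : B ∈ P.A.ssubsets then .cone ⟨B, h⟩ else .copy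

open Classical in
/-- The pentachoron `pent₁` contains the old tetrahedron, `pent₂` contains its copy, and the copy
also replaces the tetrahedron as a 3-face of `p`. All the other faces with the same vertices are
common. -/
noncomputable def newFace : P.NewCell → Finset Λ → P.NewCell
  | .old σ, B => if σ = P.p.1 ∧ B = P.A then .copy else .old (X.face σ B)
  | .cone _, B => if P.a ∈ B then P.mkCone (B.erase P.a) else .old (X.face P.t.1 B)
  | .copy, B => if B = P.A then .copy else .old (X.face P.t.1 B)
  | .pent₁, B => if B = insert P.a P.A then .pent₁ else
      if P.a ∈ B then P.mkCone (B.erase P.a) else .old (X.face P.t.1 B)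
  | .pent₂, B => if B = insert P.a P.A then .pent₂ else
      if P.a ∈ B then P.mkCone (B.erase P.a) else
      if B = P.A then .copy else .old (X.face P.t.1 B)

theorem card_A : P.A.card = 4 := P.t.2

theorem a_notMem_A : P.a ∉ P.A := P.a_notMem _

theorem face_p {B : Finset Λ} (hB : B ⊆ P.A) (hne : B.Nonempty) :
    X.face P.p.1 B = X.face P.t.1 B := by
  rw [← X.face_face P.p.1 P.A B hB P.subset hne]
  exact congrArg (fun τ => X.face τ B) P.face_eq

theorem newVerts_mkCone {B : Finset Λ} (hB : B ∈ P.A.ssubsets) :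
    P.newVerts (P.mkCone B) = insert P.a B := by
  simp [mkCone, newVerts, Finset.mem_ssubsets.1 hB]

theorem mkCone_coe (B : {B : Finset Λ // B ∈ P.A.ssubsets}) : P.mkCone B.1 = .cone B := by
  simp [mkCone]

theorem new_verts_face (σ : P.NewCell) (B : Finset Λ) (hB : B ⊆ P.newVerts σ) (hne : B.Nonempty) :
    P.newVerts (P.newFace σ B) = B := by
  have hcone : ∀ C : Finset Λ, P.a ∈ C → C.erase P.a ∈ P.A.ssubsets →
      P.newVerts (P.mkCone (C.erase P.a)) = C := by
    intro C h1 h2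
    rw [P.newVerts_mkCone h2, Finset.insert_erase h1]
  have hold : B ⊆ P.A → P.newVerts (.old (X.face P.t.1 B)) = B := by
    intro h
    exact X.verts_face _ _ h hne
  cases σ with
  | old σ =>
    simp only [newFace]
    split_ifs with h
    · exact h.2.symm
    · exact X.verts_face _ _ hB hne
  | cone C =>
    have hC := Finset.mem_ssubsets.1 C.2
    simp only [newVerts] at hB
    simp only [newFace]
    split_ifs with h
    · refine hcone B h (Finset.mem_ssubsets.2 (lt_of_le_of_lt ?_ hC))
      simpa [Finset.subset_insert_iff] using hB
    · exact hold (((Finset.subset_insert_iff_of_notMem h).1 hB).trans hC.1)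
  | copy =>
    simp only [newFace]
    split_ifs with h
    · exact h.symm
    · exact hold hB
  | pent₁ =>
    simp only [newVerts] at hB
    simp only [newFace]
    split_ifs with h1 h2
    · exact h1.symm
    · refine hcone B h2 (Finset.mem_ssubsets.2 (lt_of_le_of_ne ?_ ?_))
      · simpa [Finset.subset_insert_iff] using hB
      · intro h; exact h1 (by rw [← h, Finset.insert_erase h2])
    · exact hold ((Finset.subset_insert_iff_of_notMem h2).1 hB)
  | pent₂ =>
    simp only [newVerts] at hB
    simp only [newFace]
    split_ifs with h1 h2 h3
    · exact h1.symm
    · refine hcone B h2 (Finset.mem_ssubsets.2 (lt_of_le_of_ne ?_ ?_))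
      · simpa [Finset.subset_insert_iff] using hB
      · intro h; exact h1 (by rw [← h, Finset.insert_erase h2])
    · exact h3.symm
    · exact hold ((Finset.subset_insert_iff_of_notMem h2).1 hB)

theorem new_face_old_t (B C : Finset Λ) (hC : C ⊆ B) (hB : B ⊆ P.A) (hne : C.Nonempty) :
    P.newFace (.old (X.face P.t.1 B)) C = .old (X.face P.t.1 C) := by
  simp only [newFace]
  rw [if_neg, X.face_face _ _ _ hC hB hne]
  rintro ⟨h1, -⟩
  have h2 := congrArg (fun τ => (X.verts τ).card) h1
  simp only [X.verts_face _ _ hB (hne.mono hC), P.p.2] at h2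
  have := Finset.card_le_card hB
  rw [P.card_A] at this
  omega

theorem new_face_cone (B C : Finset Λ)
    (hB : B.erase P.a ∈ P.A.ssubsets) :
    P.newFace (P.mkCone (B.erase P.a)) C =
      if P.a ∈ C then P.mkCone (C.erase P.a) else .old (X.face P.t.1 C) := by
  rw [P.mkCone_coe ⟨_, hB⟩]
  rfl

theorem new_face_face (σ : P.NewCell) (B C : Finset Λ) (hC : C ⊆ B) (hB : B ⊆ P.newVerts σ)
    (hne : C.Nonempty) : P.newFace (P.newFace σ B) C = P.newFace σ C := by
  have haA := P.a_notMem_A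
  have key : ∀ B', B' ⊆ insert P.a P.A → P.a ∈ B' → B' ≠ insert P.a P.A →
      B'.erase P.a ∈ P.A.ssubsets := by
    intro B' h1 h2 h3
    refine Finset.mem_ssubsets.2 (lt_of_le_of_ne ?_ ?_)
    · simpa [Finset.subset_insert_iff] using h1
    · intro h; exact h3 (by rw [← h, Finset.insert_erase h2])
  cases σ with
  | old σ =>
    simp only [newVerts] at hB
    by_cases h : σ = P.p.1 ∧ B = P.A
    · obtain ⟨rfl, rfl⟩ := h
      simp only [newFace, and_self, if_true, true_and]
      split_ifs with h1
      · rfl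
      · rw [P.face_p hC hne]
    · have e : P.newFace (.old σ) B = .old (X.face σ B) := by simp only [newFace, if_neg h]
      rw [e]
      have hiff : (X.face σ B = P.p.1 ∧ C = P.A) ↔ (σ = P.p.1 ∧ C = P.A) := ?_
      · simp only [newFace, X.face_face _ _ _ hC hB hne]
        by_cases h1 : σ = P.p.1 ∧ C = P.A
        · rw [if_pos h1, if_pos (hiff.2 h1)]
        · rw [if_neg h1, if_neg (fun h2 => h1 (hiff.1 h2))]
      refine and_congr_left fun hCA => ?_
      subst hCA
      constructor
      · intro h1
        have h2 := congrArg (fun τ => (X.verts τ).card) h1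
        simp only [X.verts_face _ _ hB (hne.mono hC), P.p.2] at h2
        have h3 : B = X.verts σ := Finset.eq_of_subset_of_card_le hB (by
          rw [h2]; exact X.card_verts_le σ)
        rw [← h1, h3, X.face_verts]
      · intro h1
        subst h1
        have h4 : B ≠ P.A := fun h5 => h ⟨rfl, h5⟩
        have h5 : P.A.card < B.card := Finset.card_lt_card (lt_of_le_of_ne hC h4.symm)
        have h3 : B = X.verts P.p.1 := Finset.eq_of_subset_of_card_le hB (by
          rw [P.p.2]; rw [P.card_A] at h5; omega)
        rw [h3, X.face_verts]
  | cone D =>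
    have hD := Finset.mem_ssubsets.1 D.2
    simp only [newVerts] at hB
    by_cases h : P.a ∈ B
    · have e : P.newFace (.cone D) B = P.mkCone (B.erase P.a) := by simp only [newFace, if_pos h]
      rw [e, P.new_face_cone B C]
      · rfl
      · refine Finset.mem_ssubsets.2 (lt_of_le_of_lt ?_ hD)
        simpa [Finset.subset_insert_iff] using hB
    · have e : P.newFace (.cone D) B = .old (X.face P.t.1 B) := by simp only [newFace, if_neg h]
      rw [e, P.new_face_old_t B C hC
        (((Finset.subset_insert_iff_of_notMem h).1 hB).trans hD.1) hne]
      simp only [newFace, if_neg (fun h' => h (hC h'))]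
  | copy =>
    simp only [newVerts] at hB
    by_cases h : B = P.A
    · have e : P.newFace .copy B = .copy := by simp only [newFace, if_pos h]
      rw [e]
    · have e : P.newFace .copy B = .old (X.face P.t.1 B) := by simp only [newFace, if_neg h]
      rw [e, P.new_face_old_t B C hC hB hne]
      have : C ≠ P.A := fun h' => h (hB.antisymm (h' ▸ hC))
      simp only [newFace, if_neg this]
  | pent₁ =>
    simp only [newVerts] at hB
    by_cases h1 : B = insert P.a P.A
    · have e : P.newFace .pent₁ B = .pent₁ := by simp only [newFace, if_pos h1]
      rw [e]
    · have h1' : C ≠ insert P.a P.A := fun h' => h1 (hB.antisymm (h' ▸ hC))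
      by_cases h : P.a ∈ B
      · have e : P.newFace .pent₁ B = P.mkCone (B.erase P.a) := by
          simp only [newFace, if_pos h, if_neg h1]
        rw [e, P.new_face_cone B C (key B hB h h1)]
        simp only [newFace, if_neg h1']
      · have e : P.newFace .pent₁ B = .old (X.face P.t.1 B) := by
          simp only [newFace, if_neg h, if_neg h1]
        rw [e, P.new_face_old_t B C hC ((Finset.subset_insert_iff_of_notMem h).1 hB) hne]
        simp only [newFace, if_neg h1', if_neg (fun h' => h (hC h'))]
  | pent₂ =>
    simp only [newVerts] at hB
    by_cases h1 : B = insert P.a P.A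
    · have e : P.newFace .pent₂ B = .pent₂ := by simp only [newFace, if_pos h1]
      rw [e]
    · have h1' : C ≠ insert P.a P.A := fun h' => h1 (hB.antisymm (h' ▸ hC))
      by_cases h : P.a ∈ B
      · have e : P.newFace .pent₂ B = P.mkCone (B.erase P.a) := by
          simp only [newFace, if_pos h, if_neg h1]
        rw [e, P.new_face_cone B C (key B hB h h1)]
        simp only [newFace, if_neg h1']
        have : P.a ∉ C → C ≠ P.A := by
          rintro h3 rfl
          exact absurd (key B hB h h1) (by
            intro h4
            have h5 := Finset.mem_ssubsets.1 h4
            exact h5.2 (fun y hy => Finset.mem_erase.2 ⟨fun h6 => h3 (h6 ▸ hy), hC hy⟩))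
        split_ifs with h6 h7
        · rfl
        · exact absurd h7 (this h6)
        · rfl
      · have haC : P.a ∉ C := fun h' => h (hC h')
        have hBA := (Finset.subset_insert_iff_of_notMem h).1 hB
        by_cases h2 : B = P.A
        · have e : P.newFace .pent₂ B = .copy := by
            simp only [newFace, if_neg h, if_neg h1, if_pos h2]
          rw [e]
          simp only [newFace, if_neg h1', if_neg haC]
        · have e : P.newFace .pent₂ B = .old (X.face P.t.1 B) := by
            simp only [newFace, if_neg h, if_neg h1, if_neg h2]
          rw [e, P.new_face_old_t B C hC hBA hne]
          have : C ≠ P.A := fun h' => h2 (hBA.antisymm (h' ▸ hC))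
          simp only [newFace, if_neg h1', if_neg haC, if_neg this]

/-- The complex after the move: the tetrahedron is inflated into a pillow. -/
noncomputable def inflate : TriComplex.{max u v} Λ where
  Cell := P.NewCell
  fintypeCell := Fintype.ofFinite _
  verts := P.newVerts
  face := P.newFace
  verts_nonempty σ := by
    cases σ with
    | old σ => exact X.verts_nonempty σ
    | copy => exact X.verts_nonempty P.t.1
    | cone B => exact Finset.insert_nonempty _ _
    | pent₁ => exact Finset.insert_nonempty _ _
    | pent₂ => exact Finset.insert_nonempty _ _
  card_verts_le σ := by
    have h4 := P.card_A
    cases σ with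
    | old σ => exact X.card_verts_le σ
    | copy => exact X.card_verts_le P.t.1
    | cone B =>
      have := Finset.card_lt_card (Finset.mem_ssubsets.1 B.2)
      have := Finset.card_insert_le P.a B.1
      simp only [newVerts]
      omega
    | pent₁ =>
      have := Finset.card_insert_le P.a P.A
      simp only [newVerts]
      omega
    | pent₂ =>
      have := Finset.card_insert_le P.a P.A
      simp only [newVerts]
      omega
  face_verts σ := by
    cases σ with
    | old σ =>
      have : ¬ (σ = P.p.1 ∧ X.verts σ = P.A) := by
        rintro ⟨rfl, h⟩
        have h2 := congrArg Finset.card h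
        rw [P.p.2, P.card_A] at h2
        omega
      simp only [newFace, newVerts, X.face_verts]
      exact if_neg this
    | copy => simp [newFace, newVerts]
    | pent₁ => simp [newFace, newVerts]
    | pent₂ => simp [newFace, newVerts]
    | cone B =>
      have hB : P.a ∉ B.1 := fun h => P.a_notMem_A ((Finset.mem_ssubsets.1 B.2).1 h)
      simp only [newFace, newVerts, Finset.mem_insert_self, if_true, Finset.erase_insert hB]
      exact P.mkCone_coe B
  verts_face := P.new_verts_face
  face_face := P.new_face_face
  vertex_unique σ τ h h' := by
    have h4 := P.card_A
    have h5 : (insert P.a P.A).card = 5 := by rw [Finset.card_insert_of_notMem P.a_notMem_A, h4]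
    have hc : ∀ B : {B : Finset Λ // B ∈ P.A.ssubsets}, P.a ∉ B.1 :=
      fun B hB => P.a_notMem_A ((Finset.mem_ssubsets.1 B.2).1 hB)
    cases σ with
    | old σ =>
      cases τ with
      | old τ => exact congrArg _ (X.vertex_unique σ τ h h')
      | cone B =>
        exact absurd (show P.a ∈ X.verts σ from Finset.ext_iff.1 h' P.a |>.2 (Finset.mem_insert_self _ _)) (P.a_notMem σ)
      | copy => rw [h'] at h; simp only [newVerts] at h; omega
      | pent₁ => rw [h'] at h; simp only [newVerts] at h; omega
      | pent₂ => rw [h'] at h; simp only [newVerts] at h; omega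
    | cone B =>
      cases τ with
      | old τ =>
        exact absurd (show P.a ∈ X.verts τ from Finset.ext_iff.1 h' P.a |>.1 (Finset.mem_insert_self _ _)) (P.a_notMem τ)
      | cone C =>
        have h6 : insert P.a B.1 = insert P.a C.1 := h'
        have : B.1 = C.1 := by
          rw [← Finset.erase_insert (hc B), h6, Finset.erase_insert (hc C)]
        exact congrArg _ (Subtype.ext this)
      | copy => rw [h'] at h; simp only [newVerts] at h; omega
      | pent₁ => rw [h'] at h; simp only [newVerts] at h; omega
      | pent₂ => rw [h'] at h; simp only [newVerts] at h; omega
    | copy => simp only [newVerts] at h; omega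
    | pent₁ => simp only [newVerts] at h; omega
    | pent₂ => simp only [newVerts] at h; omega

/-- An old simplex, considered after the move. -/
def oldSimp {k : ℕ} (σ : X.Simp k) : P.inflate.Simp k := ⟨.old σ.1, σ.2⟩

/-- The number of a label among the vertices `B`. -/
def pos (B : Finset Λ) (x : Λ) : ℕ := (B.filter (· < x)).card

/-- The signs of the pentachora after the move.  They do not change for the old pentachora. The two
new ones have opposite signs, such that `pent₂` and `p` induce opposite orientations on the copy of
the tetrahedron. -/
noncomputable def newSign (ε : X.Simp 4 → ℤˣ) : P.inflate.Simp 4 → ℤˣ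
  | ⟨.old σ, h⟩ => ε ⟨σ, h⟩
  | ⟨.pent₂, _⟩ => -(ε P.p * (∏ x ∈ X.verts P.p.1 \ P.A, (-1) ^ pos (X.verts P.p.1) x) *
      (-1) ^ pos (insert P.a P.A) P.a)
  | ⟨_, _⟩ => ε P.p * (∏ x ∈ X.verts P.p.1 \ P.A, (-1) ^ pos (X.verts P.p.1) x) *
      (-1) ^ pos (insert P.a P.A) P.a

/-- The data after the move use the same square roots of the values of the cocycle on the old
2-faces; those on the new 2-faces are arbitrary. -/
def Extends {ε : X.Simp 4 → ℤˣ} (D : X.Coloring ε)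
    (D' : P.inflate.Coloring (P.newSign ε)) : Prop :=
  ∀ s : X.Simp 2, D'.q (P.oldSimp s) = D.q s

/-- The further cocycles in the two distinguished bases represent the same cohomology classes. -/
def SameClasses {r : ℕ} (Z : X.CocycleBasis r) (Z' : P.inflate.CocycleBasis r) : Prop :=
  ∀ k : Fin r, ∃ c : X.Simp 1 → ℂ, ∀ s : X.Simp 2,
    ((Z'.basis (Sum.inr k) : P.inflate.Z2) : P.inflate.Simp 2 → ℂ) (P.oldSimp s) =
      ((Z.basis (Sum.inr k) : X.Z2) : X.Simp 2 → ℂ) s + X.coboundary 1 c s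

end Site
end TriComplex

/-! Since `I` is taken up to a sign, it suffices to compare squares. The square of a Pfaffian is a
determinant (`pfaffian_sq`), and the square of `√τ` is a torsion, which can be computed from any
frame: if vectors `c` complete `ω` to a basis of `Z²`, and vectors `B` complete `f₂ c` to a basis of
the columns over tetrahedra, then `τ = det(ω, c)² · det(Gram matrix of B) / det(f₂ c, B)²`
(`torsion_indep`). Hence minors need not be compared; a frame on `X` is extended to a convenient
frame on `X'`.

The form of a tetrahedron has rank one, so its factors `β`, `γ` are determined by the colours up to
a scalar. The data on the old tetrahedra and on the copy `t'` therefore differ from those on `X` by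
scalars (`Gauge`), and the matrices `F` and the quantities `η²` rescale accordingly. The two new
pentachora carry the same functionals, up to the scalars at `t` and `t'`, and opposite boundary
signs, so that their matrices `F` are opposite (`F_fstPent`). A column on `X` is lifted by
repeating, up to scale, its value at `t` on `t'` and by putting zeros on the four interior
tetrahedra. Lifting preserves the form `f₃`, and lifted columns are orthogonal to the unit vectors
of the interior tetrahedra, because the two new pentachora cancel.

Fix a vertex `f` of `t`. To `B` are added the unit vectors of `t'` and of the interior tetrahedron
opposite to `f`; their pairing `v` is an entry of `F` of the second new pentachoron, and the Gram
determinant is multiplied by `v²`. To `c` are added the coboundaries of the three new edges not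
ending at `f`; their images vanish on the old tetrahedra and on `t'`, so the frame determinant is
multiplied by `S·Y`, where `S` is the product of the scalars of the old tetrahedra and `Y` is a 3×3
determinant. The coordinate determinants agree up to a sign, since the bases of cocycles involved
are related by integral and unipotent changes. Thus `τ' S² Y² = τ v²` (`torsion_inflate`).

The product of all `η²` is multiplied by `S² H²`, where `H` is the value of `η²` at the second new
pentachoron, and the new 2-faces contribute the product `Q` of their six square roots. What remains
is local: `(H v)² = Q² Y²` (`local_identity`, `sndPent_identity`). It follows by elimination from
the relations of two edges with a common vertex, the definition of `H`, and the antisymmetric part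
of the form of one tetrahedron. Some `f` has `v ≠ 0`; the local identity then gives `Y ≠ 0`, and the
extended frame, being nondegenerate, shows that the complex for `X'` is acyclic. -/

open Matrix

/-! ### Pfaffians and symplectic bases. -/

section Pfaffian

variable {m : ℕ}

/-- The signed sum over permutations in the definition of the Pfaffian, with rows and columns
grouped into pairs. -/
noncomputable def pairSum (A : Matrix (Fin 2 × Fin m) (Fin 2 × Fin m) ℂ) : ℂ :=
  ∑ σ : Equiv.Perm (Fin 2 × Fin m), ((Equiv.Perm.sign σ : ℤ) : ℂ) *
    ∏ i : Fin m, A (σ (0, i)) (σ (1, i))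

/-- The standard symplectic matrix. -/
def stdSymp (m : ℕ) : Matrix (Fin 2 × Fin m) (Fin 2 × Fin m) ℂ :=
  Matrix.blockDiagonal fun _ => !![0, 1; -1, 0]

theorem stdSymp_apply (x y : Fin 2 × Fin m) :
    stdSymp m x y = if x.2 = y.2 then (!![0, 1; -1, 0] : Matrix (Fin 2) (Fin 2) ℂ) x.1 y.1 else 0 :=
  Matrix.blockDiagonal_apply _ _ _

theorem det_stdSymp : (stdSymp m).det = 1 := by
  simp [stdSymp, Matrix.det_blockDiagonal]

/-- Expanding the entries of `Bᵀ * A * B` turns the sum over permutations into a sum over all maps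
`f`, whose inner sum is the determinant of `B` with the rows chosen by `f`. It vanishes unless `f`
is bijective, and otherwise returns `B.det` with the sign of `f`. -/
theorem pairSum_congr (A B : Matrix (Fin 2 × Fin m) (Fin 2 × Fin m) ℂ) :
    pairSum (Bᵀ * A * B) = B.det * pairSum A := by
  have e1 : ∀ σ : Equiv.Perm (Fin 2 × Fin m), ∏ i : Fin m, (Bᵀ * A * B) (σ (0, i)) (σ (1, i)) =
      ∑ f : Fin 2 × Fin m → Fin 2 × Fin m, (∏ i : Fin m, A (f (0, i)) (f (1, i))) *
        ∏ x, B (f x) (σ x) := by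
    intro σ
    have h1 : ∀ i, (Bᵀ * A * B) (σ (0, i)) (σ (1, i)) =
        ∑ z : Fin 2 → (Fin 2 × Fin m), A (z 0) (z 1) * (B (z 0) (σ (0, i)) * B (z 1) (σ (1, i))) := by
      intro i
      rw [← (finTwoArrowEquiv (Fin 2 × Fin m)).symm.sum_comp, Fintype.sum_prod_type]
      simp only [Matrix.mul_apply, Matrix.transpose_apply, Finset.sum_mul, finTwoArrowEquiv_symm_apply,
        Matrix.cons_val_zero, Matrix.cons_val_one]
      rw [Finset.sum_comm]
      refine Finset.sum_congr rfl fun a _ => Finset.sum_congr rfl fun b _ => ?_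
      ring
    simp only [h1]
    rw [Finset.prod_univ_sum, Fintype.piFinset_univ]
    let E : (Fin m → Fin 2 → Fin 2 × Fin m) ≃ (Fin 2 × Fin m → Fin 2 × Fin m) :=
      { toFun := fun z x => z x.2 x.1
        invFun := fun f i b => f (b, i)
        left_inv := fun _ => rfl
        right_inv := fun _ => rfl }
    refine Fintype.sum_equiv E _ _ fun z => ?_
    rw [Finset.prod_mul_distrib]
    congr 1
    rw [Fintype.prod_prod_type, Fin.prod_univ_two, ← Finset.prod_mul_distrib]
    rfl
  unfold pairSum
  simp only [e1, Finset.mul_sum]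
  rw [Finset.sum_comm]
  have e2 : ∀ f : Fin 2 × Fin m → Fin 2 × Fin m,
      ∑ σ : Equiv.Perm (Fin 2 × Fin m), ((Equiv.Perm.sign σ : ℤ) : ℂ) *
        ((∏ i : Fin m, A (f (0, i)) (f (1, i))) * ∏ x, B (f x) (σ x)) =
      (∏ i : Fin m, A (f (0, i)) (f (1, i))) * (B.submatrix f id).det := by
    intro f
    rw [← Matrix.det_transpose, Matrix.det_apply', Finset.mul_sum]
    refine Finset.sum_congr rfl fun σ _ => ?_
    simp only [Matrix.transpose_apply, Matrix.submatrix_apply, id]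
    ring
  simp only [e2]
  rw [← Finset.sum_subset (Finset.filter_subset (fun f => Function.Bijective f) Finset.univ)]
  · symm
    refine Finset.sum_bij (fun σ _ => (σ : Fin 2 × Fin m → Fin 2 × Fin m)) ?_ ?_ ?_ ?_
    · intro σ _; simp
    · intro σ _ τ _ h; exact DFunLike.coe_injective h
    · intro f hf
      exact ⟨Equiv.ofBijective f (by simpa using hf), Finset.mem_univ _, rfl⟩
    · intro σ _
      rw [Matrix.det_permute]; ring
  · intro f _ hf
    have hinj : ¬ Function.Injective f := by
      intro h
      exact hf (by simpa using Finite.injective_iff_bijective.1 h)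
    obtain ⟨x, y, hxy, hne⟩ := Function.not_injective_iff.1 hinj
    rw [Matrix.det_zero_of_row_eq hne (by funext z; simp [hxy]), mul_zero]

/-- A term survives only if the permutation carries pairs to pairs. Such permutations consist of a
permutation of the pairs, which is even, and of flips inside the pairs; a flip changes both the sign
of the permutation and that of one entry, so every surviving term is one. -/
theorem pairSum_stdSymp : pairSum (stdSymp m) = 2 ^ m * (m.factorial : ℂ) := by
  let φ : (Fin m → Equiv.Perm (Fin 2)) × Equiv.Perm (Fin m) → Equiv.Perm (Fin 2 × Fin m) :=
    fun z => (Equiv.prodCongrRight fun _ => z.2) * (Equiv.prodCongrLeft z.1)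
  have hφ : ∀ z x, φ z x = (z.1 x.2 x.1, z.2 x.2) := fun z x => rfl
  have hsign : ∀ z, Equiv.Perm.sign (φ z) = ∏ i, Equiv.Perm.sign (z.1 i) := by
    intro z
    rw [Equiv.Perm.sign_mul, Equiv.Perm.sign_prodCongrRight, Equiv.Perm.sign_prodCongrLeft]
    simp
  have hinj : Function.Injective φ := by
    intro z w h
    have h1 : ∀ x, φ z x = φ w x := fun x => by rw [h]
    simp only [hφ, Prod.mk.injEq] at h1
    refine Prod.ext ?_ ?_
    · funext i; ext b; exact congrArg _ (h1 (b, i)).1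
    · ext i; exact congrArg _ (h1 (0, i)).2
  unfold pairSum
  rw [← Finset.sum_subset (Finset.subset_univ (Finset.univ.image φ))]
  · rw [Finset.sum_image (fun _ _ _ _ h => hinj h)]
    have h2 : ∀ s : Equiv.Perm (Fin 2), ((Equiv.Perm.sign s : ℤ) : ℂ) *
        (!![0, 1; -1, 0] : Matrix (Fin 2) (Fin 2) ℂ) (s 0) (s 1) = 1 := by
      intro s
      have : s = 1 ∨ s = Equiv.swap 0 1 := by revert s; decide
      rcases this with rfl | rfl <;> simp
    have h3 : ∀ z, ((Equiv.Perm.sign (φ z) : ℤ) : ℂ) *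
        ∏ i : Fin m, stdSymp m (φ z (0, i)) (φ z (1, i)) = 1 := by
      intro z
      rw [hsign]
      simp only [stdSymp_apply, hφ, if_true, Units.coe_prod, Int.cast_prod]
      rw [← Finset.prod_mul_distrib]
      exact Finset.prod_eq_one fun i _ => h2 _
    rw [Finset.sum_congr rfl fun z _ => h3 z]
    simp [Fintype.card_perm]
  · intro σ _ hσ
    suffices ∃ i, (σ (0, i)).2 ≠ (σ (1, i)).2 by
      obtain ⟨i, hi⟩ := this
      rw [Finset.prod_eq_zero (Finset.mem_univ i), mul_zero]
      rw [stdSymp_apply, if_neg hi]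
    by_contra! hall
    refine hσ (Finset.mem_image.2 ?_)
    have hb : ∀ b i, (σ (b, i)).2 = (σ (0, i)).2 := by
      intro b i; fin_cases b
      · rfl
      · exact (hall i).symm
    have hτ : Function.Bijective fun i => (σ (0, i)).2 := by
      refine Finite.surjective_iff_bijective.1 fun j => ?_
      obtain ⟨⟨b, i⟩, hx⟩ := σ.surjective (0, j)
      exact ⟨i, (hb b i).symm.trans (congrArg Prod.snd hx)⟩
    have hs : ∀ i, Function.Bijective fun b => (σ (b, i)).1 := by
      intro i
      refine Finite.injective_iff_bijective.1 fun b c h => ?_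
      have : σ (b, i) = σ (c, i) := Prod.ext h ((hb b i).trans (hb c i).symm)
      exact congrArg Prod.fst (σ.injective this)
    refine ⟨(fun i => Equiv.ofBijective _ (hs i), Equiv.ofBijective _ hτ), Finset.mem_univ _, ?_⟩
    ext1 x
    rw [hφ]
    exact Prod.ext rfl (hb x.1 x.2).symm

/-- Families of vectors with a standard symplectic Gram matrix exist up to the dimension. -/
theorem exists_symplectic_family {I : Type*} [Fintype I] [DecidableEq I] (A : Matrix I I ℂ)
    (hA : Aᵀ = -A) (hdet : A.det ≠ 0) (k : ℕ) (hk : 2 * k ≤ Fintype.card I) :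
    ∃ b : Fin 2 × Fin k → I → ℂ, ∀ x y, b x ⬝ᵥ A *ᵥ b y = stdSymp k x y := by
  have hskew : ∀ x y : I → ℂ, x ⬝ᵥ A *ᵥ y = -(y ⬝ᵥ A *ᵥ x) := by
    intro x y
    rw [Matrix.dotProduct_mulVec, ← Matrix.mulVec_transpose, hA, Matrix.neg_mulVec,
      neg_dotProduct, dotProduct_comm]
  have hself : ∀ x : I → ℂ, x ⬝ᵥ A *ᵥ x = 0 := fun x => by
    have := hskew x x
    exact self_eq_neg.1 this
  induction k with
  | zero => exact ⟨fun x => x.2.elim0, fun x => x.2.elim0⟩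
  | succ k ih =>
    obtain ⟨b, hb⟩ := ih (by omega)
    -- Pairing with the `2 * k` vectors already found leaves a nonzero kernel for dimensional
    -- reasons.
    let f : (I → ℂ) →ₗ[ℂ] (Fin 2 × Fin k → ℂ) :=
      (Matrix.of b).mulVecLin ∘ₗ A.mulVecLin
    have hf : ∀ v x, f v x = b x ⬝ᵥ A *ᵥ v := fun v x => rfl
    obtain ⟨v, hv, hv0⟩ : ∃ v, v ∈ LinearMap.ker f ∧ v ≠ 0 := by
      have : LinearMap.ker f ≠ ⊥ := LinearMap.ker_ne_bot_of_finrank_lt (by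
        simp only [Module.finrank_fintype_fun_eq_card, Fintype.card_prod, Fintype.card_fin]
        omega)
      exact (Submodule.ne_bot_iff _).1 this
    have hv' : ∀ x, b x ⬝ᵥ A *ᵥ v = 0 := fun x => by rw [← hf, LinearMap.mem_ker.1 hv]; rfl
    obtain ⟨w, hw⟩ : ∃ w, v ⬝ᵥ A *ᵥ w = 1 := by
      obtain ⟨i, hi⟩ := Function.ne_iff.1 hv0
      refine ⟨A⁻¹ *ᵥ Pi.single i (v i)⁻¹, ?_⟩
      rw [Matrix.mulVec_mulVec, Matrix.mul_nonsing_inv _ (Ne.isUnit hdet), Matrix.one_mulVec,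
        dotProduct_single]
      exact mul_inv_cancel₀ hi
    -- Subtracting the components along the earlier pairs makes the vector orthogonal to them and
    -- does not affect its pairing with `v`.
    let w' := w - ∑ i : Fin k, ((b (0, i) ⬝ᵥ A *ᵥ w) • b (1, i) - (b (1, i) ⬝ᵥ A *ᵥ w) • b (0, i))
    have hbw : ∀ y : I → ℂ, y ⬝ᵥ A *ᵥ w' = y ⬝ᵥ A *ᵥ w - ∑ i : Fin k,
        ((b (0, i) ⬝ᵥ A *ᵥ w) * (y ⬝ᵥ A *ᵥ b (1, i)) -
          (b (1, i) ⬝ᵥ A *ᵥ w) * (y ⬝ᵥ A *ᵥ b (0, i))) := by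
      intro y
      simp only [w', Matrix.mulVec_sub, Matrix.mulVec_sum, Matrix.mulVec_smul, dotProduct_sub,
        dotProduct_sum, dotProduct_smul, smul_eq_mul]
    have hw1 : v ⬝ᵥ A *ᵥ w' = 1 := by
      rw [hbw, hw]
      simp [hskew v (b _), hv']
    have hw2 : ∀ x, b x ⬝ᵥ A *ᵥ w' = 0 := by
      rintro ⟨c, j⟩
      rw [hbw]
      simp only [hb, stdSymp_apply]
      fin_cases c <;> simp
    have hw3 : ∀ x, w' ⬝ᵥ A *ᵥ b x = 0 := fun x => by rw [hskew, hw2, neg_zero]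
    have hv3 : ∀ x, v ⬝ᵥ A *ᵥ b x = 0 := fun x => by rw [hskew, hv', neg_zero]
    have hw4 : w' ⬝ᵥ A *ᵥ v = -1 := by rw [hskew, hw1]
    refine ⟨fun x => Fin.cases (![v, w'] x.1) (fun i => b (x.1, i)) x.2, ?_⟩
    rintro ⟨c, i⟩ ⟨d, j⟩
    refine Fin.cases ?_ (fun i => ?_) i <;> refine Fin.cases ?_ (fun j => ?_) j
    · fin_cases c <;> fin_cases d <;> simp [stdSymp_apply, hself, hw1, hw4]
    · fin_cases c <;> simp [stdSymp_apply, hw3, hv3, (Fin.succ_ne_zero _).symm]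
    · fin_cases d <;> simp [stdSymp_apply, hw2, hv', Fin.succ_ne_zero]
    · simp [stdSymp_apply, hb]

/-- The numbering of `Fin (2 * m)` by consecutive pairs. -/
def pairEquiv (m : ℕ) : Fin 2 × Fin m ≃ Fin (2 * m) where
  toFun x := ⟨2 * x.2 + x.1, by omega⟩
  invFun j := (⟨j % 2, by omega⟩, ⟨j / 2, by omega⟩)
  left_inv x := by
    ext <;> simp <;> omega
  right_inv j := by
    ext; simp; omega

theorem pfaffian_eq_pairSum (A : Matrix (Fin (2 * m)) (Fin (2 * m)) ℂ) :
    pfaffian A = (2 ^ m * (m.factorial : ℂ))⁻¹ *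
      pairSum (A.submatrix (pairEquiv m) (pairEquiv m)) := by
  unfold pfaffian pairSum
  congr 1
  refine Fintype.sum_equiv (pairEquiv m).permCongr.symm _ _ fun σ => ?_
  congr 2
  · rw [Equiv.permCongr_symm, Equiv.Perm.sign_permCongr]
  · funext i
    simp only [Equiv.permCongr_symm, Equiv.permCongr_apply, Matrix.submatrix_apply,
      Equiv.apply_symm_apply, Equiv.symm_symm]
    rfl

/-- In a symplectic basis, with matrix `B`, the form becomes standard. The congruence rule gives
`B.det * pfaffian A = 1`, and multiplicativity of determinants gives `B.det ^ 2 * A.det = 1`. -/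
theorem pfaffian_sq (A : Matrix (Fin (2 * m)) (Fin (2 * m)) ℂ) (hA : Aᵀ = -A) (hdet : A.det ≠ 0) :
    pfaffian A ^ 2 = A.det := by
  let A' := A.submatrix (pairEquiv m) (pairEquiv m)
  have hd : A'.det = A.det := Matrix.det_submatrix_equiv_self _ _
  obtain ⟨b, hb⟩ := exists_symplectic_family A'
    (by simp only [A', Matrix.transpose_submatrix, hA]; rfl) (by rwa [hd]) m (by simp)
  let B : Matrix (Fin 2 × Fin m) (Fin 2 × Fin m) ℂ := Matrix.of fun x y => b y x
  have hB : Bᵀ * A' * B = stdSymp m := by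
    ext x y
    rw [← hb, Matrix.mul_assoc]
    rfl
  have h1 : B.det * pfaffian A = 1 := by
    rw [pfaffian_eq_pairSum, mul_left_comm, ← pairSum_congr, hB, pairSum_stdSymp]
    exact inv_mul_cancel₀ (by simp [Nat.factorial_ne_zero])
  have h2 : B.det * A.det * B.det = 1 := by
    have := congrArg Matrix.det hB
    rwa [Matrix.det_mul, Matrix.det_mul, Matrix.det_transpose, det_stdSymp, hd] at this
  have h0 : B.det ≠ 0 := left_ne_zero_of_mul_eq_one h1
  have : B.det ^ 2 * pfaffian A ^ 2 = B.det ^ 2 * A.det := by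
    linear_combination (B.det * pfaffian A + 1) * h1 - h2
  exact mul_left_cancel₀ (pow_ne_zero 2 h0) this

end Pfaffian

set_option linter.unusedSectionVars false

/-! ### The torsion of a complex with a skew-symmetric middle map. -/

section Torsion

variable {V : Type*} [AddCommGroup V] [Module ℂ V]
variable {J T ι κ : Type*} [Fintype J] [Fintype T] [Fintype ι] [Fintype κ]
  [DecidableEq J] [DecidableEq T] [DecidableEq ι] [DecidableEq κ]

/-- The matrix whose columns are the images of the vectors `c` and the vectors `B`. -/
def frame (f : V →ₗ[ℂ] (T → ℂ)) (c : ι → V) (B : κ → T → ℂ) (eT : ι ⊕ κ ≃ T) :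
    Matrix (ι ⊕ κ) (ι ⊕ κ) ℂ :=
  Matrix.of fun a b => Sum.elim (fun i => f (c i)) B b (eT a)

/-- The matrix of coordinates of `ω` and of the vectors `c`. -/
noncomputable def coordMatrix (e : Module.Basis J ℂ V) (ω : V) (c : ι → V) (eJ : Unit ⊕ ι ≃ J) :
    Matrix (Unit ⊕ ι) (Unit ⊕ ι) ℂ :=
  Matrix.of fun a b => e.repr (Sum.elim (fun _ => ω) c b) (eJ a)

/-- The Gram matrix of the vectors `B`. -/
def formGram (A : Matrix T T ℂ) (B : κ → T → ℂ) : Matrix κ κ ℂ :=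
  Matrix.of fun k l => B k ⬝ᵥ A *ᵥ B l

theorem frame_mulVec (f : V →ₗ[ℂ] (T → ℂ)) (c : ι → V) (B : κ → T → ℂ) (eT : ι ⊕ κ ≃ T)
    (w : ι ⊕ κ → ℂ) (a : ι ⊕ κ) : (frame f c B eT *ᵥ w) a =
      (∑ i, w (.inl i) • f (c i) + ∑ k, w (.inr k) • B k) (eT a) := by
  simp [frame, Matrix.mulVec, dotProduct, mul_comm]

theorem frame_indep {f : V →ₗ[ℂ] (T → ℂ)} {c : ι → V} {B : κ → T → ℂ} {eT : ι ⊕ κ ≃ T}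
    (hF : (frame f c B eT).det ≠ 0) {y : ι → ℂ} {z : κ → ℂ}
    (h : ∑ i, y i • f (c i) + ∑ k, z k • B k = 0) : y = 0 ∧ z = 0 := by
  have : Sum.elim y z = 0 := Matrix.eq_zero_of_mulVec_eq_zero hF (by
    funext a
    rw [frame_mulVec]
    simp only [Sum.elim_inl, Sum.elim_inr, h]
    rfl)
  exact ⟨funext fun i => congrFun this (.inl i), funext fun k => congrFun this (.inr k)⟩

theorem frame_span {f : V →ₗ[ℂ] (T → ℂ)} {c : ι → V} {B : κ → T → ℂ} {eT : ι ⊕ κ ≃ T}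
    (hF : (frame f c B eT).det ≠ 0) (x : T → ℂ) :
    ∃ (y : ι → ℂ) (z : κ → ℂ), x = ∑ i, y i • f (c i) + ∑ k, z k • B k := by
  let w := (frame f c B eT)⁻¹ *ᵥ (x ∘ eT)
  have hw : frame f c B eT *ᵥ w = x ∘ eT := by
    rw [Matrix.mulVec_mulVec, Matrix.mul_nonsing_inv _ (Ne.isUnit hF), Matrix.one_mulVec]
  refine ⟨fun i => w (.inl i), fun k => w (.inr k), ?_⟩
  funext t
  obtain ⟨a, rfl⟩ := eT.surjective t
  rw [← frame_mulVec, hw]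
  rfl

theorem coordMatrix_mulVec (e : Module.Basis J ℂ V) (ω : V) (c : ι → V) (eJ : Unit ⊕ ι ≃ J)
    (w : Unit ⊕ ι → ℂ) (a : Unit ⊕ ι) : (coordMatrix e ω c eJ *ᵥ w) a =
      e.repr (w (.inl ()) • ω + ∑ i, w (.inr i) • c i) (eJ a) := by
  simp [coordMatrix, Matrix.mulVec, dotProduct, mul_comm]

/-- A relation between `ω` and the vectors `c` is mapped by `f`, which kills `ω`, to a relation
between columns of a nonsingular frame. So only a multiple of `ω ≠ 0` is left. -/
theorem coordMatrix_det_ne_zero (e : Module.Basis J ℂ V) {ω : V} {c : ι → V} (eJ : Unit ⊕ ι ≃ J)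
    {f : V →ₗ[ℂ] (T → ℂ)} {B : κ → T → ℂ} {eT : ι ⊕ κ ≃ T}
    (hF : (frame f c B eT).det ≠ 0) (hω : ω ≠ 0) (hfω : f ω = 0) :
    (coordMatrix e ω c eJ).det ≠ 0 := by
  intro h
  obtain ⟨w, hw, hz⟩ := Matrix.exists_mulVec_eq_zero_iff.2 h
  have h1 : w (.inl ()) • ω + ∑ i, w (.inr i) • c i = 0 := by
    refine e.repr.injective (Finsupp.ext fun j => ?_)
    obtain ⟨a, rfl⟩ := eJ.surjective j
    rw [← coordMatrix_mulVec, hz]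
    simp
  have h2 : (fun i => w (.inr i)) = 0 ∧ (0 : κ → ℂ) = 0 := by
    refine frame_indep hF ?_
    have := congrArg f h1
    simpa [hfω] using this
  have h3 : ∀ i, w (.inr i) = 0 := fun i => congrFun h2.1 i
  have h4 : w (.inl ()) = 0 := by
    simp only [h3, zero_smul, Finset.sum_const_zero, add_zero] at h1
    exact (smul_eq_zero.1 h1).resolve_right hω
  refine hw (funext fun a => ?_)
  rcases a with ⟨⟩ | i
  · exact h4
  · exact h3 i

theorem coordMatrix_span {e : Module.Basis J ℂ V} {ω : V} {c : ι → V} {eJ : Unit ⊕ ι ≃ J}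
    (hC : (coordMatrix e ω c eJ).det ≠ 0) (v : V) :
    ∃ (s : ℂ) (y : ι → ℂ), v = s • ω + ∑ i, y i • c i := by
  let w := (coordMatrix e ω c eJ)⁻¹ *ᵥ fun a => e.repr v (eJ a)
  have hw : coordMatrix e ω c eJ *ᵥ w = fun a => e.repr v (eJ a) := by
    rw [Matrix.mulVec_mulVec, Matrix.mul_nonsing_inv _ (Ne.isUnit hC), Matrix.one_mulVec]
  refine ⟨w (.inl ()), fun i => w (.inr i), e.repr.injective (Finsupp.ext fun j => ?_)⟩
  obtain ⟨a, rfl⟩ := eJ.surjective j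
  rw [← coordMatrix_mulVec, hw]

/-- By `eJ`, the vectors `c` number one less than the dimension of `V`. Together with `ω` they form
a basis, and `f` is injective on their span. -/
theorem ker_le_of_frame (e : Module.Basis J ℂ V) {ω : V} {c : ι → V} (eJ : Unit ⊕ ι ≃ J)
    {f : V →ₗ[ℂ] (T → ℂ)} {B : κ → T → ℂ} {eT : ι ⊕ κ ≃ T}
    (hF : (frame f c B eT).det ≠ 0) (hω : ω ≠ 0) (hfω : f ω = 0) {v : V} (hv : f v = 0) :
    ∃ s : ℂ, v = s • ω := by
  obtain ⟨s, y, rfl⟩ := coordMatrix_span (coordMatrix_det_ne_zero e eJ hF hω hfω) v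
  have h2 : y = 0 ∧ (0 : κ → ℂ) = 0 := frame_indep hF (by simpa [hfω] using hv)
  exact ⟨s, by simp [h2.1]⟩

theorem dotProduct_mulVec_eq_zero {A : Matrix T T ℂ} (hA : Aᵀ = -A) {x : T → ℂ}
    (hx : A *ᵥ x = 0) (y : T → ℂ) : x ⬝ᵥ A *ᵥ y = 0 := by
  rw [Matrix.dotProduct_mulVec, ← Matrix.mulVec_transpose, hA, Matrix.neg_mulVec, hx]
  simp

/-- A vector killed by `A` is orthogonal to all vectors `B`; since `A` also kills the image of `f`,
nonsingularity of the Gram matrix removes the component along `B`. -/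
theorem mem_range_of_gram {f : V →ₗ[ℂ] (T → ℂ)} {A : Matrix T T ℂ} {c : ι → V}
    {B : κ → T → ℂ} {eT : ι ⊕ κ ≃ T} (hF : (frame f c B eT).det ≠ 0)
    (hG : (formGram A B).det ≠ 0) (hAf : ∀ v, A *ᵥ f v = 0) {x : T → ℂ} (hx : A *ᵥ x = 0) :
    ∃ v, f v = x := by
  obtain ⟨y, z, rfl⟩ := frame_span hF x
  have hz : z = 0 := Matrix.eq_zero_of_mulVec_eq_zero hG (by
    funext k
    have : B k ⬝ᵥ A *ᵥ (∑ i, y i • f (c i) + ∑ k, z k • B k) = 0 := by rw [hx]; simp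
    simp only [Matrix.mulVec_add, Matrix.mulVec_sum, Matrix.mulVec_smul, hAf, smul_zero,
      Finset.sum_const_zero, zero_add, dotProduct_sum, dotProduct_smul, smul_eq_mul] at this
    simpa only [formGram, Matrix.mulVec, dotProduct, mul_comm, Matrix.of_apply, Pi.zero_apply] using this)
  exact ⟨∑ i, y i • c i, by simp [hz]⟩

/-- Squaring absorbs the sign of a reordering, which makes the enumeration of rows immaterial below.
-/
theorem det_sq_submatrix {n : Type*} [Fintype n] [DecidableEq n] (σ : Equiv.Perm n)
    (M : Matrix n n ℂ) : (M.submatrix σ id).det ^ 2 = M.det ^ 2 := by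
  rw [Matrix.det_permute, mul_pow]
  rcases Int.units_eq_one_or (Equiv.Perm.sign σ) with h | h <;> simp [h]

theorem frame_det_sq_congr (f : V →ₗ[ℂ] (T → ℂ)) (c : ι → V) (B : κ → T → ℂ)
    (eT eT' : ι ⊕ κ ≃ T) : (frame f c B eT).det ^ 2 = (frame f c B eT').det ^ 2 := by
  rw [← det_sq_submatrix (eT.trans eT'.symm) (frame f c B eT')]
  congr 2
  ext a b
  simp [frame]

theorem coordMatrix_det_sq_congr (e : Module.Basis J ℂ V) (ω : V) (c : ι → V)
    (eJ eJ' : Unit ⊕ ι ≃ J) :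
    (coordMatrix e ω c eJ).det ^ 2 = (coordMatrix e ω c eJ').det ^ 2 := by
  rw [← det_sq_submatrix (eJ.trans eJ'.symm) (coordMatrix e ω c eJ')]
  congr 2
  ext a b
  simp [coordMatrix]

/-- Modulo `ω`, the vectors `c'` are combinations of `c` with matrix `h`; modulo the image of `f`,
the vectors `B'` are combinations of `B` with matrix `z`. Passing to the primed vectors multiplies
the coordinate determinant by `det h`, the frame determinant by `det h * det z`, and the Gram
determinant by `(det z)²`, because `A` does not see the image of `f`. The equation is multiplied
out, so the second frame may be degenerate. -/
theorem torsion_indep_aux (e : Module.Basis J ℂ V) {ω : V} {f : V →ₗ[ℂ] (T → ℂ)}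
    {A : Matrix T T ℂ} (hω : ω ≠ 0) (hfω : f ω = 0) (hA : Aᵀ = -A) (hAf : ∀ v, A *ᵥ f v = 0)
    {c c' : ι → V} {B B' : κ → T → ℂ} (eJ : Unit ⊕ ι ≃ J) (eT : ι ⊕ κ ≃ T)
    (hF : (frame f c B eT).det ≠ 0) :
    (coordMatrix e ω c' eJ).det ^ 2 * (formGram A B').det * (frame f c B eT).det ^ 2 =
      (coordMatrix e ω c eJ).det ^ 2 * (formGram A B).det * (frame f c' B' eT).det ^ 2 := by
  choose s h hc using coordMatrix_span (coordMatrix_det_ne_zero e eJ hF hω hfω)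
  choose y z hB using frame_span hF
  have h1 : coordMatrix e ω c' eJ = coordMatrix e ω c eJ *
      Matrix.fromBlocks (1 : Matrix Unit Unit ℂ) (Matrix.of fun _ j => s (c' j)) 0
        (Matrix.of fun i j => h (c' j) i) := by
    ext a b
    change _ = (coordMatrix e ω c eJ *ᵥ fun k => _) a
    rw [coordMatrix_mulVec]
    rcases b with ⟨⟩ | j
    · simp [coordMatrix]
    · conv_lhs => rw [coordMatrix, Matrix.of_apply, Sum.elim_inr, hc (c' j)]
      rfl
  have h2 : frame f c' B' eT = frame f c B eT *
      Matrix.fromBlocks (Matrix.of fun i j => h (c' j) i) (Matrix.of fun i l => y (B' l) i) 0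
        (Matrix.of fun k l => z (B' l) k) := by
    ext a b
    change _ = (frame f c B eT *ᵥ fun k => _) a
    rw [frame_mulVec]
    rcases b with j | l
    · conv_lhs => rw [frame, Matrix.of_apply, Sum.elim_inl, hc (c' j)]
      simp [hfω]
    · conv_lhs => rw [frame, Matrix.of_apply, Sum.elim_inr, hB (B' l)]
      rfl
  have h3 : formGram A B' = (Matrix.of fun k l => z (B' l) k)ᵀ * formGram A B *
      (Matrix.of fun k l => z (B' l) k) := by
    have h4 : ∀ l, A *ᵥ B' l = ∑ k, z (B' l) k • A *ᵥ B k := by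
      intro l
      conv_lhs => rw [hB (B' l)]
      simp [Matrix.mulVec_add, Matrix.mulVec_sum, Matrix.mulVec_smul, hAf]
    have h5 : ∀ k x, B' k ⬝ᵥ A *ᵥ x = ∑ l, z (B' k) l * (B l ⬝ᵥ A *ᵥ x) := by
      intro k x
      conv_lhs => rw [hB (B' k)]
      simp [add_dotProduct, sum_dotProduct, smul_dotProduct,
        dotProduct_mulVec_eq_zero hA (hAf _)]
    ext k l
    rw [Matrix.mul_assoc]
    simp only [formGram, Matrix.of_apply, Matrix.mul_apply, Matrix.transpose_apply]
    rw [h5]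
    refine Finset.sum_congr rfl fun m _ => ?_
    rw [h4]
    simp [dotProduct_sum, dotProduct_smul, mul_comm]
  rw [h1, h2, h3]
  simp only [Matrix.det_mul, Matrix.det_fromBlocks_zero₂₁, Matrix.det_transpose, Matrix.det_one]
  ring

/-- The torsion does not depend on the choice of the vectors by which it is computed. -/
theorem torsion_indep {ι' κ' : Type*} [Fintype ι'] [Fintype κ'] [DecidableEq ι'] [DecidableEq κ']
    (e : Module.Basis J ℂ V) {ω : V} {f : V →ₗ[ℂ] (T → ℂ)}
    {A : Matrix T T ℂ} (hω : ω ≠ 0) (hfω : f ω = 0) (hA : Aᵀ = -A) (hAf : ∀ v, A *ᵥ f v = 0)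
    {c : ι → V} {c' : ι' → V} {B : κ → T → ℂ} {B' : κ' → T → ℂ}
    (eJ : Unit ⊕ ι ≃ J) (eT : ι ⊕ κ ≃ T) (eJ' : Unit ⊕ ι' ≃ J) (eT' : ι' ⊕ κ' ≃ T)
    (hF : (frame f c B eT).det ≠ 0) :
    (coordMatrix e ω c' eJ').det ^ 2 * (formGram A B').det * (frame f c B eT).det ^ 2 =
      (coordMatrix e ω c eJ).det ^ 2 * (formGram A B).det * (frame f c' B' eT').det ^ 2 := by
  have hJ := Fintype.card_congr (eJ.trans eJ'.symm)
  have hT := Fintype.card_congr (eT.trans eT'.symm)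
  simp only [Fintype.card_sum] at hJ hT
  -- The index types of the two frames have equal sizes, since both are complementary to the same
  -- `J` and `T`. Matching them reduces to the case of common index types.
  let a : ι ≃ ι' := Fintype.equivOfCardEq (by omega)
  let b : κ ≃ κ' := Fintype.equivOfCardEq (by omega)
  have h1 : (coordMatrix e ω c' eJ').det =
      (coordMatrix e ω (c' ∘ a) (((Equiv.refl _).sumCongr a).trans eJ')).det := by
    rw [← Matrix.det_submatrix_equiv_self ((Equiv.refl _).sumCongr a)]
    congr 1
    ext x y
    rcases y with y | y <;> rfl
  have h2 : (frame f c' B' eT').det =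
      (frame f (c' ∘ a) (B' ∘ b) ((a.sumCongr b).trans eT')).det := by
    rw [← Matrix.det_submatrix_equiv_self (a.sumCongr b)]
    congr 1
    ext x y
    rcases y with y | y <;> rfl
  have h3 : (formGram A B').det = (formGram A (B' ∘ b)).det := by
    rw [← Matrix.det_submatrix_equiv_self b]
    rfl
  rw [h1, h2, h3, coordMatrix_det_sq_congr e ω (c' ∘ a) _ eJ,
    frame_det_sq_congr f (c' ∘ a) (B' ∘ b) _ eT]
  exact torsion_indep_aux e hω hfω hA hAf eJ eT hF

/-- The two determinants are integers with product one. -/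
theorem det_sq_eq_one_of_integral {n : Type*} [Fintype n] [DecidableEq n] {P Q : Matrix n n ℂ}
    (hPQ : P * Q = 1) (hP : ∀ i j, ∃ x : ℤ, P i j = x) (hQ : ∀ i j, ∃ x : ℤ, Q i j = x) :
    P.det ^ 2 = 1 := by
  choose p hp using hP
  choose q hq using hQ
  have h1 : P = (Int.castRingHom ℂ).mapMatrix (Matrix.of p) := by ext i j; simp [hp]
  have h2 : Q = (Int.castRingHom ℂ).mapMatrix (Matrix.of q) := by ext i j; simp [hq]
  have h3 : (Matrix.of p).det * (Matrix.of q).det = 1 := by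
    have := congrArg Matrix.det hPQ
    rw [Matrix.det_mul, h1, h2, ← RingHom.map_det, ← RingHom.map_det, Matrix.det_one] at this
    simp only [eq_intCast] at this
    exact_mod_cast this
  rw [h1, ← RingHom.map_det]
  rcases Int.eq_one_or_neg_one_of_mul_eq_one h3 with h | h <;> simp [h]

theorem exists_int_repr_of_mem_span (e : Module.Basis J ℂ V) {v : V}
    (hv : v ∈ Submodule.span ℤ (Set.range e)) (j : J) : ∃ x : ℤ, e.repr v j = x := by
  induction hv using Submodule.span_induction with
  | mem v h =>
    obtain ⟨i, rfl⟩ := h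
    by_cases hij : i = j
    · exact ⟨1, by simp [hij]⟩
    · exact ⟨0, by simp [hij]⟩
  | zero => exact ⟨0, by simp⟩
  | add v w _ _ hv hw =>
    obtain ⟨x, hx⟩ := hv
    obtain ⟨y, hy⟩ := hw
    exact ⟨x + y, by simp [hx, hy]⟩
  | smul n v _ hv =>
    obtain ⟨x, hx⟩ := hv
    exact ⟨n * x, by simp [hx]⟩

theorem coordMatrix_eq_mul {J' : Type*} [Fintype J'] [DecidableEq J'] (e : Module.Basis J ℂ V)
    (e' : Module.Basis J' ℂ V) (ω : V) (c : ι → V) (eJ : Unit ⊕ ι ≃ J) (eJ' : Unit ⊕ ι ≃ J') :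
    coordMatrix e' ω c eJ' =
      (Matrix.of fun a b => e'.repr (e (eJ b)) (eJ' a)) * coordMatrix e ω c eJ := by
  ext a b
  simp only [Matrix.mul_apply, coordMatrix, Matrix.of_apply]
  generalize Sum.elim (fun _ => ω) c b = v
  conv_lhs => rw [← e.sum_repr v]
  rw [← eJ.sum_comp]
  simp [mul_comm]

/-- The determinant of the coordinates does not change, up to a sign, under an integral change of
the basis. -/
theorem coordMatrix_det_sq_of_integral {J' : Type*} [Fintype J'] [DecidableEq J'] (e : Module.Basis J ℂ V)
    (e' : Module.Basis J' ℂ V) (h : ∀ j, e j ∈ Submodule.span ℤ (Set.range e'))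
    (h' : ∀ j, e' j ∈ Submodule.span ℤ (Set.range e)) (ω : V) (c : ι → V) (eJ : Unit ⊕ ι ≃ J)
    (eJ' : Unit ⊕ ι ≃ J') :
    (coordMatrix e' ω c eJ').det ^ 2 = (coordMatrix e ω c eJ).det ^ 2 := by
  rw [coordMatrix_eq_mul e e' ω c eJ eJ', Matrix.det_mul, mul_pow]
  rw [det_sq_eq_one_of_integral (Q := Matrix.of fun a b => e.repr (e' (eJ' b)) (eJ a)), one_mul]
  · ext a b
    simp only [Matrix.mul_apply, Matrix.of_apply]
    have : e'.repr (∑ j, e.repr (e' (eJ' b)) j • e j) (eJ' a) = (1 : Matrix _ _ ℂ) a b := by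
      rw [e.sum_repr, e'.repr_self, Matrix.one_apply, Finsupp.single_apply]
      simp [eq_comm]
    rw [← this, ← eJ.sum_comp]
    simp [mul_comm]
  · exact fun a b => exists_int_repr_of_mem_span e' (h _) _
  · exact fun a b => exists_int_repr_of_mem_span e (h' _) _

/-- The numbering of the coordinates which starts with `i₀`. -/
def colEquiv {k : ℕ} {i₀ : J} (col : Fin k ≃ {i : J // i ≠ i₀}) : Unit ⊕ Fin k ≃ J :=
  ((Equiv.ofUnique Unit {i : J // i = i₀}).sumCongr col).trans (Equiv.sumCompl (· = i₀))

theorem colEquiv_inl {k : ℕ} {i₀ : J} (col : Fin k ≃ {i : J // i ≠ i₀}) (u : Unit) :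
    colEquiv col (.inl u) = i₀ :=
  (default : {i : J // i = i₀}).2

theorem colEquiv_inr {k : ℕ} {i₀ : J} (col : Fin k ≃ {i : J // i ≠ i₀}) (a : Fin k) :
    colEquiv col (.inr a) = (col a).1 := rfl

/-- For the basis vectors other than `i₀` the matrix of coordinates is block triangular, and only
the coordinate of `ω` is left. Together with `frame_row_det` and `formGram_single` this identifies
the minors of the definition with a special choice of frame. -/
theorem coordMatrix_col_det (e : Module.Basis J ℂ V) (ω : V) {k : ℕ} {i₀ : J}
    (col : Fin k ≃ {i : J // i ≠ i₀}) :
    (coordMatrix e ω (fun a => e (col a).1) (colEquiv col)).det = e.repr ω i₀ := by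
  have : coordMatrix e ω (fun a => e (col a).1) (colEquiv col) =
      Matrix.fromBlocks (Matrix.of fun _ _ : Unit => e.repr ω i₀) 0
        (Matrix.of fun a (_ : Unit) => e.repr ω (col a).1) 1 := by
    ext a b
    rcases a with a | a <;> rcases b with b | b
    · simp [coordMatrix, colEquiv_inl]
    · simp [coordMatrix, colEquiv_inl, (col b).2]
    · simp [coordMatrix, colEquiv_inr]
    · simp [coordMatrix, colEquiv_inr, Finsupp.single_apply, Matrix.one_apply, Subtype.val_inj,
        eq_comm]
  rw [this, Matrix.det_fromBlocks_zero₁₂]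
  simp

open Classical in
theorem frame_row_det (f : V →ₗ[ℂ] (T → ℂ)) {k l : ℕ} (c : Fin k → V) {R : Set T}
    (row : Fin k ≃ {t // t ∈ R}) (rest : Fin l ≃ {t // t ∉ R}) :
    (frame f c (fun a => Pi.single (rest a).1 1)
      ((row.sumCongr rest).trans (Equiv.sumCompl (· ∈ R)))).det =
      (Matrix.of fun a b => f (c b) (row a).1).det := by
  have : frame f c (fun a => Pi.single (rest a).1 1)
      ((row.sumCongr rest).trans (Equiv.sumCompl (· ∈ R))) =
      Matrix.fromBlocks (Matrix.of fun a b => f (c b) (row a).1) 0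
        (Matrix.of fun a b => f (c b) (rest a).1) 1 := by
    ext a b
    rcases a with a | a <;> rcases b with b | b
    · simp [frame]
    · have : (row a).1 ≠ (rest b).1 := fun h => (rest b).2 (h ▸ (row a).2)
      simp [frame, this]
    · simp [frame]
    · simp [frame, Pi.single_apply, Matrix.one_apply, Subtype.val_inj]
  rw [this, Matrix.det_fromBlocks_zero₁₂, Matrix.det_one, mul_one]

theorem formGram_single {l : ℕ} (A : Matrix T T ℂ) (r : Fin l → T) :
    formGram A (fun a => Pi.single (r a) 1) = A.submatrix r r := by
  ext a b
  simp [formGram]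

/-- Rows and columns with nonzero minors exist. -/
theorem exists_torsion_minors (e : Module.Basis J ℂ V) {ω : V} {f : V →ₗ[ℂ] (T → ℂ)}
    {A : Matrix T T ℂ} (hω : ω ≠ 0) (hfω : f ω = 0)
    (hker : ∀ v, f v = 0 → ∃ s : ℂ, v = s • ω)
    (hA : Aᵀ = -A) (hex : ∀ x, A *ᵥ x = 0 → ∃ v, f v = x) (hAf : ∀ v, A *ᵥ f v = 0) :
    ∃ (i₀ : J) (R : Set T) (k m : ℕ) (col : Fin k ≃ {i : J // i ≠ i₀})
      (row : Fin k ≃ {t // t ∈ R}) (rest : Fin (2 * m) ≃ {t // t ∉ R}),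
      e.repr ω i₀ ≠ 0 ∧ (Matrix.of fun a b => f (e (col b).1) (row a).1).det ≠ 0 ∧
      (A.submatrix (fun a => (rest a).1) (fun a => (rest a).1)).det ≠ 0 := by
  classical
  obtain ⟨i₀, hi₀⟩ : ∃ i, e.repr ω i ≠ 0 := by
    by_contra! h
    exact hω (e.repr.injective (Finsupp.ext fun i => by simp [h i]))
  let ι := {i : J // i ≠ i₀}
  have hinj : ∀ x : ι → ℂ, f (∑ i, x i • e i.1) = 0 → x = 0 := by
    intro x hx
    obtain ⟨s, hs⟩ := hker _ hx
    have h1 : ∀ j, e.repr (∑ i : ι, x i • e i.1) j = ∑ i : ι, x i * if i.1 = j then 1 else 0 := by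
      intro j
      simp [Finsupp.single_apply]
    have h2 : s = 0 := by
      have := h1 i₀
      rw [hs, Finset.sum_eq_zero fun i _ => by rw [if_neg i.2, mul_zero]] at this
      simpa [hi₀] using this
    funext j
    have := h1 j.1
    rw [hs, h2] at this
    rw [Finset.sum_eq_single j (fun i _ hi => by
      rw [if_neg fun h => hi (Subtype.ext h), mul_zero]) (by simp), if_pos rfl, mul_one,
      zero_smul, map_zero] at this
    exact this.symm
  let M : Matrix T ι ℂ := Matrix.of fun t i => f (e i.1) t
  have hM : ∀ x, M *ᵥ x = f (∑ i, x i • e i.1) := by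
    intro x; funext t
    simp [M, Matrix.mulVec, dotProduct, mul_comm]
  have hspan : Submodule.span ℂ (Set.range M.row) = ⊤ := by
    have h1 : M.rank = Fintype.card ι := by
      have := LinearMap.finrank_range_of_inj (f := M.mulVecLin) (by
        rw [← LinearMap.ker_eq_bot, LinearMap.ker_eq_bot']
        intro x hx
        exact hinj x (by rw [← hM]; exact hx))
      rw [Matrix.rank, this, Module.finrank_fintype_fun_eq_card]
    refine Submodule.eq_top_of_finrank_eq ?_
    rw [← Matrix.rank_eq_finrank_span_row, h1, Module.finrank_fintype_fun_eq_card]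
  -- The columns other than `i₀` are independent, so a maximal independent set of rows has exactly
  -- as many members and supplies a square minor.
  obtain ⟨μ, a, ha, hs, hli⟩ := exists_linearIndependent' ℂ M.row
  have : Finite μ := Finite.of_injective a ha
  have : Fintype μ := Fintype.ofFinite μ
  let b := Module.Basis.mk hli (by rw [hs, hspan])
  have hcard : Fintype.card μ = Fintype.card ι := by
    have := Module.finrank_eq_card_basis b
    rw [Module.finrank_fintype_fun_eq_card] at this
    exact this.symm
  let R : Set T := Set.range a
  let S := {t // t ∉ R}
  let eμ : Fin (Fintype.card ι) ≃ μ := Fintype.equivOfCardEq (by simp [hcard])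
  let row : Fin (Fintype.card ι) ≃ {t // t ∈ R} := eμ.trans (Equiv.ofInjective a ha)
  have hrow : ∀ x, (row x).1 = a (eμ x) := fun x => rfl
  let col := (Fintype.equivFin ι).symm
  have hminor : (Matrix.of fun x y => f (e (col y).1) (row x).1).det ≠ 0 := by
    intro h0
    obtain ⟨w, hw, hz⟩ := Matrix.exists_vecMul_eq_zero_iff.2 h0
    have h1 : ∑ x, w x • (M.row ∘ a ∘ eμ) x = 0 := by
      funext i
      have := congrFun hz (col.symm i)
      simp only [Matrix.vecMul, dotProduct, Matrix.of_apply, Equiv.apply_symm_apply,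
        Pi.zero_apply] at this
      simp only [Finset.sum_apply, Pi.smul_apply, Function.comp_apply, smul_eq_mul, Pi.zero_apply]
      rw [← this]
      rfl
    have hli' : LinearIndependent ℂ (M.row ∘ a ∘ eμ) := hli.comp eμ eμ.injective
    exact hw (funext fun x => Fintype.linearIndependent_iff.1 hli' w h1 x)
  let A' : Matrix S S ℂ := A.submatrix Subtype.val Subtype.val
  -- A kernel vector of the complementary block, extended by zero to `x`, is killed by the whole
  -- matrix `A`, hence lies in the image of `f`. As it vanishes on the rows of the nonzero minor, it
  -- is zero.
  have hA' : A'.det ≠ 0 := by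
    intro h0
    obtain ⟨w, hw, hz⟩ := Matrix.exists_mulVec_eq_zero_iff.2 h0
    let x : T → ℂ := fun t => if h : t ∉ R then w ⟨t, h⟩ else 0
    have hxR : ∀ t ∈ R, x t = 0 := fun t ht => dif_neg (not_not.2 ht)
    have hxS : ∀ s : S, x s.1 = w s := fun s => dif_pos s.2
    have hsum : ∀ g : T → ℂ, ∑ t, g t * x t = ∑ s : S, g s.1 * w s := by
      intro g
      rw [← Equiv.sum_comp (Equiv.sumCompl (· ∈ R)), Fintype.sum_sum_type]
      rw [Finset.sum_eq_zero fun t _ => by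
        rw [Equiv.sumCompl_apply_inl, hxR _ t.2, mul_zero], zero_add]
      exact Finset.sum_congr rfl fun s _ => by rw [Equiv.sumCompl_apply_inr, hxS]
    have h1 : ∀ t, t ∉ R → (A *ᵥ x) t = 0 := by
      intro t ht
      have := congrFun hz ⟨t, ht⟩
      simp only [Matrix.mulVec, dotProduct, hsum] at this ⊢
      exact this
    -- the vector `A *ᵥ x` is supported on `R` and orthogonal to the image of `f`
    have h2 : A *ᵥ x = 0 := by
      have h3 : ∀ v, f v ⬝ᵥ A *ᵥ x = 0 := fun v => dotProduct_mulVec_eq_zero hA (hAf v) x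
      have h4 : ∀ y, (A *ᵥ x) (row y).1 = 0 := by
        have : (Matrix.of fun x y => f (e (col y).1) (row x).1)ᵀ *ᵥ
            (fun y => (A *ᵥ x) (row y).1) = 0 := by
          funext i
          have := h3 (e (col i).1)
          rw [dotProduct, ← Equiv.sum_comp (Equiv.sumCompl (· ∈ R)), Fintype.sum_sum_type] at this
          simp only [Equiv.sumCompl_apply_inl, Equiv.sumCompl_apply_inr] at this
          rw [Finset.sum_eq_zero (s := (Finset.univ : Finset {t // ¬ t ∈ R})) fun t _ => by
            rw [h1 _ t.2, mul_zero], add_zero, ← row.sum_comp] at this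
          exact this
        have := Matrix.eq_zero_of_mulVec_eq_zero (by rwa [Matrix.det_transpose]) this
        exact fun y => congrFun this y
      funext t
      by_cases ht : t ∈ R
      · have := h4 (row.symm ⟨t, ht⟩)
        rwa [Equiv.apply_symm_apply] at this
      · exact h1 t ht
    obtain ⟨v, hv⟩ := hex x h2
    obtain ⟨s, y, hsy⟩ : ∃ (s : ℂ) (y : Fin (Fintype.card ι) → ℂ),
        v = s • ω + ∑ i, y i • e (col i).1 :=
      coordMatrix_span (e := e) (eJ := colEquiv col) (by rwa [coordMatrix_col_det]) v
    have hy : y = 0 := Matrix.eq_zero_of_mulVec_eq_zero hminor (by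
      funext a
      have h5 := congrFun hv (row a).1
      rw [hxR _ (row a).2, hsy] at h5
      simpa [hfω, Matrix.mulVec, dotProduct, mul_comm] using h5)
    rw [hy] at hsy
    simp only [Pi.zero_apply, zero_smul, Finset.sum_const_zero, add_zero] at hsy
    refine hw (funext fun t => ?_)
    rw [← hxS, ← hv, hsy, map_smul, hfω, smul_zero]
    rfl
  -- A nonsingular skew-symmetric matrix has even size; this allows the remaining rows to be
  -- numbered by `Fin (2 * m)`.
  have heven : Even (Fintype.card S) := by
    have h1 : A'ᵀ = -A' := by
      rw [Matrix.transpose_submatrix, hA]; rfl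
    have h2 : A'.det = (-1) ^ Fintype.card S * A'.det := by
      conv_lhs => rw [← Matrix.det_transpose, h1, Matrix.det_neg]
    by_contra hodd
    rw [Nat.not_even_iff_odd] at hodd
    rw [hodd.neg_one_pow, neg_one_mul] at h2
    exact hA' (self_eq_neg.1 h2)
  obtain ⟨m, hm⟩ := heven
  let rest : Fin (2 * m) ≃ S := Fintype.equivOfCardEq (by rw [hm, Fintype.card_fin]; omega)
  refine ⟨i₀, R, _, m, col, row, rest, hi₀, hminor, ?_⟩
  rw [← Matrix.det_submatrix_equiv_self rest] at hA'
  exact hA'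

end Torsion

/-! ### Faces, coboundaries and maximal trees. -/

namespace TriComplex

variable {Λ : Type v} [LinearOrder Λ] (X : TriComplex.{u} Λ)

theorem verts_sub {k j : ℕ} (σ : X.Simp k) (s : Finset (Fin (k + 1))) (hs : s.card = j + 1) :
    X.verts (X.sub σ s hs).1 = s.map (X.vtx σ).toEmbedding := by
  refine X.verts_face _ _ (X.map_vtx_subset σ s) ?_
  rw [← Finset.card_pos, Finset.card_map, hs]
  exact Nat.succ_pos j

theorem vtx_sub {k j : ℕ} (σ : X.Simp k) (s : Finset (Fin (k + 1))) (hs : s.card = j + 1)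
    (x : Fin (j + 1)) : X.vtx (X.sub σ s hs) x = X.vtx σ (s.orderEmbOfFin hs x) := by
  have : (fun x => X.vtx σ (s.orderEmbOfFin hs x)) = X.vtx (X.sub σ s hs) := by
    refine Finset.orderEmbOfFin_unique _ (fun x => ?_)
      ((X.vtx σ).strictMono.comp (s.orderEmbOfFin hs).strictMono)
    rw [verts_sub]
    exact Finset.mem_map_of_mem _ (Finset.orderEmbOfFin_mem _ _ _)
  exact (congrFun this x).symm

theorem sub_congr {k j : ℕ} (σ : X.Simp k) {s s' : Finset (Fin (k + 1))} (h : s = s')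
    (hs : s.card = j + 1) : X.sub σ s hs = X.sub σ s' (h ▸ hs) := by
  subst h; rfl

theorem sub_sub {k j i : ℕ} (σ : X.Simp k) (s : Finset (Fin (k + 1))) (hs : s.card = j + 1)
    (s' : Finset (Fin (j + 1))) (hs' : s'.card = i + 1) :
    X.sub (X.sub σ s hs) s' hs' =
      X.sub σ (s'.map (s.orderEmbOfFin hs).toEmbedding) (by simp [hs']) := by
  refine Subtype.ext ?_
  have h1 : s'.map (X.vtx (X.sub σ s hs)).toEmbedding =
      (s'.map (s.orderEmbOfFin hs).toEmbedding).map (X.vtx σ).toEmbedding := by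
    rw [Finset.map_map]
    congr 1
    ext x
    exact X.vtx_sub σ s hs x
  change X.face (X.face σ.1 _) _ = X.face σ.1 _
  rw [h1, X.face_face]
  · refine Finset.map_subset_map.2 fun x hx => ?_
    obtain ⟨y, -, rfl⟩ := Finset.mem_map.1 hx
    exact Finset.orderEmbOfFin_mem _ _ _
  · exact X.map_vtx_subset σ s
  · rw [← Finset.card_pos]
    simp [hs']

theorem sub_injective {k j : ℕ} (σ : X.Simp k) {s s' : Finset (Fin (k + 1))}
    {hs : s.card = j + 1} {hs' : s'.card = j + 1} (h : X.sub σ s hs = X.sub σ s' hs') : s = s' := by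
  have := congrArg (fun τ => X.verts τ.1) h
  simp only [verts_sub] at this
  exact Finset.map_injective _ this

theorem d_injective {k : ℕ} (σ : X.Simp (k + 1)) : Function.Injective (X.d σ) := by
  intro m n h
  by_contra hne
  have := X.sub_injective σ h
  exact (Finset.mem_erase.1 (this ▸ Finset.mem_erase.2 ⟨hne, Finset.mem_univ m⟩)).1 rfl

theorem map_orderEmb_erase {N : ℕ} (n : Fin (N + 1)) (s : Finset (Fin N)) {k : ℕ} (hk : k = N)
    (h : (Finset.univ.erase n).card = k) (s' : Finset (Fin k)) (hs : s' = s.map (finCongr hk.symm).toEmbedding) :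
    s'.map ((Finset.univ.erase n).orderEmbOfFin h).toEmbedding = s.map n.succAboveEmb := by
  subst hk
  have : (n.succAbove : Fin k → Fin (k + 1)) = (Finset.univ.erase n).orderEmbOfFin h :=
    Finset.orderEmbOfFin_unique h (fun x => by simp [Fin.succAbove_ne]) n.strictMono_succAbove
  subst hs
  ext x
  simp [Finset.mem_map, ← this]

theorem sub_d {k j : ℕ} (σ : X.Simp (k + 1)) (n : Fin (k + 2)) (s : Finset (Fin (k + 1)))
    (hs : s.card = j + 1) :
    X.sub (X.d σ n) s hs = X.sub σ (s.map n.succAboveEmb) (by simp [hs]) := by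
  unfold d
  rw [sub_sub]
  exact X.sub_congr _ (map_orderEmb_erase n s rfl _ _ (by simp)) _

theorem map_erase_succAbove {k : ℕ} (n : Fin (k + 2)) (j : Fin (k + 1)) :
    (Finset.univ.erase j).map n.succAboveEmb = (Finset.univ.erase n).erase (n.succAbove j) := by
  ext x
  by_cases hx : x = n
  · subst hx
    simp [Fin.succAbove_ne]
  · obtain ⟨y, rfl⟩ := Fin.exists_succAbove_eq hx
    simp [Fin.succAbove_ne]

/-- The value of a cochain on the face with the given vertex numbers. -/
noncomputable def ev {k j : ℕ} (σ : X.Simp k) (c : X.Simp j → ℂ) (s : Finset (Fin (k + 1))) : ℂ :=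
  if h : s.card = j + 1 then c (X.sub σ s h) else 0

theorem ev_of_card {k j : ℕ} (σ : X.Simp k) (c : X.Simp j → ℂ) {s : Finset (Fin (k + 1))}
    (h : s.card = j + 1) : X.ev σ c s = c (X.sub σ s h) := dif_pos h

theorem apply_d_d {k : ℕ} (σ : X.Simp (k + 2)) (c : X.Simp k → ℂ) (n : Fin (k + 3))
    (j : Fin (k + 2)) :
    c (X.d (X.d σ n) j) = X.ev σ c ((Finset.univ.erase n).erase (n.succAbove j)) := by
  have h : X.d (X.d σ n) j = X.sub σ ((Finset.univ.erase j).map n.succAboveEmb) (by simp) :=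
    X.sub_d σ n _ _
  rw [h, ← X.ev_of_card σ c, map_erase_succAbove]

/-- The number `n.succAbove j` is `j` below `n` and `j + 1` above it, so the signed terms are
antisymmetric in the two omitted vertices. This is the combinatorial core of the vanishing of the
double coboundary. -/
theorem sum_succAbove_eq_zero {k : ℕ} (h : Fin (k + 2) → Fin (k + 2) → ℂ)
    (hh : ∀ n m, h n m = h m n) :
    ∑ n : Fin (k + 2), (-1 : ℂ) ^ (n : ℕ) *
      ∑ j : Fin (k + 1), (-1 : ℂ) ^ (j : ℕ) * h n (n.succAbove j) = 0 := by
  let f : Fin (k + 2) → Fin (k + 2) → ℂ := fun n m =>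
    if m = n then 0 else (-1) ^ ((n : ℕ) + m) * (if n < m then -1 else 1) * h n m
  have hf : ∀ n m, f n m = - f m n := by
    intro n m
    simp only [f]
    rcases lt_trichotomy n m with hnm | rfl | hnm
    · rw [if_neg hnm.ne', if_pos hnm, if_neg hnm.ne, if_neg hnm.not_gt, hh m n, add_comm (m : ℕ)]
      ring
    · simp
    · rw [if_neg hnm.ne, if_neg hnm.not_gt, if_neg hnm.ne', if_pos hnm, hh m n, add_comm (m : ℕ)]
      ring
  have h1 : ∀ n : Fin (k + 2), (-1 : ℂ) ^ (n : ℕ) *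
      ∑ j : Fin (k + 1), (-1 : ℂ) ^ (j : ℕ) * h n (n.succAbove j) = ∑ m, f n m := by
    intro n
    rw [Fin.sum_univ_succAbove _ n, Finset.mul_sum]
    simp only [f, if_true, zero_add]
    refine Finset.sum_congr rfl fun j _ => ?_
    rw [if_neg (Fin.succAbove_ne n j)]
    rcases lt_or_ge j.castSucc n with hj | hj
    · rw [Fin.succAbove_of_castSucc_lt n j hj, if_neg hj.not_gt]
      simp only [Fin.val_castSucc]
      ring
    · rw [Fin.succAbove_of_le_castSucc n j hj, if_pos (Fin.lt_def.2 (by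
        have := Fin.le_def.1 hj
        simp only [Fin.val_castSucc] at this
        simp only [Fin.val_succ]; omega))]
      simp only [Fin.val_succ]
      ring
  rw [Finset.sum_congr rfl fun n _ => h1 n]
  have h2 : ∑ n, ∑ m, f n m = - ∑ n, ∑ m, f n m := by
    conv_lhs => rw [Finset.sum_comm]
    rw [← Finset.sum_neg_distrib]
    refine Finset.sum_congr rfl fun n _ => ?_
    rw [← Finset.sum_neg_distrib]
    exact Finset.sum_congr rfl fun m _ => hf m n
  exact self_eq_neg.1 h2

theorem coboundary_coboundary (k : ℕ) (c : X.Simp k → ℂ) :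
    X.coboundary (k + 1) (X.coboundary k c) = 0 := by
  funext σ
  change ∑ n : Fin (k + 3), (-1 : ℂ) ^ (n : ℕ) *
    ∑ j : Fin (k + 2), (-1 : ℂ) ^ (j : ℕ) * c (X.d (X.d σ n) j) = 0
  simp only [X.apply_d_d]
  exact sum_succAbove_eq_zero (fun n m => X.ev σ c ((Finset.univ.erase n).erase m))
    fun n m => by rw [Finset.erase_right_comm]

theorem coboundary_mem_Z2 (y : X.Simp 1 → ℂ) : X.coboundary 1 y ∈ X.Z2 :=
  X.coboundary_coboundary 1 y

theorem edgeCob_mem_Z2 (b : X.Simp 1) : X.edgeCob b ∈ X.Z2 := X.coboundary_mem_Z2 _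

theorem coboundary_eq_sum (y : X.Simp 1 → ℂ) : X.coboundary 1 y = ∑ b, y b • X.edgeCob b := by
  classical
  conv_lhs => rw [← Finset.univ_sum_single y]
  rw [map_sum]
  refine Finset.sum_congr rfl fun b _ => ?_
  unfold edgeCob
  rw [← map_smul]
  congr 1
  funext x
  by_cases h : x = b
  · subst h; simp
  · simp [h]

theorem isTetCocycle_res {c : X.Simp 2 → ℂ} (hc : c ∈ X.Z2) (t : X.Simp 3) :
    IsTetCocycle (X.res t c) :=
  congrFun (LinearMap.mem_ker.1 hc) t

/-- Any increasing enumeration of `s` is allowed, which admits explicit ones such as `Fin.cons 0 f`.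
-/
theorem coboundary_sub {k l : ℕ} (σ : X.Simp l) (c : X.Simp k → ℂ) {s : Finset (Fin (l + 1))}
    (hs : s.card = k + 2) {f : Fin (k + 2) → Fin (l + 1)} (hf : StrictMono f)
    (hfs : ∀ x, f x ∈ s) :
    X.coboundary k c (X.sub σ s hs) =
      ∑ n : Fin (k + 2), (-1 : ℂ) ^ (n : ℕ) * X.ev σ c (s.erase (f n)) := by
  have hfe := Finset.orderEmbOfFin_unique hs hfs hf
  change ∑ n : Fin (k + 2), (-1 : ℂ) ^ (n : ℕ) * c (X.d (X.sub σ s hs) n) = _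
  refine Finset.sum_congr rfl fun n _ => ?_
  congr 1
  have h1 : (Finset.univ.erase n).map (s.orderEmbOfFin hs).toEmbedding = s.erase (f n) := by
    rw [Finset.map_erase, Finset.map_orderEmbOfFin_univ, hfe]
    rfl
  have h2 : (s.erase (f n)).card = k + 1 := by rw [Finset.card_erase_of_mem (hfs n), hs]; rfl
  rw [X.ev_of_card σ c h2]
  unfold d
  rw [sub_sub, X.sub_congr σ h1]

/-- A 2-cocycle is a coboundary within one pentachoron. -/
theorem exists_coboundary_eq {c : X.Simp 2 → ℂ} (hc : c ∈ X.Z2) (p : X.Simp 4) :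
    ∃ y : X.Simp 1 → ℂ, ∀ s (hs : s.card = 3), c (X.sub p s hs) = X.coboundary 1 y (X.sub p s hs) := by
  classical
  -- The cone construction with the vertex `0` as the apex: the cochain takes on the edge `ij` the
  -- value of the cocycle on `0ij`, and zero on the edges that contain `0`.
  let Y : Finset (Fin 5) → ℂ := fun s => if 0 ∈ s then 0 else X.ev p c (insert 0 s)
  let y : X.Simp 1 → ℂ := fun b => ∑ s : Finset (Fin 5),
    if h : s.card = 2 then if X.sub p s h = b then Y s else 0 else 0
  have hy : ∀ s, s.card = 2 → X.ev p y s = Y s := by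
    intro s hs
    rw [X.ev_of_card p y hs]
    simp only [y]
    rw [Finset.sum_eq_single s, dif_pos hs, if_pos rfl]
    · intro s' _ hne
      split_ifs with h1 h2
      · exact absurd (X.sub_injective p h2) hne
      · rfl
      · rfl
    · simp
  refine ⟨y, fun s hs => ?_⟩
  have hcard : ∀ {s : Finset (Fin 5)} (f : Fin 3 → Fin 5), (∀ x, f x ∈ s) → s.card = 3 →
      ∀ n, X.ev p y (s.erase (f n)) = Y (s.erase (f n)) := fun f hf hs n =>
    hy _ (by rw [Finset.card_erase_of_mem (hf n), hs])
  by_cases h0 : 0 ∈ s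
  · let f := s.orderEmbOfFin hs
    have hf : ∀ x, f x ∈ s := Finset.orderEmbOfFin_mem s hs
    have hf0 : f 0 = 0 := by
      obtain ⟨x, hx⟩ : (0 : Fin 5) ∈ Set.range f := by
        rw [Finset.range_orderEmbOfFin]; exact h0
      have := f.monotone (Fin.zero_le x)
      rw [hx] at this
      exact Fin.le_zero_iff.1 this
    have hf1 : ∀ x : Fin 2, f x.succ ≠ 0 := fun x h =>
      absurd (f.injective (h.trans hf0.symm)) (Fin.succ_ne_zero x)
    rw [X.coboundary_sub p y hs f.strictMono hf]
    simp only [hcard f hf hs]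
    rw [Fin.sum_univ_succ, Finset.sum_eq_zero]
    · simp only [hf0, Y, Finset.notMem_erase, if_false, Finset.insert_erase h0]
      rw [X.ev_of_card p c hs]
      simp
    · intro x _
      simp only [Y]
      rw [if_pos (Finset.mem_erase.2 ⟨(hf1 x).symm, h0⟩), mul_zero]
  · let f := s.orderEmbOfFin hs
    have hf : ∀ x, f x ∈ s := Finset.orderEmbOfFin_mem s hs
    have hs' : (insert 0 s).card = 4 := by rw [Finset.card_insert_of_notMem h0, hs]
    have hf0 : ∀ x, f x ≠ 0 := fun x h => h0 (h ▸ hf x)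
    have hcons : StrictMono (Fin.cons 0 f : Fin 4 → Fin 5) := by
      refine Fin.strictMono_iff_lt_succ.2 fun i => ?_
      refine Fin.cases ?_ (fun i => ?_) i
      · exact Fin.pos_iff_ne_zero.2 (hf0 0)
      · exact f.strictMono (Fin.castSucc_lt_succ)
    -- The cocycle condition in the tetrahedron spanned by `0` and `s`, to be solved for the face
    -- `s`.
    have h1 : X.coboundary 2 c (X.sub p (insert 0 s) hs') = 0 :=
      congrFun (LinearMap.mem_ker.1 hc) _
    rw [X.coboundary_sub p c hs' hcons (by
      intro x
      refine Fin.cases ?_ (fun i => ?_) x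
      · exact Finset.mem_insert_self _ _
      · exact Finset.mem_insert_of_mem (hf i))] at h1
    rw [Fin.sum_univ_succ] at h1
    simp only [Fin.cons_zero, Fin.cons_succ, Finset.erase_insert h0, Fin.val_zero, pow_zero,
      one_mul, Fin.val_succ, pow_succ, mul_neg, mul_one, neg_mul, Finset.sum_neg_distrib] at h1
    rw [X.coboundary_sub p y hs f.strictMono hf, ← X.ev_of_card p c hs]
    simp only [hcard f hf hs]
    rw [add_neg_eq_zero.1 h1]
    refine Finset.sum_congr rfl fun n _ => ?_
    simp only [Y]
    rw [if_neg (fun h => h0 (Finset.mem_of_mem_erase h)),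
      Finset.erase_insert_of_ne (hf0 n).symm]

theorem coboundary_zero_apply (χ : X.Simp 0 → ℂ) (e : X.Simp 1) :
    X.coboundary 0 χ e = χ (X.d e 0) - χ (X.d e 1) := by
  simp [coboundary, Fin.sum_univ_two, sub_eq_add_neg]

/-- The vanishing of the double coboundary of an integral 0-cochain, read as an integral relation
between edge coboundaries. All the integrality statements about cocycle bases come from such
relations. -/
theorem sum_smul_edgeCob_eq_zero (χ : X.Simp 0 → ℤ) :
    ∑ e, (χ (X.d e 0) - χ (X.d e 1)) • X.edgeCob e = 0 := by
  have h1 := X.coboundary_coboundary 0 fun v => (χ v : ℂ)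
  rw [X.coboundary_eq_sum] at h1
  rw [← h1]
  refine Finset.sum_congr rfl fun e _ => ?_
  rw [coboundary_zero_apply, ← Int.cast_sub, Int.cast_smul_eq_zsmul]

/-- The order of the labels orients every edge, so the ordered pairs of ends of two edges are never
reverse to each other. -/
theorem vtx_d_zero_lt (e : X.Simp 1) : X.vtx (X.d e 1) 0 < X.vtx (X.d e 0) 0 := by
  have h : ∀ n : Fin 2, X.vtx (X.d e n) 0 = X.vtx e (1 - n) := by
    intro n
    unfold d
    rw [vtx_sub]
    congr 1
    have h1 := Finset.orderEmbOfFin_mem (Finset.univ.erase n) (k := 1) (by simp) (0 : Fin 1)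
    have h2 : ∀ n z : Fin 2, z ∈ Finset.univ.erase n → z = 1 - n := by decide
    exact h2 n _ h1
  rw [h, h]
  exact (X.vtx e).strictMono (by decide)

/-- Cutting a maximal tree at one of its edges. -/
theorem IsSpanningTree.exists_cut {X : TriComplex.{u} Λ} {T : Set (X.Simp 1)}
    (hT : X.IsSpanningTree T) {b : X.Simp 1} (hb : b ∈ T) :
    ∃ χ : X.Simp 0 → ℤ, χ (X.d b 0) - χ (X.d b 1) = 1 ∧
      ∀ e ∈ T, e ≠ b → χ (X.d e 0) - χ (X.d e 1) = 0 := by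
  classical
  obtain ⟨hinj, htree⟩ := hT
  set G := SimpleGraph.fromRel fun v w : X.Simp 0 => ∃ e ∈ T, X.d e 0 = v ∧ X.d e 1 = w with hG
  have hadj : ∀ e ∈ T, G.Adj (X.d e 0) (X.d e 1) := by
    intro e he
    rw [hG, SimpleGraph.fromRel_adj]
    exact ⟨fun h => absurd (X.d_injective e h) (by decide), Or.inl ⟨e, he, rfl, rfl⟩⟩
  have hbr := SimpleGraph.isAcyclic_iff_forall_adj_isBridge.1 htree.isAcyclic (hadj b hb)
  rw [SimpleGraph.isBridge_iff] at hbr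
  let G' := G.deleteEdges {s(X.d b 0, X.d b 1)}
  -- The indicator function of one of the two components into which the tree falls when the bridge
  -- `b` is removed.
  refine ⟨fun v => if G'.Reachable (X.d b 0) v then 1 else 0, ?_, ?_⟩
  · simp only []
    rw [if_pos (SimpleGraph.Reachable.refl _), if_neg hbr]; rfl
  · intro e he hne
    have h1 : G'.Adj (X.d e 0) (X.d e 1) := by
      rw [SimpleGraph.deleteEdges_adj]
      refine ⟨hadj e he, fun h => ?_⟩
      rw [Set.mem_singleton_iff, Sym2.eq_iff] at h
      -- Distinct tree edges have distinct ordered pairs of ends, although the complex may have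
      -- multiple edges; the reversed pair is excluded by the order of the labels.
      rcases h with h | h
      · exact hne (hinj he hb (Prod.ext h.1 h.2))
      · have h2 := X.vtx_d_zero_lt e
        rw [h.1, h.2] at h2
        exact absurd h2 (X.vtx_d_zero_lt b).not_gt
    have h3 : G'.Reachable (X.d b 0) (X.d e 0) ↔ G'.Reachable (X.d b 0) (X.d e 1) :=
      ⟨fun h => h.trans h1.reachable, fun h => h.trans h1.symm.reachable⟩
    simp only [h3, sub_self]

end TriComplex

/-! ### The bilinear form of one tetrahedron. -/

/-- In the symmetric part the area term drops out. What is left is the coboundary of the 2-cochain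
`c c' / ω`, so it cancels over the boundary of a pentachoron. -/
theorem tetForm_add_swap (q c c' : Fin 4 → ℂ) (hq : ∀ n, q n ≠ 0) :
    tetForm q c c' + tetForm q c' c = ∑ n : Fin 4, (-1 : ℂ) ^ (n : ℕ) * (c n * c' n / q n ^ 2) := by
  have h0 := hq 0
  have h1 := hq 1
  have h2 := hq 2
  have h3 := hq 3
  simp only [tetForm, Fin.sum_univ_four, Fin.prod_univ_four]
  field_simp
  ring

/-- The antisymmetric part is the area term alone; multiplying by all four roots clears its
denominators. -/
theorem tetForm_sub_swap_mul (q c c' : Fin 4 → ℂ) (hq : ∀ n, q n ≠ 0) :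
    (tetForm q c c' - tetForm q c' c) * ∏ n, q n =
      q 3 ^ 2 * (c 1 * c' 2 - c 2 * c' 1) + q 1 ^ 2 * (c 2 * c' 3 - c 3 * c' 2) +
        q 2 ^ 2 * (c 3 * c' 1 - c 1 * c' 3) := by
  have h0 := hq 0
  have h1 := hq 1
  have h2 := hq 2
  have h3 := hq 3
  simp only [tetForm, Fin.sum_univ_four, Fin.prod_univ_four]
  field_simp
  ring

/-- The factors of the form of a tetrahedron are determined up to rescaling. -/
theorem exists_rescaling {q : Fin 4 → ℂ} (hq : ∀ n, q n ≠ 0)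
    {β γ β' γ' : (Fin 4 → ℂ) →ₗ[ℂ] ℂ}
    (h : ∀ c c', IsTetCocycle c → IsTetCocycle c' → β c * γ c' = tetForm q c c')
    (h' : ∀ c c', IsTetCocycle c → IsTetCocycle c' → β' c * γ' c' = tetForm q c c') :
    ∃ l : ℂ, l ≠ 0 ∧ ∀ c, IsTetCocycle c → β' c = l * β c ∧ l * γ' c = γ c := by
  have h0 := hq 0
  have h1 := hq 1
  have h2 := hq 2
  have h3 := hq 3
  obtain ⟨a, b, ha, hb, hab⟩ : ∃ a b, IsTetCocycle a ∧ IsTetCocycle b ∧ tetForm q a b ≠ 0 := by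
    -- For these two cocycles the antisymmetric part, times the product of the roots, equals `q 3 ^
    -- 2 ≠ 0`; hence the form is nonzero on them in at least one of the two orders.
    let a : Fin 4 → ℂ := ![1, 1, 0, 0]
    let b : Fin 4 → ℂ := ![-1, 0, 1, 0]
    have ha : IsTetCocycle a := by simp [IsTetCocycle, a, Fin.sum_univ_four]
    have hb : IsTetCocycle b := by simp [IsTetCocycle, b, Fin.sum_univ_four]
    have h4 := tetForm_sub_swap_mul q a b hq
    have h5 : q 3 ^ 2 * (a 1 * b 2 - a 2 * b 1) + q 1 ^ 2 * (a 2 * b 3 - a 3 * b 2) +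
        q 2 ^ 2 * (a 3 * b 1 - a 1 * b 3) = q 3 ^ 2 := by simp [a, b]
    by_cases hab : tetForm q a b = 0
    · refine ⟨b, a, hb, ha, fun hba => ?_⟩
      rw [hab, hba, h5] at h4
      rw [sub_self, zero_mul] at h4
      exact pow_ne_zero 2 h3 h4.symm
    · exact ⟨a, b, ha, hb, hab⟩
  have e1 := h a b ha hb
  have e2 := h' a b ha hb
  have n1 : β a ≠ 0 := fun h => hab (by rw [← e1, h, zero_mul])
  have n2 : γ b ≠ 0 := fun h => hab (by rw [← e1, h, mul_zero])
  have n3 : β' a ≠ 0 := fun h => hab (by rw [← e2, h, zero_mul])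
  have n4 : γ' b ≠ 0 := fun h => hab (by rw [← e2, h, mul_zero])
  refine ⟨γ b / γ' b, div_ne_zero n2 n4, fun c hc => ⟨?_, ?_⟩⟩
  · have e3 := h c b hc hb
    have e4 := h' c b hc hb
    field_simp
    rw [e4, ← e3, mul_comm]
  · have e3 := h a c ha hc
    have e4 := h' a c ha hc
    -- The scalar can be read off from either factor, because both products give the same value of
    -- the form at `(a, b)`.
    have e5 : γ b / γ' b = β' a / β a := by
      field_simp
      linear_combination e1 - e2
    rw [e5]
    field_simp
    rw [e4, ← e3]

/-- The values of the coboundary of the edge `ab` on the 2-faces of a tetrahedron. -/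
def edgeVec (a b : Fin 4) : Fin 4 → ℂ := fun n => ∑ k : Fin 3, (-1) ^ (k : ℕ) *
  if (Finset.univ.erase n).erase (n.succAbove k) = {a, b} then 1 else 0

theorem edgeVec_eq (a b n : Fin 4) : edgeVec a b n = ((∑ k : Fin 3, (-1) ^ (k : ℕ) *
    if (Finset.univ.erase n).erase (n.succAbove k) = {a, b} then 1 else 0 : ℤ) : ℂ) := by
  simp [edgeVec]

/-- The 2×2 minors of the two incidence vectors are `0` or `±1`, a finite check. For `a ≠ 0` a
single value of `w` is left; for `a = 0` the combination `w 3 + w 1 - w 2` appears, which equals `w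
0` by the cocycle condition. Squaring disposes of the sign. -/
theorem edgeVec_wedge {w : Fin 4 → ℂ} (hw : ∑ n : Fin 4, (-1 : ℂ) ^ (n : ℕ) * w n = 0)
    {a b c : Fin 4} (hab : a ≠ b) (hac : a ≠ c) (hbc : b ≠ c) :
    (w 3 * (edgeVec a b 1 * edgeVec a c 2 - edgeVec a b 2 * edgeVec a c 1) +
      w 1 * (edgeVec a b 2 * edgeVec a c 3 - edgeVec a b 3 * edgeVec a c 2) +
        w 2 * (edgeVec a b 3 * edgeVec a c 1 - edgeVec a b 1 * edgeVec a c 3)) ^ 2 = w a ^ 2 := by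
  let M : Fin 4 → Fin 4 → Fin 4 → ℤ := fun a b n => ∑ k : Fin 3, (-1) ^ (k : ℕ) *
    if (Finset.univ.erase n).erase (n.succAbove k) = {a, b} then 1 else 0
  have hM : ∀ a b n, edgeVec a b n = (M a b n : ℂ) := edgeVec_eq
  have key : ∀ a b c : Fin 4, a ≠ b → a ≠ c → b ≠ c →
      (M a b 1 * M a c 2 - M a b 2 * M a c 1, M a b 2 * M a c 3 - M a b 3 * M a c 2,
        M a b 3 * M a c 1 - M a b 1 * M a c 3) ∈
      ![({(1, 1, -1), (-1, -1, 1)} : Finset (ℤ × ℤ × ℤ)), {(0, 1, 0), (0, -1, 0)},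
        {(0, 0, 1), (0, 0, -1)}, {(1, 0, 0), (-1, 0, 0)}] a := by decide
  have h := key a b c hab hac hbc
  simp only [hM]
  simp only [← Int.cast_mul, ← Int.cast_sub]
  generalize M a b 1 * M a c 2 - M a b 2 * M a c 1 = u₁ at h ⊢
  generalize M a b 2 * M a c 3 - M a b 3 * M a c 2 = u₂ at h ⊢
  generalize M a b 3 * M a c 1 - M a b 1 * M a c 3 = u₃ at h ⊢
  have hw0 : w 3 + w 1 - w 2 = w 0 := by
    rw [Fin.sum_univ_four] at hw
    norm_num at hw
    linear_combination -hw
  clear hM key hab hac hbc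
  fin_cases a <;> simp only [Finset.mem_insert, Finset.mem_singleton, Prod.mk.injEq, Fin.zero_eta,
    Fin.mk_one, Fin.reduceFinMk, Matrix.cons_val] at h <;>
    rcases h with ⟨rfl, rfl, rfl⟩ | ⟨rfl, rfl, rfl⟩ <;>
    push_cast <;> first | ring1 | (change _ = w 0 ^ 2; rw [← hw0]; ring1)

/-! ### Edge operators and the Gaussian weight of a pentachoron. -/

namespace TriComplex

variable {Λ : Type v} [LinearOrder Λ] (X : TriComplex.{u} Λ)

theorem edgeCob_apply_d (t : X.Simp 3) {s : Finset (Fin 4)} (hs : s.card = 2) (n : Fin 4) :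
    X.edgeCob (X.sub t s hs) (X.d t n) = ∑ k : Fin 3, (-1) ^ (k : ℕ) *
      if (Finset.univ.erase n).erase (n.succAbove k) = s then 1 else 0 := by
  classical
  change ∑ k : Fin 3, (-1 : ℂ) ^ (k : ℕ) *
    (Pi.single (X.sub t s hs) 1 : X.Simp 1 → ℂ) (X.d (X.d t n) k) = _
  refine Finset.sum_congr rfl fun k _ => ?_
  congr 1
  have h1 : ((Finset.univ.erase n).erase (n.succAbove k)).card = 2 := by
    rw [Finset.card_erase_of_mem (by simp [Fin.succAbove_ne])]; simp
  rw [X.apply_d_d t (Pi.single (X.sub t s hs) 1 : X.Simp 1 → ℂ) n k, X.ev_of_card _ _ h1,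
    Pi.single_apply]
  congr 1
  exact propext ⟨fun h => X.sub_injective t h, fun h => X.sub_congr t h h1⟩

theorem res_edgeCob (t : X.Simp 3) {a b : Fin 4} (hs : ({a, b} : Finset (Fin 4)).card = 2) :
    X.res t (X.edgeCob (X.sub t {a, b} hs)) = edgeVec a b := by
  funext n
  exact X.edgeCob_apply_d t hs n

theorem res_edgeCob_eq_zero (t : X.Simp 3) {b : X.Simp 1}
    (hb : ∀ s (hs : s.card = 2), b ≠ X.sub t s hs) : X.res t (X.edgeCob b) = 0 := by
  classical
  funext n
  change ∑ k : Fin 3, (-1 : ℂ) ^ (k : ℕ) *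
    (Pi.single b 1 : X.Simp 1 → ℂ) (X.d (X.d t n) k) = 0
  refine Finset.sum_eq_zero fun k _ => ?_
  have h1 : ((Finset.univ.erase n).erase (n.succAbove k)).card = 2 := by
    rw [Finset.card_erase_of_mem (by simp [Fin.succAbove_ne])]; simp
  rw [X.apply_d_d t (Pi.single b 1 : X.Simp 1 → ℂ) n k, X.ev_of_card _ _ h1, Pi.single_apply,
    if_neg (hb _ h1).symm, mul_zero]

theorem eq_zero_of_span {I N : Type*} [Fintype N] {v : I → N → ℂ}
    (hv : Submodule.span ℂ (Set.range v) = ⊤) {x : N → ℂ} (hx : ∀ i, ∑ m, v i m * x m = 0) :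
    x = 0 := by
  classical
  let f : (N → ℂ) →ₗ[ℂ] ℂ := ∑ m, x m • LinearMap.proj m
  have hf : f = 0 := LinearMap.ext_on_range hv fun i => by
    simp only [f, LinearMap.sum_apply, LinearMap.smul_apply, LinearMap.proj_apply, smul_eq_mul,
      LinearMap.zero_apply]
    rw [← hx i]
    exact Finset.sum_congr rfl fun m _ => mul_comm _ _
  funext m
  have := LinearMap.congr_fun hf (Pi.single m 1)
  simpa [f, Pi.single_apply] using this

/-- The Gaussian matrix is determined by the edge operators. -/
theorem gaussian_rescaling {I N : Type*} [Fintype N] {v v' w w' : I → N → ℂ} {F F' : Matrix N N ℂ}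
    {l : N → ℂ} {s : ℂ} (hv : Submodule.span ℂ (Set.range v) = ⊤)
    (h : ∀ i n, w i n = ∑ m, v i m * F m n) (h' : ∀ i n, w' i n = ∑ m, v' i m * F' m n)
    (hv' : ∀ i m, v' i m = l m * v i m) (hw' : ∀ i n, l n * w' i n = s * w i n) (m n : N) :
    l m * l n * F' m n = s * F m n := by
  have := eq_zero_of_span (x := fun m => l m * l n * F' m n - s * F m n) hv (fun i => by
    have h1 := hw' i n
    rw [h, h', Finset.mul_sum, Finset.mul_sum, ← sub_eq_zero, ← Finset.sum_sub_distrib] at h1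
    rw [← h1]
    refine Finset.sum_congr rfl fun m _ => ?_
    rw [hv']; ring)
  exact sub_eq_zero.1 (congrFun this m)

namespace Coloring

variable {X} {ε : X.Simp 4 → ℤˣ} (D : X.Coloring ε)

/-- The sign with which a tetrahedron enters the boundary of a pentachoron. -/
noncomputable def bdSign (ε : X.Simp 4 → ℤˣ) (p : X.Simp 4) (n : Fin 5) : ℂ :=
  ((ε p : ℤ) : ℂ) * (-1) ^ (n : ℕ)

theorem bdSign_sq (p : X.Simp 4) (n : Fin 5) : bdSign ε p n ^ 2 = 1 := by
  rcases Int.units_eq_one_or (ε p) with h | h <;>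
    simp [bdSign, h, ← pow_mul, mul_comm _ 2]

/-- Inside one pentachoron every cocycle is a coboundary, hence a combination of edge coboundaries,
and the relation is linear. -/
theorem annihilate_of_mem_Z2 {c : X.Simp 2 → ℂ} (hc : c ∈ X.Z2) (p : X.Simp 4) (n : Fin 5) :
    bdSign ε p n * D.γ (X.d p n) (X.res (X.d p n) c) =
      ∑ m : Fin 5, D.β (X.d p m) (X.res (X.d p m) c) * D.F p m n := by
  obtain ⟨y, hy⟩ := X.exists_coboundary_eq hc p
  have h1 : ∀ m, X.res (X.d p m) c = ∑ b, y b • X.res (X.d p m) (X.edgeCob b) := by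
    intro m
    simp only [← map_smul, ← map_sum, ← X.coboundary_eq_sum]
    funext k
    change c (X.d (X.d p m) k) = X.coboundary 1 y (X.d (X.d p m) k)
    have h2 : ((Finset.univ.erase m).erase (m.succAbove k)).card = 3 := by
      rw [Finset.card_erase_of_mem (by simp [Fin.succAbove_ne])]; simp
    rw [X.apply_d_d p c, X.apply_d_d p (X.coboundary 1 y), X.ev_of_card p _ h2,
      X.ev_of_card p _ h2, hy]
  simp only [h1, map_sum, map_smul, smul_eq_mul, Finset.mul_sum, Finset.sum_mul]
  rw [Finset.sum_comm]
  refine Finset.sum_congr rfl fun b _ => ?_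
  simp only [mul_assoc, ← Finset.mul_sum]
  rw [← D.annihilate p b n]
  simp only [bdSign]
  ring

/-- Evaluated on two edges, the symmetric part of `F` becomes the signed sum, over the boundary of
the pentachoron, of the symmetrized tetrahedral forms. This is a double coboundary and vanishes. The
edge vectors span, so the symmetric part itself is zero. -/
theorem F_skew (p : X.Simp 4) (m n : Fin 5) : D.F p m n = -D.F p n m := by
  let v : X.Simp 1 → Fin 5 → ℂ := fun b m => D.β (X.d p m) (X.res (X.d p m) (X.edgeCob b))
  have hv : Submodule.span ℂ (Set.range v) = ⊤ := D.span_eq_top p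
  have h1 : ∀ b b', ∑ n, (∑ m, v b m * D.F p m n) * v b' n =
      ∑ n, bdSign ε p n * tetForm (X.res (X.d p n) D.q) (X.res (X.d p n) (X.edgeCob b'))
        (X.res (X.d p n) (X.edgeCob b)) := by
    intro b b'
    refine Finset.sum_congr rfl fun n _ => ?_
    rw [← D.annihilate_of_mem_Z2 (X.edgeCob_mem_Z2 b) p n, ← D.β_mul_γ _ _ _
      (X.isTetCocycle_res (X.edgeCob_mem_Z2 b') _) (X.isTetCocycle_res (X.edgeCob_mem_Z2 b) _)]
    ring
  have h2 : ∀ b b', ∑ n, (∑ m, v b m * D.F p m n) * v b' n +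
      ∑ n, (∑ m, v b' m * D.F p m n) * v b n = 0 := by
    intro b b'
    rw [h1, h1, ← Finset.sum_add_distrib]
    have h3 := congrFun (X.coboundary_coboundary 2
      fun s => X.edgeCob b' s * X.edgeCob b s / D.q s ^ 2) p
    have h4 : ∀ n : Fin 5, bdSign ε p n * tetForm (X.res (X.d p n) D.q)
        (X.res (X.d p n) (X.edgeCob b')) (X.res (X.d p n) (X.edgeCob b)) +
        bdSign ε p n * tetForm (X.res (X.d p n) D.q)
        (X.res (X.d p n) (X.edgeCob b)) (X.res (X.d p n) (X.edgeCob b')) =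
        ((ε p : ℤ) : ℂ) * ((-1) ^ (n : ℕ) * X.coboundary 2
          (fun s => X.edgeCob b' s * X.edgeCob b s / D.q s ^ 2) (X.d p n)) := by
      intro n
      rw [← mul_add, tetForm_add_swap (X.res (X.d p n) D.q) _ _ fun _ => D.q_ne_zero _, bdSign,
        mul_assoc]
      rfl
    rw [Finset.sum_congr rfl fun n _ => h4 n, ← Finset.mul_sum]
    have h5 : ∑ n : Fin 5, (-1 : ℂ) ^ (n : ℕ) * X.coboundary 2
          (fun s => X.edgeCob b' s * X.edgeCob b s / D.q s ^ 2) (X.d p n) = 0 := h3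
    rw [h5, mul_zero]
  have h6 : ∀ b', (fun m => ∑ n, (D.F p m n + D.F p n m) * v b' n) = 0 := by
    intro b'
    refine eq_zero_of_span hv fun b => ?_
    rw [← h2 b b']
    simp only [Finset.mul_sum, Finset.sum_mul]
    conv_rhs => enter [1]; rw [Finset.sum_comm]
    rw [← Finset.sum_add_distrib]
    refine Finset.sum_congr rfl fun m _ => ?_
    rw [← Finset.sum_add_distrib]
    exact Finset.sum_congr rfl fun n _ => by ring
  have h7 : ∀ m, (fun n => D.F p m n + D.F p n m) = 0 := by
    intro m
    refine eq_zero_of_span hv fun b => ?_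
    exact (Finset.sum_congr rfl fun n _ => mul_comm _ _).trans (congrFun (h6 b) m)
  exact eq_neg_of_add_eq_zero_left (congrFun (h7 m) n)

theorem F_self (p : X.Simp 4) (m : Fin 5) : D.F p m m = 0 := self_eq_neg.1 (D.F_skew p m m)

/-- The component, in the `m`-th 3-face of a pentachoron, of the edge spanned by the given
vertices. -/
noncomputable def bEdge (p : X.Simp 4) (s : Finset (Fin 5)) (m : Fin 5) : ℂ :=
  if h : s.card = 2 then D.β (X.d p m) (X.res (X.d p m) (X.edgeCob (X.sub p s h))) else 0

/-- The same for the second functional. -/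
noncomputable def gEdge (p : X.Simp 4) (s : Finset (Fin 5)) (m : Fin 5) : ℂ :=
  if h : s.card = 2 then D.γ (X.d p m) (X.res (X.d p m) (X.edgeCob (X.sub p s h))) else 0

/-- The square root at the 2-face which does not contain the vertices `x` and `y`. -/
noncomputable def qOpp (p : X.Simp 4) (x y : Fin 5) : ℂ :=
  X.ev p D.q ((Finset.univ.erase x).erase y)

theorem qOpp_comm (p : X.Simp 4) (x y : Fin 5) : D.qOpp p x y = D.qOpp p y x := by
  unfold qOpp
  rw [Finset.erase_right_comm]

theorem qOpp_ne_zero (p : X.Simp 4) {x y : Fin 5} (h : x ≠ y) : D.qOpp p x y ≠ 0 := by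
  unfold qOpp
  rw [X.ev_of_card]
  · exact D.q_ne_zero _
  · rw [Finset.card_erase_of_mem (by simp [h.symm])]; simp

theorem res_edgeCob_sub_eq_zero (p : X.Simp 4) {s : Finset (Fin 5)} (hs : s.card = 2) {m : Fin 5}
    (hm : m ∈ s) : X.res (X.d p m) (X.edgeCob (X.sub p s hs)) = 0 := by
  refine X.res_edgeCob_eq_zero _ fun s' hs' h => ?_
  rw [X.sub_d] at h
  have := X.sub_injective p h
  rw [this] at hm
  obtain ⟨y, -, hy⟩ := Finset.mem_map.1 hm
  exact Fin.succAbove_ne m y hy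

theorem bEdge_eq_zero (p : X.Simp 4) {s : Finset (Fin 5)} {m : Fin 5} (hm : m ∈ s) :
    D.bEdge p s m = 0 := by
  unfold bEdge
  split_ifs with h
  · rw [res_edgeCob_sub_eq_zero p h hm, map_zero]
  · rfl

theorem gEdge_eq_zero (p : X.Simp 4) {s : Finset (Fin 5)} {m : Fin 5} (hm : m ∈ s) :
    D.gEdge p s m = 0 := by
  unfold gEdge
  split_ifs with h
  · rw [res_edgeCob_sub_eq_zero p h hm, map_zero]
  · rfl

theorem annihilate_edge (p : X.Simp 4) (s : Finset (Fin 5)) (n : Fin 5) :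
    bdSign ε p n * D.gEdge p s n = ∑ m, D.bEdge p s m * D.F p m n := by
  unfold gEdge bEdge
  split_ifs with h
  · exact D.annihilate p _ n
  · simp

/-- Edges outside of the pentachoron have zero components, so the spanning assumption would fail. A
nonzero component makes the relation that defines `η ^ 2` effective. -/
theorem exists_bEdge_ne_zero (p : X.Simp 4) : ∃ s m, D.bEdge p s m ≠ 0 := by
  by_contra! h
  have h1 := D.span_eq_top p
  have h2 : (fun b : X.Simp 1 => fun m : Fin 5 =>
      D.β (X.d p m) (X.res (X.d p m) (X.edgeCob b))) = fun _ => 0 := by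
    funext b m
    by_cases hb : ∃ s, ∃ hs : s.card = 2, b = X.sub p s hs
    · obtain ⟨s, hs, rfl⟩ := hb
      have := h s m
      rw [bEdge, dif_pos hs] at this
      exact this
    · push Not at hb
      rw [X.res_edgeCob_eq_zero _ fun s' hs' h => ?_, map_zero]
      · rfl
      · rw [X.sub_d] at h
        exact hb _ _ h
  rw [h2] at h1
  have h3 : (Pi.single 0 1 : Fin 5 → ℂ) ∈ (⊤ : Submodule ℂ (Fin 5 → ℂ)) := trivial
  have h4 : Set.range (fun _ : X.Simp 1 => (0 : Fin 5 → ℂ)) ⊆ {0} := by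
    rintro _ ⟨_, rfl⟩; rfl
  rw [← h1] at h3
  have h5 := Submodule.span_mono h4 h3
  rw [Submodule.span_zero_singleton, Submodule.mem_bot] at h5
  simpa using congrFun h5 0

theorem exists_perm (x y m : Fin 5) (hxy : x ≠ y) (hx : x ≠ m) (hy : y ≠ m) :
    ∃ σ : Equiv.Perm (Fin 5), σ 0 = x ∧ σ 1 = y ∧ σ 4 = m := by
  have h : ∀ x y m : Fin 5, x ≠ y → x ≠ m → y ≠ m → ∃ k l : Fin 5,
      Function.Injective ![x, y, k, l, m] := by decide
  obtain ⟨k, l, hkl⟩ := h x y m hxy hx hy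
  exact ⟨Equiv.ofBijective _ (Finite.injective_iff_bijective.1 hkl), rfl, rfl, rfl⟩

theorem map_eq_erase (σ : Equiv.Perm (Fin 5)) {s : Finset (Fin 5)} {x y : Fin 5}
    (h : s = (Finset.univ.erase x).erase y) :
    s.map σ.toEmbedding = (Finset.univ.erase (σ x)).erase (σ y) := by
  subst h
  simp [Finset.map_erase]

/-- The restrictions on the permutation are removed by symmetry: exchanging both pairs `0,1` and
`2,3` keeps the parity and the 2×2 minor of `F`, while exchanging only `2,3` reverses the sign of
both. -/
theorem η_sq_perm (p : X.Simp 4) (σ : Equiv.Perm (Fin 5)) :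
    D.η p ^ 2 * (D.F p (σ 1) (σ 3) * D.F p (σ 0) (σ 2) - D.F p (σ 1) (σ 2) * D.F p (σ 0) (σ 3)) =
      ((Equiv.Perm.sign σ : ℤ) : ℂ) * (D.bEdge p {σ 0, σ 1} (σ 4) * (D.qOpp p (σ 3) (σ 4) *
        D.qOpp p (σ 2) (σ 4) * D.qOpp p (σ 2) (σ 3) * D.qOpp p (σ 0) (σ 1))) := by
  have base : ∀ σ : Equiv.Perm (Fin 5), Equiv.Perm.sign σ = 1 → σ 0 < σ 1 →
      D.η p ^ 2 * (D.F p (σ 1) (σ 3) * D.F p (σ 0) (σ 2) -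
        D.F p (σ 1) (σ 2) * D.F p (σ 0) (σ 3)) =
      D.bEdge p {σ 0, σ 1} (σ 4) * (D.qOpp p (σ 3) (σ 4) *
        D.qOpp p (σ 2) (σ 4) * D.qOpp p (σ 2) (σ 3) * D.qOpp p (σ 0) (σ 1)) := by
    intro σ h1 h2
    rw [D.η_sq p σ h1 h2]
    have hq : ∀ (s : Finset (Fin 5)) (x y : Fin 5) (hs : (s.map σ.toEmbedding).card = 2 + 1),
        s = (Finset.univ.erase x).erase y → D.q (X.sub p (s.map σ.toEmbedding) hs) =
          D.qOpp p (σ x) (σ y) := by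
      intro s x y hs h
      rw [qOpp, ← map_eq_erase σ h, X.ev_of_card p _ hs]
    have hb : ∀ (hs : ((({0, 1} : Finset (Fin 5)).map σ.toEmbedding)).card = 1 + 1),
        D.β (X.d p (σ 4)) (X.res (X.d p (σ 4)) (X.edgeCob (X.sub p
          (({0, 1} : Finset (Fin 5)).map σ.toEmbedding) hs))) = D.bEdge p {σ 0, σ 1} (σ 4) := by
      intro hs
      have : ({0, 1} : Finset (Fin 5)).map σ.toEmbedding = {σ 0, σ 1} := by simp
      rw [bEdge, dif_pos (this ▸ hs), X.sub_congr p this]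
    rw [hb, hq _ 3 4 _ (by decide), hq _ 2 4 _ (by decide), hq _ 2 3 _ (by decide),
      hq _ 0 1 _ (by decide)]
    ring
  have even : ∀ σ : Equiv.Perm (Fin 5), Equiv.Perm.sign σ = 1 →
      D.η p ^ 2 * (D.F p (σ 1) (σ 3) * D.F p (σ 0) (σ 2) -
        D.F p (σ 1) (σ 2) * D.F p (σ 0) (σ 3)) =
      D.bEdge p {σ 0, σ 1} (σ 4) * (D.qOpp p (σ 3) (σ 4) *
        D.qOpp p (σ 2) (σ 4) * D.qOpp p (σ 2) (σ 3) * D.qOpp p (σ 0) (σ 1)) := by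
    intro σ h1
    rcases lt_or_ge (σ 0) (σ 1) with h | h
    · exact base σ h1 h
    · have hlt : σ 1 < σ 0 := lt_of_le_of_ne h fun h => absurd (σ.injective h) (by decide)
      have e := base (σ * (Equiv.swap 0 1 * Equiv.swap 2 3)) (by
        rw [Equiv.Perm.sign_mul, h1, one_mul]; decide)
      simp only [Equiv.Perm.mul_apply, show (Equiv.swap 0 1 : Equiv.Perm (Fin 5)) (Equiv.swap 2 3 0) = 1 by decide,
        show (Equiv.swap 0 1 : Equiv.Perm (Fin 5)) (Equiv.swap 2 3 1) = 0 by decide,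
        show (Equiv.swap 0 1 : Equiv.Perm (Fin 5)) (Equiv.swap 2 3 2) = 3 by decide,
        show (Equiv.swap 0 1 : Equiv.Perm (Fin 5)) (Equiv.swap 2 3 3) = 2 by decide,
        show (Equiv.swap 0 1 : Equiv.Perm (Fin 5)) (Equiv.swap 2 3 4) = 4 by decide] at e
      have e := e hlt
      rw [Finset.pair_comm, D.qOpp_comm p (σ 3) (σ 2), D.qOpp_comm p (σ 1) (σ 0)] at e
      linear_combination e
  rcases Int.units_eq_one_or (Equiv.Perm.sign σ) with h | h
  · rw [even σ h, h]; simp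
  · have e := even (σ * Equiv.swap 2 3) (by rw [Equiv.Perm.sign_mul, h]; decide)
    simp only [Equiv.Perm.mul_apply, show (Equiv.swap 2 3 : Equiv.Perm (Fin 5)) 0 = 0 by decide,
      show (Equiv.swap 2 3 : Equiv.Perm (Fin 5)) 1 = 1 by decide,
      show (Equiv.swap 2 3 : Equiv.Perm (Fin 5)) 2 = 3 by decide,
      show (Equiv.swap 2 3 : Equiv.Perm (Fin 5)) 3 = 2 by decide,
      show (Equiv.swap 2 3 : Equiv.Perm (Fin 5)) 4 = 4 by decide] at e
    rw [D.qOpp_comm p (σ 3) (σ 2)] at e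
    rw [h]
    push_cast
    linear_combination -e

/-- The two orders of the factors differ by a known quantity for two edges with a common vertex. -/
theorem wedge_sq (p : X.Simp 4) (σ : Equiv.Perm (Fin 5)) :
    ((D.bEdge p {σ 1, σ 2} (σ 0) * D.gEdge p {σ 1, σ 4} (σ 0) -
      D.bEdge p {σ 1, σ 4} (σ 0) * D.gEdge p {σ 1, σ 2} (σ 0)) *
      (D.qOpp p (σ 0) (σ 2) * D.qOpp p (σ 0) (σ 3) * D.qOpp p (σ 0) (σ 4))) ^ 2 =
      D.qOpp p (σ 0) (σ 1) ^ 2 := by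
  have hne : ∀ {x y : Fin 5}, x ≠ y → σ x ≠ σ y := fun h => σ.injective.ne h
  set n := σ 0 with hn
  have hsucc : ∀ x : Fin 5, x ≠ 0 → ∃ a, n.succAbove a = σ x := fun x hx =>
    Fin.exists_succAbove_eq (hne hx)
  obtain ⟨a, ha⟩ := hsucc 1 (by decide)
  obtain ⟨b, hb⟩ := hsucc 2 (by decide)
  obtain ⟨c, hc⟩ := hsucc 4 (by decide)
  obtain ⟨f, hf⟩ := hsucc 3 (by decide)
  have hab : a ≠ b := fun h => hne (by decide : (1 : Fin 5) ≠ 2) (by rw [← ha, ← hb, h])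
  have hac : a ≠ c := fun h => hne (by decide : (1 : Fin 5) ≠ 4) (by rw [← ha, ← hc, h])
  have haf : a ≠ f := fun h => hne (by decide : (1 : Fin 5) ≠ 3) (by rw [← ha, ← hf, h])
  have hbc : b ≠ c := fun h => hne (by decide : (2 : Fin 5) ≠ 4) (by rw [← hb, ← hc, h])
  have hbf : b ≠ f := fun h => hne (by decide : (2 : Fin 5) ≠ 3) (by rw [← hb, ← hf, h])
  have hcf : c ≠ f := fun h => hne (by decide : (4 : Fin 5) ≠ 3) (by rw [← hc, ← hf, h])
  rw [← ha, ← hb, ← hc, ← hf]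
  set q := X.res (X.d p n) D.q with hq
  have hq0 : ∀ x, q x ≠ 0 := fun x => D.q_ne_zero _
  have hqo : ∀ x, D.qOpp p n (n.succAbove x) = q x := by
    intro x
    exact (X.apply_d_d p D.q n x).symm
  have hpair : ∀ {x y : Fin 4}, x ≠ y → ({x, y} : Finset (Fin 4)).card = 2 :=
    fun h => Finset.card_pair h
  have hsub : ∀ {x y : Fin 4} (h : x ≠ y) (h' : ({n.succAbove x, n.succAbove y} : Finset (Fin 5)).card = 2),
      X.sub p {n.succAbove x, n.succAbove y} h' = X.sub (X.d p n) {x, y} (hpair h) := by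
    intro x y h h'
    rw [X.sub_d]
    exact X.sub_congr p (by simp [Finset.map_insert]) h'
  have hpair' : ∀ {x y : Fin 4}, x ≠ y →
      ({n.succAbove x, n.succAbove y} : Finset (Fin 5)).card = 2 :=
    fun h => Finset.card_pair fun h' => h (Fin.succAbove_right_injective h')
  have hB : ∀ {x y : Fin 4}, x ≠ y → D.bEdge p {n.succAbove x, n.succAbove y} n =
      D.β (X.d p n) (edgeVec x y) := by
    intro x y h
    rw [bEdge, dif_pos (hpair' h), hsub h, X.res_edgeCob]
  have hG : ∀ {x y : Fin 4}, x ≠ y → D.gEdge p {n.succAbove x, n.succAbove y} n =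
      D.γ (X.d p n) (edgeVec x y) := by
    intro x y h
    rw [gEdge, dif_pos (hpair' h), hsub h, X.res_edgeCob]
  have hcoc : ∀ {x y : Fin 4}, x ≠ y → IsTetCocycle (edgeVec x y) := by
    intro x y h
    rw [← X.res_edgeCob (X.d p n) (hpair h)]
    exact X.isTetCocycle_res (X.edgeCob_mem_Z2 _) _
  rw [hB hab, hB hac, hG hab, hG hac, hqo, hqo, hqo, hqo,
    D.β_mul_γ _ _ _ (hcoc hab) (hcoc hac), D.β_mul_γ _ _ _ (hcoc hac) (hcoc hab)]
  -- The antisymmetric part times all four roots is the `ω`-weighted area of the two edges, which up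
  -- to a sign is the value of `ω` on the face opposite to their common vertex.
  have h1 := tetForm_sub_swap_mul q (edgeVec a b) (edgeVec a c) hq0
  have h2 := edgeVec_wedge (w := fun x => q x ^ 2) (show ∑ x : Fin 4, (-1 : ℂ) ^ (x : ℕ) *
    q x ^ 2 = 0 from X.isTetCocycle_res D.sq_mem (X.d p n)) hab hac hbc
  rw [← h1] at h2
  have h3 : ∏ x, q x = q a * (q b * q f * q c) := by
    have : (Finset.univ : Finset (Fin 4)) = {a, b, f, c} := by
      symm
      refine Finset.eq_univ_of_card _ ?_
      rw [Finset.card_insert_of_notMem (by simp [hab, haf, hac]),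
        Finset.card_insert_of_notMem (by simp [hbf, hbc]), Finset.card_pair hcf.symm]
      rfl
    rw [this, Finset.prod_insert (by simp [hab, haf, hac]), Finset.prod_insert (by simp [hbf, hbc]),
      Finset.prod_pair hcf.symm]
    ring
  rw [h3] at h2
  have h4 : q a ^ 2 ≠ 0 := pow_ne_zero 2 (hq0 a)
  refine mul_left_cancel₀ h4 ?_
  linear_combination h2

/-- The relation between a matrix element of a pentachoron, the quantity `η ^ 2`, and the edge
operators of three edges with a common vertex. -/
theorem local_identity (p : X.Simp 4) (σ : Equiv.Perm (Fin 5)) :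
    (D.η p ^ 2 * D.F p (σ 3) (σ 1)) ^ 2 =
      (D.qOpp p (σ 0) (σ 2) * D.qOpp p (σ 0) (σ 3) * D.qOpp p (σ 0) (σ 4) *
        D.qOpp p (σ 2) (σ 3) * D.qOpp p (σ 2) (σ 4) * D.qOpp p (σ 3) (σ 4)) ^ 2 *
      (D.bEdge p {σ 1, σ 2} (σ 0) * D.bEdge p {σ 1, σ 4} (σ 2) * D.bEdge p {σ 1, σ 0} (σ 4) +
        D.bEdge p {σ 1, σ 4} (σ 0) * D.bEdge p {σ 1, σ 2} (σ 4) *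
          D.bEdge p {σ 1, σ 0} (σ 2)) ^ 2 := by
  have hsum : ∀ f : Fin 5 → ℂ, ∑ m, f m = f (σ 0) + f (σ 1) + f (σ 2) + f (σ 3) + f (σ 4) := by
    intro f
    exact (Equiv.sum_comp σ f).symm.trans (Fin.sum_univ_five _)
  -- Two columns of the relations of two edges at the vertex `σ 1`. In the column `σ 1` the left
  -- side vanishes, because the tetrahedron opposite to this vertex does not contain the edges.
  have e1 := D.annihilate_edge p {σ 1, σ 4} (σ 0)
  have e2 := D.annihilate_edge p {σ 1, σ 4} (σ 1)
  have e3 := D.annihilate_edge p {σ 1, σ 2} (σ 0)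
  have e4 := D.annihilate_edge p {σ 1, σ 2} (σ 1)
  rw [D.gEdge_eq_zero p (by simp : σ 1 ∈ ({σ 1, σ 4} : Finset (Fin 5)))] at e2
  rw [D.gEdge_eq_zero p (by simp : σ 1 ∈ ({σ 1, σ 2} : Finset (Fin 5)))] at e4
  rw [hsum, D.bEdge_eq_zero p (by simp : σ 1 ∈ ({σ 1, σ 4} : Finset (Fin 5))),
    D.bEdge_eq_zero p (by simp : σ 4 ∈ ({σ 1, σ 4} : Finset (Fin 5)))] at e1 e2
  rw [hsum, D.bEdge_eq_zero p (by simp : σ 1 ∈ ({σ 1, σ 2} : Finset (Fin 5))),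
    D.bEdge_eq_zero p (by simp : σ 2 ∈ ({σ 1, σ 2} : Finset (Fin 5)))] at e3 e4
  rw [D.F_self] at e1 e3
  have h1 := D.η_sq_perm p σ
  -- The relation for `η ^ 2` is used in two arrangements, for the two 2×2 minors that the
  -- eliminations below produce.
  have h2 := D.η_sq_perm p (σ * Equiv.swap 2 4)
  simp only [Equiv.Perm.mul_apply, show (Equiv.swap 2 4 : Equiv.Perm (Fin 5)) 0 = 0 by decide,
    show (Equiv.swap 2 4 : Equiv.Perm (Fin 5)) 1 = 1 by decide,
    show (Equiv.swap 2 4 : Equiv.Perm (Fin 5)) 2 = 4 by decide,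
    show (Equiv.swap 2 4 : Equiv.Perm (Fin 5)) 3 = 3 by decide,
    show (Equiv.swap 2 4 : Equiv.Perm (Fin 5)) 4 = 2 by decide, Equiv.Perm.sign_mul,
    Equiv.Perm.sign_swap (show (2 : Fin 5) ≠ 4 by decide)] at h2
  push_cast at h2
  rw [D.qOpp_comm p (σ 3) (σ 2), D.qOpp_comm p (σ 4) (σ 2), D.qOpp_comm p (σ 4) (σ 3)] at h2
  rw [Finset.pair_comm (σ 1) (σ 0)]
  have h3 := D.wedge_sq p σ
  have hs : bdSign ε p (σ 0) ^ 2 = 1 := bdSign_sq p _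
  have hσ : ((Equiv.Perm.sign σ : ℤ) : ℂ) ^ 2 = 1 := by
    rcases Int.units_eq_one_or (Equiv.Perm.sign σ) with h | h <;> simp [h]
  have hq : D.qOpp p (σ 0) (σ 1) ^ 2 ≠ 0 :=
    pow_ne_zero 2 (D.qOpp_ne_zero p (σ.injective.ne (by decide)))
  rw [D.F_skew p (σ 2) (σ 0), D.F_skew p (σ 3) (σ 0)] at e1
  rw [D.F_skew p (σ 2) (σ 1), D.F_skew p (σ 3) (σ 1)] at e2
  rw [D.F_skew p (σ 3) (σ 0), D.F_skew p (σ 4) (σ 0)] at e3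
  rw [D.F_skew p (σ 3) (σ 1), D.F_skew p (σ 4) (σ 1)] at e4
  rw [D.F_skew p (σ 3) (σ 1)]
  generalize D.F p (σ 0) (σ 1) = F01 at *
  generalize D.F p (σ 0) (σ 2) = F02 at *
  generalize D.F p (σ 0) (σ 3) = F03 at *
  generalize D.F p (σ 0) (σ 4) = F04 at *
  generalize D.F p (σ 1) (σ 2) = F12 at *
  generalize D.F p (σ 1) (σ 3) = F13 at *
  generalize D.F p (σ 1) (σ 4) = F14 at *
  generalize D.bEdge p {σ 1, σ 4} (σ 0) = b0 at *
  generalize D.bEdge p {σ 1, σ 4} (σ 2) = b2 at *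
  generalize D.bEdge p {σ 1, σ 4} (σ 3) = b3 at *
  generalize D.bEdge p {σ 1, σ 2} (σ 0) = c0 at *
  generalize D.bEdge p {σ 1, σ 2} (σ 4) = c4 at *
  generalize D.bEdge p {σ 1, σ 2} (σ 3) = c3 at *
  generalize D.bEdge p {σ 0, σ 1} (σ 4) = a4 at *
  generalize D.bEdge p {σ 0, σ 1} (σ 2) = a2 at *
  generalize D.gEdge p {σ 1, σ 2} (σ 0) = g at *
  generalize D.gEdge p {σ 1, σ 4} (σ 0) = k at *
  generalize bdSign ε p (σ 0) = s at *
  generalize ((Equiv.Perm.sign σ : ℤ) : ℂ) = t at *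
  generalize D.η p ^ 2 = H at *
  generalize D.qOpp p (σ 0) (σ 1) = q01 at *
  generalize D.qOpp p (σ 0) (σ 2) = q02 at *
  generalize D.qOpp p (σ 0) (σ 3) = q03 at *
  generalize D.qOpp p (σ 0) (σ 4) = q04 at *
  generalize D.qOpp p (σ 2) (σ 3) = q23 at *
  generalize D.qOpp p (σ 2) (σ 4) = q24 at *
  generalize D.qOpp p (σ 3) (σ 4) = q34 at *
  -- Elimination of `b3`, and then of `c3`, between the two columns of each edge.
  have f1 : b2 * (F13 * F02 - F12 * F03) = -(s * k * F13) - b0 * F01 * F03 := by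
    linear_combination F13 * e1 - F03 * e2
  have f2 : c4 * (F13 * F04 - F14 * F03) = -(s * g * F13) - c0 * F01 * F03 := by
    linear_combination F13 * e3 - F03 * e4
  -- Weighting the two equations by `c0` and `b0` cancels the common term with `F01 * F03`; the
  -- minors are then replaced through the relation for `H`.
  have f3 : -(s * (H * F13) * (c0 * k - b0 * g)) =
      t * (q34 * q24 * q23 * q01) * (c0 * b2 * a4 + b0 * c4 * a2) := by
    linear_combination (-H * c0) * f1 + H * b0 * f2 + c0 * b2 * h1 - b0 * c4 * h2
  have f4 : (H * F13) ^ 2 * (c0 * k - b0 * g) ^ 2 =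
      (q34 * q24 * q23 * q01) ^ 2 * (c0 * b2 * a4 + b0 * c4 * a2) ^ 2 := by
    have : (-(s * (H * F13) * (c0 * k - b0 * g))) ^ 2 =
        (t * (q34 * q24 * q23 * q01) * (c0 * b2 * a4 + b0 * c4 * a2)) ^ 2 := by rw [f3]
    linear_combination this - (H * F13) ^ 2 * (c0 * k - b0 * g) ^ 2 * hs +
      (q34 * q24 * q23 * q01) ^ 2 * (c0 * b2 * a4 + b0 * c4 * a2) ^ 2 * hσ
  refine mul_left_cancel₀ hq ?_
  linear_combination (-(H * F13) ^ 2) * h3 + (q02 * q03 * q04) ^ 2 * f4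

end Coloring

end TriComplex

/-- The corrections `z` involve only the first group of basis vectors, so the change of basis is
unipotent and has determinant one. It will absorb the coboundaries by which the further cocycles
before and after the move may differ. -/
theorem exists_unipotent_basis {V : Type*} [AddCommGroup V] [Module ℂ V] {J K ι : Type*}
    [Fintype J] [Fintype K] [Fintype ι] [DecidableEq J] [DecidableEq K] [DecidableEq ι]
    (e : Module.Basis (J ⊕ K) ℂ V) (z : K → V) (hz : ∀ k l, e.repr (z k) (Sum.inr l) = 0) :
    ∃ e' : Module.Basis (J ⊕ K) ℂ V, (∀ i, e' (Sum.inl i) = e (Sum.inl i)) ∧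
      (∀ k, e' (Sum.inr k) = e (Sum.inr k) + z k) ∧
      ∀ (ω : V) (c : ι → V) (eJ : Unit ⊕ ι ≃ J ⊕ K),
        (coordMatrix e ω c eJ).det = (coordMatrix e' ω c eJ).det := by
  let v : J ⊕ K → V := Sum.elim (fun i => e (Sum.inl i)) fun k => e (Sum.inr k) + z k
  have hdet : (Matrix.of fun i j => e.repr (v j) i).det = 1 := by
    have : (Matrix.of fun i j => e.repr (v j) i) = Matrix.fromBlocks 1
        (Matrix.of fun i k => e.repr (z k) (Sum.inl i)) 0 1 := by
      ext i j
      rcases i with i | i <;> rcases j with j | j <;>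
        simp [v, hz, Finsupp.single_apply, Matrix.one_apply, eq_comm]
    rw [this, Matrix.det_fromBlocks_zero₂₁]
    simp
  obtain ⟨h1, h2⟩ := e.is_basis_iff_det.2 (show IsUnit (e.det v) by
    have h : e.det v = 1 := hdet
    exact h ▸ isUnit_one)
  refine ⟨Module.Basis.mk h1 h2.ge, fun i => by simp [v], fun k => by simp [v], fun ω c eJ => ?_⟩
  rw [coordMatrix_eq_mul (Module.Basis.mk h1 h2.ge) e ω c eJ eJ, Matrix.det_mul]
  have : (Matrix.of fun a b => e.repr (Module.Basis.mk h1 h2.ge (eJ b)) (eJ a)) =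
      (Matrix.of fun i j => e.repr (v j) i).submatrix eJ eJ := by
    ext a b
    simp
  rw [this, Matrix.det_submatrix_equiv_self, hdet, one_mul]

/-! ### Rescaling of the quantities `η`, and sums and products over a closed complex. -/

namespace TriComplex

variable {Λ : Type v} [LinearOrder Λ]

namespace Coloring

variable {X : TriComplex.{u} Λ} {ε : X.Simp 4 → ℤˣ} (D : X.Coloring ε)

/-- In the relation for `η ^ 2` the 2×2 minor of `F` loses the four scalars of its indices, and the
edge component gains the fifth. The common sign `s` enters squared. -/
theorem η_rescaling {X' : TriComplex.{w} Λ} {ε' : X'.Simp 4 → ℤˣ} (D' : X'.Coloring ε')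
    {p : X.Simp 4} {p' : X'.Simp 4} {l : Fin 5 → ℂ} {s : ℂ} (hs : s ^ 2 = 1)
    (hF : ∀ m n, l m * l n * D'.F p' m n = s * D.F p m n)
    (hB : ∀ e m, D'.bEdge p' e m = l m * D.bEdge p e m)
    (hq : ∀ x y, D'.qOpp p' x y = D.qOpp p x y) :
    D'.η p' ^ 2 = D.η p ^ 2 * ∏ m, l m := by
  obtain ⟨e, m, he⟩ := D.exists_bEdge_ne_zero p
  have hcard : e.card = 2 := by
    by_contra h
    exact he (by rw [bEdge, dif_neg h])
  have hm : m ∉ e := fun h => he (D.bEdge_eq_zero p h)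
  obtain ⟨x, y, hxy, rfl⟩ := Finset.card_eq_two.1 hcard
  simp only [Finset.mem_insert, Finset.mem_singleton, not_or] at hm
  obtain ⟨σ, rfl, rfl, rfl⟩ := exists_perm x y m hxy (Ne.symm hm.1) (Ne.symm hm.2)
  have e1 := D.η_sq_perm p σ
  have e2 := D'.η_sq_perm p' σ
  rw [hB, hq, hq, hq, hq] at e2
  have hne : D.F p (σ 1) (σ 3) * D.F p (σ 0) (σ 2) - D.F p (σ 1) (σ 2) * D.F p (σ 0) (σ 3) ≠ 0 := by
    intro h
    rw [h, mul_zero] at e1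
    have hσ : ∀ {x y : Fin 5}, x ≠ y → D.qOpp p (σ x) (σ y) ≠ 0 := fun h =>
      D.qOpp_ne_zero p (σ.injective.ne h)
    have h3 : ((Equiv.Perm.sign σ : ℤ) : ℂ) ≠ 0 := by
      rcases Int.units_eq_one_or (Equiv.Perm.sign σ) with h | h <;> simp [h]
    exact absurd e1.symm (mul_ne_zero h3 (mul_ne_zero he (mul_ne_zero (mul_ne_zero (mul_ne_zero
      (hσ (by decide)) (hσ (by decide))) (hσ (by decide))) (hσ (by decide)))))
  have hl : ∏ m, l m = l (σ 0) * l (σ 1) * l (σ 2) * l (σ 3) * l (σ 4) := by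
    exact (Equiv.prod_comp σ l).symm.trans (Fin.prod_univ_five _)
  refine mul_right_cancel₀ hne ?_
  rw [hl]
  have a1 := hF (σ 1) (σ 3)
  have a2 := hF (σ 0) (σ 2)
  have a3 := hF (σ 1) (σ 2)
  have a4 := hF (σ 0) (σ 3)
  have e3 : l (σ 0) * l (σ 1) * l (σ 2) * l (σ 3) * (D'.F p' (σ 1) (σ 3) * D'.F p' (σ 0) (σ 2) -
      D'.F p' (σ 1) (σ 2) * D'.F p' (σ 0) (σ 3)) =
      D.F p (σ 1) (σ 3) * D.F p (σ 0) (σ 2) - D.F p (σ 1) (σ 2) * D.F p (σ 0) (σ 3) := by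
    have b1 : (l (σ 1) * l (σ 3) * D'.F p' (σ 1) (σ 3)) * (l (σ 0) * l (σ 2) * D'.F p' (σ 0) (σ 2)) -
      (l (σ 1) * l (σ 2) * D'.F p' (σ 1) (σ 2)) * (l (σ 0) * l (σ 3) * D'.F p' (σ 0) (σ 3)) =
      (s * D.F p (σ 1) (σ 3)) * (s * D.F p (σ 0) (σ 2)) -
        (s * D.F p (σ 1) (σ 2)) * (s * D.F p (σ 0) (σ 3)) := by rw [a1, a2, a3, a4]
    linear_combination b1 + (D.F p (σ 1) (σ 3) * D.F p (σ 0) (σ 2) -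
      D.F p (σ 1) (σ 2) * D.F p (σ 0) (σ 3)) * hs
  linear_combination (-D'.η p' ^ 2) * e3 + l (σ 0) * l (σ 1) * l (σ 2) * l (σ 3) * e2 -
    l (σ 0) * l (σ 1) * l (σ 2) * l (σ 3) * l (σ 4) * e1

end Coloring

/-- The two pentachora at a tetrahedron contribute opposite signs. Coherence is used in this form,
which is established again for the complex after the move. -/
theorem IsClosedOriented.sum_eq_zero {X : TriComplex.{u} Λ} {ε : X.Simp 4 → ℤˣ}
    (hX : X.IsClosedOriented ε) [DecidableEq (X.Simp 3)] (t : X.Simp 3) :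
    ∑ p : X.Simp 4, ∑ m : Fin 5, (if X.d p m = t then Coloring.bdSign ε p m else 0) = 0 := by
  classical
  obtain ⟨p, p', hne, hiff, hε⟩ := hX.2 t
  rw [← Fintype.sum_prod_type' (f := fun p m => if X.d p m = t then Coloring.bdSign ε p m else 0)]
  rw [Finset.sum_ite, Finset.sum_const_zero, add_zero]
  have : (Finset.univ.filter fun r : X.Simp 4 × Fin 5 => X.d r.1 r.2 = t) = {p, p'} := by
    ext r
    simp [hiff]
  rw [this, Finset.sum_pair hne]
  have h := congrArg (fun x : ℤˣ => ((x : ℤ) : ℂ)) hε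
  push_cast at h
  simp only [Coloring.bdSign, h]
  ring

/-- Every tetrahedron occurs exactly twice as a 3-face. -/
theorem IsClosedOriented.prod_d {X : TriComplex.{u} Λ} {ε : X.Simp 4 → ℤˣ}
    (hX : X.IsClosedOriented ε) (f : X.Simp 3 → ℂ) :
    ∏ p : X.Simp 4, ∏ m : Fin 5, f (X.d p m) = (∏ t, f t) ^ 2 := by
  classical
  rw [← Fintype.prod_prod_type' (f := fun p m => f (X.d p m)),
    ← Finset.prod_fiberwise (g := fun r : X.Simp 4 × Fin 5 => X.d r.1 r.2), ← Finset.prod_pow]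
  refine Finset.prod_congr rfl fun t _ => ?_
  obtain ⟨p, p', hne, hiff, -⟩ := hX.2 t
  have : (Finset.univ.filter fun r : X.Simp 4 × Fin 5 => X.d r.1 r.2 = t) = {p, p'} := by
    ext r
    simp [hiff]
  rw [this, Finset.prod_pair hne, (hiff p).2 (Or.inl rfl), (hiff p').2 (Or.inr rfl), sq]

/-! ### The simplices after the move and their incidences. -/

namespace Site

variable {X : TriComplex.{u} Λ} (P : X.Site)

theorem card_insert : (insert P.a P.A).card = 5 := by
  rw [Finset.card_insert_of_notMem P.a_notMem_A, P.card_A]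

/-- The second copy of the tetrahedron. -/
def copySimp : P.inflate.Simp 3 := ⟨.copy, P.card_A⟩

/-- The new pentachoron that contains the old tetrahedron. -/
def fstPent : P.inflate.Simp 4 := ⟨.pent₁, P.card_insert⟩

/-- The new pentachoron that contains the copy of the tetrahedron. -/
def sndPent : P.inflate.Simp 4 := ⟨.pent₂, P.card_insert⟩

theorem oldSimp_injective {k : ℕ} : Function.Injective (P.oldSimp : X.Simp k → _) := by
  intro σ τ h
  have h1 : InflatedCell.old σ.1 = InflatedCell.old τ.1 := congrArg Subtype.val h
  injection h1 with h2
  exact Subtype.ext h2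

theorem sub_oldSimp {k j : ℕ} (σ : X.Simp k) (s : Finset (Fin (k + 1))) (hs : s.card = j + 1)
    (h : ¬(σ.1 = P.p.1 ∧ s.map (X.vtx σ).toEmbedding = P.A)) :
    P.inflate.sub (P.oldSimp σ) s hs = P.oldSimp (X.sub σ s hs) :=
  Subtype.ext (if_neg h)

/-- The only face of an old simplex changed by the move is a tetrahedron. -/
theorem sub_oldSimp_of_le {k j : ℕ} (σ : X.Simp k) (s : Finset (Fin (k + 1)))
    (hs : s.card = j + 1) (hj : j ≤ 2) :
    P.inflate.sub (P.oldSimp σ) s hs = P.oldSimp (X.sub σ s hs) := by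
  refine P.sub_oldSimp σ s hs fun h => ?_
  have h1 := congrArg Finset.card h.2
  rw [Finset.card_map, hs, P.card_A] at h1
  omega

theorem d_oldSimp {k : ℕ} (σ : X.Simp (k + 1)) (n : Fin (k + 2)) (hk : k ≤ 2) :
    P.inflate.d (P.oldSimp σ) n = P.oldSimp (X.d σ n) :=
  P.sub_oldSimp_of_le σ _ _ hk

theorem d_p_eq_iff (m : Fin 5) :
    X.d P.p m = P.t ↔ (Finset.univ.erase m).map (X.vtx P.p).toEmbedding = P.A := by
  constructor
  · intro h
    rw [A, ← h]
    exact (X.verts_sub _ _ _).symm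
  · intro h
    refine Subtype.ext ?_
    change X.face P.p.1 ((Finset.univ.erase m).map (X.vtx P.p).toEmbedding) = P.t.1
    rw [h]
    exact P.face_eq

open Classical in
theorem d_oldSimp_pent (p : X.Simp 4) (m : Fin 5) : P.inflate.d (P.oldSimp p) m =
    if p = P.p ∧ X.d p m = P.t then P.copySimp else P.oldSimp (X.d p m) := by
  split_ifs with h
  · obtain ⟨rfl, h⟩ := h
    exact Subtype.ext (if_pos ⟨rfl, (P.d_p_eq_iff m).1 h⟩)
  · refine P.sub_oldSimp p _ _ fun h' => h ?_
    have h1 : p = P.p := Subtype.ext h'.1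
    subst h1
    exact ⟨rfl, (P.d_p_eq_iff m).2 h'.2⟩

theorem sub_copySimp {j : ℕ} (s : Finset (Fin 4)) (hs : s.card = j + 1) (hj : j ≤ 2) :
    P.inflate.sub P.copySimp s hs = P.oldSimp (X.sub P.t s hs) := by
  refine Subtype.ext (if_neg fun h => ?_)
  have h1 := congrArg Finset.card h
  rw [Finset.card_map, hs, P.card_A] at h1
  omega

theorem d_copySimp (n : Fin 4) : P.inflate.d P.copySimp n = P.oldSimp (X.d P.t n) :=
  P.sub_copySimp _ _ le_rfl

theorem exists_apex : ∃ n : Fin 5, P.inflate.vtx P.sndPent n = P.a := by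
  have h : P.a ∈ Set.range (P.inflate.vtx P.sndPent) := by
    unfold vtx
    rw [Finset.range_orderEmbOfFin]
    exact Finset.mem_insert_self P.a P.A
  exact h

/-- The number of the new vertex among the vertices of the new pentachora. -/
noncomputable def apex : Fin 5 := P.exists_apex.choose

theorem vtx_apex : P.inflate.vtx P.sndPent P.apex = P.a := P.exists_apex.choose_spec

theorem vtx_succAbove (x : Fin 4) :
    P.inflate.vtx P.sndPent (P.apex.succAbove x) = X.vtx P.t x := by
  have : (fun x => P.inflate.vtx P.sndPent (P.apex.succAbove x)) = X.vtx P.t := by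
    refine Finset.orderEmbOfFin_unique _ (fun x => ?_)
      ((P.inflate.vtx P.sndPent).strictMono.comp P.apex.strictMono_succAbove)
    have h1 : P.inflate.vtx P.sndPent (P.apex.succAbove x) ∈ insert P.a P.A :=
      Finset.orderEmbOfFin_mem _ _ _
    refine (Finset.mem_insert.1 h1).resolve_left fun h2 => ?_
    rw [← P.vtx_apex] at h2
    exact Fin.succAbove_ne _ _ ((P.inflate.vtx P.sndPent).injective h2)
  exact congrFun this x

theorem map_vtx_succAbove (s : Finset (Fin 4)) :
    (s.map P.apex.succAboveEmb).map (P.inflate.vtx P.sndPent).toEmbedding =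
      s.map (X.vtx P.t).toEmbedding := by
  rw [Finset.map_map]
  congr 1
  ext x
  exact P.vtx_succAbove x

theorem a_mem_map_iff (s : Finset (Fin 5)) :
    P.a ∈ s.map (P.inflate.vtx P.sndPent).toEmbedding ↔ P.apex ∈ s := by
  conv_lhs => rw [← P.vtx_apex]
  exact Finset.mem_map' _

theorem map_vtx_t_subset (s : Finset (Fin 4)) : s.map (X.vtx P.t).toEmbedding ⊆ P.A :=
  X.map_vtx_subset P.t s

theorem ne_insert {B : Finset Λ} (hB : B.card ≤ 4) : B ≠ insert P.a P.A := fun h => by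
  rw [h, P.card_insert] at hB
  omega

theorem sub_fstPent_eq {j : ℕ} (s : Finset (Fin 4)) (hs : (s.map P.apex.succAboveEmb).card = j + 1) :
    P.inflate.sub P.fstPent (s.map P.apex.succAboveEmb) hs =
      P.oldSimp (X.sub P.t s (by simpa using hs)) := by
  have h1 := P.map_vtx_succAbove s
  have hB : (s.map (X.vtx P.t).toEmbedding).card ≤ 4 := by
    rw [Finset.card_map]; exact Finset.card_le_univ s
  have ha : P.a ∉ s.map (X.vtx P.t).toEmbedding := fun h => P.a_notMem_A (P.map_vtx_t_subset s h)
  refine Subtype.ext ?_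
  -- The two new pentachora have the same vertices, so the numbering of the second serves for both.
  change P.newFace .pent₁ ((s.map P.apex.succAboveEmb).map (P.inflate.vtx P.sndPent).toEmbedding) = _
  rw [h1]
  simp only [newFace]
  rw [if_neg (P.ne_insert hB), if_neg ha]
  rfl

theorem d_fstPent_apex : P.inflate.d P.fstPent P.apex = P.oldSimp P.t := by
  have h : Finset.univ.erase P.apex = Finset.univ.map P.apex.succAboveEmb := by
    ext x
    by_cases hx : x = P.apex
    · simp [hx, Fin.succAbove_ne]
    · obtain ⟨y, rfl⟩ := Fin.exists_succAbove_eq hx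
      simp [Fin.succAbove_ne]
  unfold d
  rw [P.inflate.sub_congr _ h, P.sub_fstPent_eq]
  congr 1
  refine Subtype.ext ?_
  change X.face P.t.1 (Finset.univ.map (X.vtx P.t).toEmbedding) = _
  have h2 : Finset.univ.map (X.vtx P.t).toEmbedding = X.verts P.t.1 :=
    Finset.map_orderEmbOfFin_univ _ _
  rw [h2, X.face_verts]

theorem d_sndPent_apex : P.inflate.d P.sndPent P.apex = P.copySimp := by
  have h : Finset.univ.erase P.apex = Finset.univ.map P.apex.succAboveEmb := by
    ext x
    by_cases hx : x = P.apex
    · simp [hx, Fin.succAbove_ne]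
    · obtain ⟨y, rfl⟩ := Fin.exists_succAbove_eq hx
      simp [Fin.succAbove_ne]
  refine Subtype.ext ?_
  change P.newFace .pent₂ ((Finset.univ.erase P.apex).map (P.inflate.vtx P.sndPent).toEmbedding) = _
  have h2 : Finset.univ.map (X.vtx P.t).toEmbedding = P.A :=
    Finset.map_orderEmbOfFin_univ _ _
  rw [h, P.map_vtx_succAbove, h2]
  simp only [newFace]
  rw [if_neg (P.ne_insert P.card_A.le), if_neg P.a_notMem_A, if_pos trivial]
  rfl

/-- The two new pentachora have the same faces, except for the tetrahedra opposite to the new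
vertex. -/
theorem sub_fstPent_eq_sub_sndPent {j : ℕ} (s : Finset (Fin 5)) (hs : s.card = j + 1) (hj : j ≤ 3)
    (h : P.apex ∈ s ∨ j ≤ 2) : P.inflate.sub P.fstPent s hs = P.inflate.sub P.sndPent s hs := by
  refine Subtype.ext ?_
  change P.newFace .pent₁ (s.map (P.inflate.vtx P.sndPent).toEmbedding) =
    P.newFace .pent₂ (s.map (P.inflate.vtx P.sndPent).toEmbedding)
  have hB : (s.map (P.inflate.vtx P.sndPent).toEmbedding).card = j + 1 := by
    rw [Finset.card_map, hs]
  simp only [newFace]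
  rw [if_neg (P.ne_insert (by omega)), if_neg (P.ne_insert (by omega))]
  split_ifs with h1 h2
  · rfl
  · rcases h with h | h
    · exact absurd ((P.a_mem_map_iff s).2 h) h1
    · rw [h2, P.card_A] at hB
      omega
  · rfl

/-- The tetrahedra common to the two new pentachora. -/
noncomputable def newTet (x : Fin 4) : P.inflate.Simp 3 := P.inflate.d P.sndPent (P.apex.succAbove x)

theorem d_fstPent (x : Fin 4) : P.inflate.d P.fstPent (P.apex.succAbove x) = P.newTet x :=
  P.sub_fstPent_eq_sub_sndPent _ _ le_rfl (Or.inl (by simp [(Fin.succAbove_ne _ _).symm]))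

/-- The edges with the new vertex. -/
noncomputable def newEdge (x : Fin 4) : P.inflate.Simp 1 :=
  P.inflate.sub P.sndPent {P.apex, P.apex.succAbove x}
    (Finset.card_pair (Fin.succAbove_ne _ _).symm)

theorem sub_sndPent_ne_oldSimp {j : ℕ} {s : Finset (Fin 5)} {hs : s.card = j + 1} (h : P.apex ∈ s)
    (σ : X.Simp j) : P.inflate.sub P.sndPent s hs ≠ P.oldSimp σ := by
  intro h1
  have h2 : P.a ∈ P.inflate.verts (P.inflate.sub P.sndPent s hs).1 := by
    rw [verts_sub]
    exact (P.a_mem_map_iff s).2 h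
  rw [h1] at h2
  exact P.a_notMem _ h2

theorem sub_sndPent_ne_copySimp {s : Finset (Fin 5)} {hs : s.card = 3 + 1} (h : P.apex ∈ s) :
    P.inflate.sub P.sndPent s hs ≠ P.copySimp := by
  intro h1
  have h2 : P.a ∈ P.inflate.verts (P.inflate.sub P.sndPent s hs).1 := by
    rw [verts_sub]
    exact (P.a_mem_map_iff s).2 h
  rw [h1] at h2
  exact P.a_notMem_A h2

/-- Realizing all cones as faces of one pentachoron through its apex reduces the enumeration of the
new simplices to that of subsets of `Fin 5`. -/
theorem exists_eq_sub {j : ℕ} (B : {B : Finset Λ // B ∈ P.A.ssubsets})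
    (h : (P.newVerts (.cone B)).card = j + 1) :
    ∃ (s : Finset (Fin 5)) (hs : s.card = j + 1), P.apex ∈ s ∧
      (⟨.cone B, h⟩ : P.inflate.Simp j) = P.inflate.sub P.sndPent s hs := by
  classical
  have hB := Finset.mem_ssubsets.1 B.2
  have haB : P.a ∉ B.1 := fun h => P.a_notMem_A (hB.1 h)
  let s : Finset (Fin 5) := Finset.univ.filter fun x => P.inflate.vtx P.sndPent x ∈ insert P.a B.1
  have hsmap : s.map (P.inflate.vtx P.sndPent).toEmbedding = insert P.a B.1 := by
    ext y
    simp only [s, Finset.mem_map, Finset.mem_filter, Finset.mem_univ, true_and]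
    constructor
    · rintro ⟨x, hx, rfl⟩; exact hx
    · intro hy
      have : y ∈ Set.range (P.inflate.vtx P.sndPent) := by
        unfold vtx
        rw [Finset.range_orderEmbOfFin]
        exact Finset.insert_subset_insert _ hB.1 hy
      obtain ⟨x, rfl⟩ := this
      exact ⟨x, hy, rfl⟩
  have hs : s.card = j + 1 := by
    rw [← h, ← Finset.card_map (P.inflate.vtx P.sndPent).toEmbedding, hsmap]
    rfl
  refine ⟨s, hs, ?_, Subtype.ext ?_⟩
  · rw [← P.a_mem_map_iff, hsmap]
    exact Finset.mem_insert_self _ _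
  · change _ = P.newFace .pent₂ (s.map (P.inflate.vtx P.sndPent).toEmbedding)
    rw [hsmap]
    simp only [newFace]
    rw [if_neg, if_pos (Finset.mem_insert_self _ _), Finset.erase_insert haB]
    · exact (P.mkCone_coe B).symm
    · intro h'
      have h2 := congrArg (Finset.erase · P.a) h'
      simp only [Finset.erase_insert haB, Finset.erase_insert P.a_notMem_A] at h2
      exact hB.ne h2

/-- The simplices of dimension at most two: the old ones and those with the new vertex. -/
theorem simp_cases {j : ℕ} (hj : j ≤ 2) (σ : P.inflate.Simp j) :
    (∃ τ, σ = P.oldSimp τ) ∨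
      ∃ (s : Finset (Fin 5)) (hs : s.card = j + 1), P.apex ∈ s ∧ σ = P.inflate.sub P.sndPent s hs := by
  obtain ⟨c, hc⟩ := σ
  cases c with
  | old τ => exact Or.inl ⟨⟨τ, hc⟩, rfl⟩
  | cone B => exact Or.inr (P.exists_eq_sub B hc)
  | copy =>
    have := hc.symm.trans P.card_A
    omega
  | pent₁ =>
    have := hc.symm.trans P.card_insert
    omega
  | pent₂ =>
    have := hc.symm.trans P.card_insert
    omega

theorem oldSimp_sub_bijective {j : ℕ} (hj : j ≤ 2) :
    Function.Bijective (Sum.elim P.oldSimp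
      fun s : {s : Finset (Fin 5) // s.card = j + 1 ∧ P.apex ∈ s} =>
        P.inflate.sub P.sndPent s.1 s.2.1) := by
  constructor
  · rintro (σ | s) (τ | s') h
    · exact congrArg _ (P.oldSimp_injective h)
    · exact absurd h.symm (P.sub_sndPent_ne_oldSimp (hs := s'.2.1) s'.2.2 σ)
    · exact absurd h (P.sub_sndPent_ne_oldSimp (hs := s.2.1) s.2.2 τ)
    · exact congrArg _ (Subtype.ext (P.inflate.sub_injective _ (hs := s.2.1) (hs' := s'.2.1) h))
  · intro σ
    rcases P.simp_cases hj σ with ⟨τ, rfl⟩ | ⟨s, hs, ha, rfl⟩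
    · exact ⟨Sum.inl τ, rfl⟩
    · exact ⟨Sum.inr ⟨s, hs, ha⟩, rfl⟩

theorem newEdge_injective : Function.Injective P.newEdge := by
  intro x y h
  have h1 := P.inflate.sub_injective _ (hs := Finset.card_pair (Fin.succAbove_ne _ x).symm)
    (hs' := Finset.card_pair (Fin.succAbove_ne _ y).symm) h
  have h2 : P.apex.succAbove x ∈ ({P.apex, P.apex.succAbove y} : Finset (Fin 5)) := by
    rw [← h1]; simp
  simpa [Fin.succAbove_ne] using h2

theorem edge_bijective : Function.Bijective (Sum.elim P.oldSimp P.newEdge) := by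
  constructor
  · rintro (σ | x) (τ | y) h
    · exact congrArg _ (P.oldSimp_injective h)
    · exact absurd h.symm (P.sub_sndPent_ne_oldSimp (hs := Finset.card_pair (Fin.succAbove_ne _ y).symm) (by simp) σ)
    · exact absurd h (P.sub_sndPent_ne_oldSimp (hs := Finset.card_pair (Fin.succAbove_ne _ x).symm) (by simp) τ)
    · exact congrArg _ (P.newEdge_injective h)
  · intro σ
    rcases P.simp_cases (by omega) σ with ⟨τ, rfl⟩ | ⟨s, hs, ha, rfl⟩
    · exact ⟨Sum.inl τ, rfl⟩
    · have h1 : (s.erase P.apex).card = 1 := by rw [Finset.card_erase_of_mem ha, hs]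
      obtain ⟨y, hy⟩ := Finset.card_eq_one.1 h1
      have hyne : y ≠ P.apex := by
        have : y ∈ s.erase P.apex := by rw [hy]; simp
        exact Finset.ne_of_mem_erase this
      obtain ⟨x, rfl⟩ := Fin.exists_succAbove_eq hyne
      refine ⟨Sum.inr x, P.inflate.sub_congr _ ?_ (Finset.card_pair (Fin.succAbove_ne _ x).symm)⟩
      rw [← hy, Finset.insert_erase ha]

theorem tet_bijective : Function.Bijective
    (Sum.elim P.oldSimp (Sum.elim (fun _ : Unit => P.copySimp) P.newTet)) := by
  have hmem : ∀ x, P.apex ∈ Finset.univ.erase (P.apex.succAbove x) := fun x => by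
    simp [(Fin.succAbove_ne _ _).symm]
  constructor
  · rintro (σ | ⟨⟩ | x) (τ | ⟨⟩ | y) h
    · exact congrArg _ (P.oldSimp_injective h)
    · have := congrArg Subtype.val h
      injection this
    · exact absurd h.symm (P.sub_sndPent_ne_oldSimp (hs := by simp) (hmem y) σ)
    · have := congrArg Subtype.val h
      injection this
    · rfl
    · exact absurd h.symm (P.sub_sndPent_ne_copySimp (hs := by simp) (hmem y))
    · exact absurd h (P.sub_sndPent_ne_oldSimp (hs := by simp) (hmem x) τ)
    · exact absurd h (P.sub_sndPent_ne_copySimp (hs := by simp) (hmem x))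
    · have := P.inflate.d_injective P.sndPent h
      rw [Fin.succAbove_right_injective this]
  · rintro ⟨c, hc⟩
    cases c with
    | old τ => exact ⟨Sum.inl ⟨τ, hc⟩, rfl⟩
    | copy => exact ⟨Sum.inr (Sum.inl ()), rfl⟩
    | pent₁ =>
      have := hc.symm.trans P.card_insert
      omega
    | pent₂ =>
      have := hc.symm.trans P.card_insert
      omega
    | cone B =>
      obtain ⟨s, hs, ha, h⟩ := P.exists_eq_sub B hc
      have h1 : sᶜ.card = 1 := by rw [Finset.card_compl, hs]; rfl
      obtain ⟨y, hy⟩ := Finset.card_eq_one.1 h1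
      have hyne : y ≠ P.apex := by
        rintro rfl
        have : P.apex ∈ sᶜ := by rw [hy]; simp
        exact Finset.mem_compl.1 this ha
      obtain ⟨x, rfl⟩ := Fin.exists_succAbove_eq hyne
      refine ⟨Sum.inr (Sum.inr x), ?_⟩
      rw [h]
      refine P.inflate.sub_congr _ ?_ (by simp)
      rw [← compl_compl s, hy]
      ext z; simp

/-- The tetrahedra after the move. -/
noncomputable def tetEquiv : X.Simp 3 ⊕ (Unit ⊕ Fin 4) ≃ P.inflate.Simp 3 :=
  Equiv.ofBijective _ P.tet_bijective

theorem pent_bijective : Function.Bijective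
    (Sum.elim P.oldSimp (Sum.elim (fun _ : Unit => P.fstPent) fun _ : Unit => P.sndPent)) := by
  constructor
  · rintro (σ | ⟨⟩ | ⟨⟩) (τ | ⟨⟩ | ⟨⟩) h
    · exact congrArg _ (P.oldSimp_injective h)
    all_goals first | rfl | (have := congrArg Subtype.val h; injection this)
  · rintro ⟨c, hc⟩
    cases c with
    | old τ => exact ⟨Sum.inl ⟨τ, hc⟩, rfl⟩
    | copy =>
      have := hc.symm.trans P.card_A
      omega
    | pent₁ => exact ⟨Sum.inr (Sum.inl ()), rfl⟩
    | pent₂ => exact ⟨Sum.inr (Sum.inr ()), rfl⟩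
    | cone B =>
      have h1 := Finset.card_lt_card (Finset.mem_ssubsets.1 B.2)
      have h2 := Finset.card_insert_le P.a B.1
      have h3 : (insert P.a B.1).card = 5 := hc
      rw [P.card_A] at h1
      omega

theorem sum_pents {M : Type*} [AddCommMonoid M] (f : P.inflate.Simp 4 → M) :
    ∑ p, f p = ∑ p, f (P.oldSimp p) + (f P.fstPent + f P.sndPent) := by
  rw [← (Equiv.ofBijective _ P.pent_bijective).sum_comp, Fintype.sum_sum_type,
    Fintype.sum_sum_type]
  simp

theorem prod_pents {M : Type*} [CommMonoid M] (f : P.inflate.Simp 4 → M) :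
    ∏ p, f p = (∏ p, f (P.oldSimp p)) * (f P.fstPent * f P.sndPent) := by
  rw [← (Equiv.ofBijective _ P.pent_bijective).prod_comp, Fintype.prod_sum_type,
    Fintype.prod_sum_type]
  simp

theorem prod_triangles {M : Type*} [CommMonoid M] (f : P.inflate.Simp 2 → M) :
    ∏ s, f s = (∏ s, f (P.oldSimp s)) *
      ∏ s : {s : Finset (Fin 5) // s.card = 2 + 1 ∧ P.apex ∈ s},
        f (P.inflate.sub P.sndPent s.1 s.2.1) := by
  rw [← (Equiv.ofBijective _ (P.oldSimp_sub_bijective le_rfl)).prod_comp, Fintype.prod_sum_type]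
  rfl

theorem exists_d_p_eq : ∃ m, X.d P.p m = P.t := by
  have h1 : P.A ⊆ X.verts P.p.1 := P.subset
  have h2 : (X.verts P.p.1 \ P.A).card = 1 := by
    rw [Finset.card_sdiff_of_subset h1, P.card_A, P.p.2]
  obtain ⟨y, hy⟩ := Finset.card_eq_one.1 h2
  have hyp : y ∈ X.verts P.p.1 := (Finset.mem_sdiff.1 (hy ▸ Finset.mem_singleton_self y)).1
  have : y ∈ Set.range (X.vtx P.p) := by
    unfold vtx
    rw [Finset.range_orderEmbOfFin]
    exact hyp
  obtain ⟨m, rfl⟩ := this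
  refine ⟨m, (P.d_p_eq_iff m).2 ?_⟩
  rw [Finset.map_erase]
  have h3 : Finset.univ.map (X.vtx P.p).toEmbedding = X.verts P.p.1 :=
    Finset.map_orderEmbOfFin_univ _ _
  rw [h3]
  have h4 : (X.vtx P.p).toEmbedding m = X.vtx P.p m := rfl
  rw [h4, ← Finset.sdiff_singleton_eq_erase, ← hy, Finset.sdiff_sdiff_eq_self h1]

theorem pos_vtx (Y : TriComplex.{w} Λ) {k : ℕ} (σ : Y.Simp k) (n : Fin (k + 1)) :
    pos (Y.verts σ.1) (Y.vtx σ n) = n := by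
  have h : (Y.verts σ.1).filter (· < Y.vtx σ n) = (Finset.Iio n).map (Y.vtx σ).toEmbedding := by
    have h3 : Finset.univ.map (Y.vtx σ).toEmbedding = Y.verts σ.1 :=
      Finset.map_orderEmbOfFin_univ _ _
    rw [← h3]
    ext y
    simp only [Finset.mem_filter, Finset.mem_map, Finset.mem_univ, true_and, Finset.mem_Iio]
    constructor
    · rintro ⟨⟨x, rfl⟩, hx⟩
      exact ⟨x, (Y.vtx σ).lt_iff_lt.1 hx, rfl⟩
    · rintro ⟨x, hx, rfl⟩
      exact ⟨⟨x, rfl⟩, (Y.vtx σ).lt_iff_lt.2 hx⟩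
  rw [pos, h, Finset.card_map, Fin.card_Iio]

theorem pos_a : pos (insert P.a P.A) P.a = P.apex := by
  have := pos_vtx P.inflate P.sndPent P.apex
  rw [P.vtx_apex] at this
  exact this

variable (ε : X.Simp 4 → ℤˣ)

theorem bdSign_oldSimp (p : X.Simp 4) (m : Fin 5) :
    Coloring.bdSign (P.newSign ε) (P.oldSimp p) m = Coloring.bdSign ε p m := rfl

theorem bdSign_fstPent (m : Fin 5) : Coloring.bdSign (P.newSign ε) P.fstPent m =
    -Coloring.bdSign (P.newSign ε) P.sndPent m := by
  have h : P.newSign ε P.sndPent = -P.newSign ε P.fstPent := rfl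
  simp [Coloring.bdSign, h]

/-- The first new pentachoron takes over the place of `p` at `t`, so it must induce there the
orientation that `p` did; the two powers with the number of the apex cancel. -/
theorem bdSign_fstPent_apex {m : Fin 5} (hm : X.d P.p m = P.t) :
    Coloring.bdSign (P.newSign ε) P.fstPent P.apex = Coloring.bdSign ε P.p m := by
  have h1 : X.verts P.p.1 \ P.A = {X.vtx P.p m} := by
    rw [← (P.d_p_eq_iff m).1 hm, Finset.map_erase]
    have h3 : Finset.univ.map (X.vtx P.p).toEmbedding = X.verts P.p.1 :=
      Finset.map_orderEmbOfFin_univ _ _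
    rw [h3]
    refine (Finset.sdiff_erase (Finset.orderEmbOfFin_mem (X.verts P.p.1) P.p.2 m)).trans ?_
    rw [Finset.sdiff_self]
    rfl
  have h2 : P.newSign ε P.fstPent = ε P.p * (-1) ^ (m : ℕ) * (-1) ^ (P.apex : ℕ) := by
    change ε P.p * (∏ x ∈ X.verts P.p.1 \ P.A, (-1) ^ pos (X.verts P.p.1) x) *
      (-1) ^ pos (insert P.a P.A) P.a = _
    rw [h1, Finset.prod_singleton, pos_vtx, P.pos_a]
  simp only [Coloring.bdSign, h2]
  push_cast
  rw [mul_assoc, ← pow_add, Even.neg_one_pow ⟨_, rfl⟩, mul_one]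

open Classical in
/-- The new pentachora are oriented coherently. -/
theorem inflate_sum_eq_zero (hX : X.IsClosedOriented ε) (t : P.inflate.Simp 3) :
    ∑ p : P.inflate.Simp 4, ∑ m : Fin 5,
      (if P.inflate.d p m = t then Coloring.bdSign (P.newSign ε) p m else 0) = 0 := by
  obtain ⟨m₀, hm₀⟩ := P.exists_d_p_eq
  have hsplit : ∀ f : Fin 5 → ℂ, ∑ m, f m = f P.apex + ∑ x, f (P.apex.succAbove x) :=
    fun f => Fin.sum_univ_succAbove f _
  -- The interior tetrahedra cancel between the two new pentachora, which leaves `t` and its copy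
  -- with opposite signs.
  have hu : ∑ m : Fin 5,
      (if P.inflate.d P.fstPent m = t then Coloring.bdSign (P.newSign ε) P.fstPent m else 0) +
      ∑ m : Fin 5,
      (if P.inflate.d P.sndPent m = t then Coloring.bdSign (P.newSign ε) P.sndPent m else 0) =
      (if P.oldSimp P.t = t then Coloring.bdSign ε P.p m₀ else 0) -
        (if P.copySimp = t then Coloring.bdSign ε P.p m₀ else 0) := by
    have h1 := P.bdSign_fstPent_apex ε hm₀
    have h2 := P.bdSign_fstPent ε
    have h3 : Coloring.bdSign (P.newSign ε) P.sndPent P.apex = -Coloring.bdSign ε P.p m₀ := by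
      rw [← h1, h2, neg_neg]
    rw [hsplit, hsplit, P.d_fstPent_apex, P.d_sndPent_apex, h1, h3]
    simp only [P.d_fstPent, h2]
    have h4 : ∀ x, (if P.newTet x = t then
        -Coloring.bdSign (P.newSign ε) P.sndPent (P.apex.succAbove x) else 0) =
        -(if P.inflate.d P.sndPent (P.apex.succAbove x) = t then
          Coloring.bdSign (P.newSign ε) P.sndPent (P.apex.succAbove x) else 0) := by
      intro x
      rw [newTet]
      split_ifs <;> simp
    simp only [h4, Finset.sum_neg_distrib]
    split_ifs <;> ring
  rw [P.sum_pents, hu]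
  -- The old pentachora give the old sum, except that one 3-face of `p` has been moved from `t` to
  -- the copy.
  have hold : ∑ p : X.Simp 4, ∑ m : Fin 5, (if P.inflate.d (P.oldSimp p) m = t then
      Coloring.bdSign (P.newSign ε) (P.oldSimp p) m else 0) =
      ∑ p : X.Simp 4, ∑ m : Fin 5, (if P.oldSimp (X.d p m) = t then
        Coloring.bdSign ε p m else 0) -
      (if P.oldSimp P.t = t then Coloring.bdSign ε P.p m₀ else 0) +
        (if P.copySimp = t then Coloring.bdSign ε P.p m₀ else 0) := by
    have h5 : ∀ p m, (if P.inflate.d (P.oldSimp p) m = t then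
        Coloring.bdSign (P.newSign ε) (P.oldSimp p) m else 0) =
        (if P.oldSimp (X.d p m) = t then Coloring.bdSign ε p m else 0) +
        (if p = P.p then if m = m₀ then (-(if P.oldSimp P.t = t then Coloring.bdSign ε P.p m₀ else 0) +
        (if P.copySimp = t then Coloring.bdSign ε P.p m₀ else 0)) else 0 else 0) := by
      intro p m
      rw [P.d_oldSimp_pent, P.bdSign_oldSimp]
      by_cases hp : p = P.p
      · subst hp
        by_cases hm : m = m₀
        · subst hm
          simp only [hm₀, true_and, if_true]
          ring
        · have : X.d P.p m ≠ P.t := fun h => hm (X.d_injective _ (h.trans hm₀.symm))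
          simp [this, hm]
      · simp [hp]
    simp only [h5, Finset.sum_add_distrib]
    rw [Finset.sum_eq_single (f := fun p => ∑ m : Fin 5, if p = P.p then _ else _) P.p
      (fun p _ hp => by simp only [if_neg hp, Finset.sum_const_zero]) (fun h => absurd (Finset.mem_univ _) h)]
    simp only [if_true, Finset.sum_ite_eq', Finset.mem_univ]
    ring
  rw [hold]
  have hmain : ∑ p : X.Simp 4, ∑ m : Fin 5, (if P.oldSimp (X.d p m) = t then
      Coloring.bdSign ε p m else 0) = 0 := by
    by_cases ht : ∃ t₀, t = P.oldSimp t₀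
    · obtain ⟨t₀, rfl⟩ := ht
      refine Eq.trans ?_ (hX.sum_eq_zero t₀)
      simp only [P.oldSimp_injective.eq_iff]
    · refine Finset.sum_eq_zero fun p _ => Finset.sum_eq_zero fun m _ => if_neg fun h => ht ⟨_, h.symm⟩
  rw [hmain]
  ring

end Site

end TriComplex

/-! ### The chain complex: acyclicity and torsion. -/

namespace TriComplex

variable {Λ : Type v} [LinearOrder Λ] {X : TriComplex.{u} Λ} {ε : X.Simp 4 → ℤˣ}

theorem dotProduct_surjective {N : Type*} [Fintype N] (φ : (N → ℂ) →ₗ[ℂ] ℂ) :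
    ∃ w : N → ℂ, ∀ x, φ x = w ⬝ᵥ x := by
  classical
  refine ⟨fun n => φ (Pi.single n 1), fun x => ?_⟩
  rw [LinearMap.pi_apply_eq_sum_univ φ x]
  refine Finset.sum_congr rfl fun n _ => ?_
  have : (fun j => if n = j then (1 : ℂ) else 0) = Pi.single n 1 := by
    ext j
    simp [Pi.single_apply, eq_comm]
  rw [this, smul_eq_mul, mul_comm]

/-- A functional that vanishes on the kernel of a map to a space of columns factors through it. -/
theorem exists_dotProduct_of_ker {V N : Type*} [AddCommGroup V] [Module ℂ V] [Fintype N]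
    (f : V →ₗ[ℂ] (N → ℂ)) (φ : V →ₗ[ℂ] ℂ) (h : ∀ v, f v = 0 → φ v = 0) :
    ∃ w : N → ℂ, ∀ v, φ v = w ⬝ᵥ f v := by
  have h1 : φ ∈ (LinearMap.ker f).dualAnnihilator := by
    rw [Submodule.mem_dualAnnihilator]
    exact fun v hv => h v hv
  rw [← LinearMap.range_dualMap_eq_dualAnnihilator_ker] at h1
  obtain ⟨g, rfl⟩ := h1
  obtain ⟨w, hw⟩ := dotProduct_surjective g
  exact ⟨w, fun v => hw _⟩

namespace Coloring

variable (D : X.Coloring ε)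

theorem f2_apply (c : X.Z2) (t : X.Simp 3) : D.f2 c t = D.β t (X.res t c) := rfl

theorem f4_apply (w : X.Simp 3 → ℂ) (c : X.Z2) : D.f4 w c = w ⬝ᵥ D.f2 c := by
  simp [f4, dotProduct]

/-- The form is a sum over pentachora, each involving only its own five 3-faces; pairings of vectors
of small support are thus computed locally. -/
theorem f3Matrix_form (x y : X.Simp 3 → ℂ) : x ⬝ᵥ D.f3Matrix *ᵥ y =
    ∑ p, ∑ m, ∑ n, x (X.d p m) * D.F p m n * y (X.d p n) := by
  classical
  simp only [dotProduct, mulVec, f3Matrix, Finset.mul_sum, Finset.sum_mul]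
  have h : ∀ t t' p m n, x t * ((if X.d p m = t ∧ X.d p n = t' then D.F p m n else 0) * y t') =
      if X.d p m = t then if X.d p n = t' then x (X.d p m) * D.F p m n * y (X.d p n) else 0 else 0 := by
    intro t t' p m n
    split_ifs <;> simp_all [mul_assoc]
  simp only [h]
  calc _ = ∑ t, ∑ p, ∑ t', ∑ m, ∑ n, (if X.d p m = t then if X.d p n = t' then
        x (X.d p m) * D.F p m n * y (X.d p n) else 0 else 0) :=
        Finset.sum_congr rfl fun t _ => Finset.sum_comm
    _ = ∑ p, ∑ t, ∑ t', ∑ m, ∑ n, (if X.d p m = t then if X.d p n = t' then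
        x (X.d p m) * D.F p m n * y (X.d p n) else 0 else 0) := Finset.sum_comm
    _ = _ := Finset.sum_congr rfl fun p _ => ?_
  calc _ = ∑ t, ∑ m, ∑ t', ∑ n, (if X.d p m = t then if X.d p n = t' then
        x (X.d p m) * D.F p m n * y (X.d p n) else 0 else 0) :=
        Finset.sum_congr rfl fun t _ => Finset.sum_comm
    _ = ∑ m, ∑ t, ∑ t', ∑ n, (if X.d p m = t then if X.d p n = t' then
        x (X.d p m) * D.F p m n * y (X.d p n) else 0 else 0) := Finset.sum_comm
    _ = _ := Finset.sum_congr rfl fun m _ => ?_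
  calc _ = ∑ t, ∑ n, ∑ t', (if X.d p m = t then if X.d p n = t' then
        x (X.d p m) * D.F p m n * y (X.d p n) else 0 else 0) :=
        Finset.sum_congr rfl fun t _ => Finset.sum_comm
    _ = ∑ n, ∑ t, ∑ t', (if X.d p m = t then if X.d p n = t' then
        x (X.d p m) * D.F p m n * y (X.d p n) else 0 else 0) := Finset.sum_comm
    _ = _ := Finset.sum_congr rfl fun n _ => ?_
  simp

theorem f3Matrix_transpose : D.f3Matrixᵀ = -D.f3Matrix := by
  ext t t'
  simp only [Matrix.transpose_apply, Matrix.neg_apply, f3Matrix, ← Finset.sum_neg_distrib]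
  refine Finset.sum_congr rfl fun p _ => ?_
  rw [Finset.sum_comm]
  refine Finset.sum_congr rfl fun m _ => Finset.sum_congr rfl fun n _ => ?_
  rw [D.F_skew p n m]
  split_ifs <;> simp_all

theorem form_skew (x y : X.Simp 3 → ℂ) : x ⬝ᵥ D.f3Matrix *ᵥ y = -(y ⬝ᵥ D.f3Matrix *ᵥ x) := by
  rw [dotProduct_mulVec, ← mulVec_transpose, f3Matrix_transpose, dotProduct_comm, neg_mulVec,
    dotProduct_neg]

-- Each pentachoron at `t` contributes the same number `γ_t(c)` with its boundary sign, so these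
-- contributions cancel. The cancellation of signs alone is assumed, as this is what is proved after
-- the move.
open Classical in
theorem f3Matrix_mulVec_f2 (h : ∀ t : X.Simp 3, ∑ p : X.Simp 4, ∑ m : Fin 5,
    (if X.d p m = t then bdSign ε p m else 0) = 0) (c : X.Z2) : D.f3Matrix *ᵥ D.f2 c = 0 := by
  ext t
  have h1 := D.f3Matrix_form (Pi.single t 1) (D.f2 c)
  rw [single_one_dotProduct] at h1
  rw [h1]
  have h2 : ∀ p m, ∑ n, (Pi.single t 1 : X.Simp 3 → ℂ) (X.d p m) * D.F p m n * D.f2 c (X.d p n) =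
      -D.γ t (X.res t c) * (if X.d p m = t then bdSign ε p m else 0) := by
    intro p m
    split_ifs with hm
    · have h3 := D.annihilate_of_mem_Z2 c.2 p m
      subst hm
      simp only [Pi.single_eq_same, one_mul]
      rw [neg_mul, mul_comm, h3, ← Finset.sum_neg_distrib]
      refine Finset.sum_congr rfl fun n _ => ?_
      rw [D.F_skew p m n, f2_apply]
      ring
    · simp [hm]
  simp only [h2, ← Finset.mul_sum, h t, mul_zero, Pi.zero_apply]

/-- For the edges `01` and `02` the antisymmetric part times the roots has square `ω₀²`, where `ω₀`
is the value on the face opposite to the vertex `0`. -/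
theorem exists_tetForm_ne_zero (t : X.Simp 3) : ∃ b b' : X.Simp 1,
    tetForm (X.res t D.q) (X.res t (X.edgeCob b)) (X.res t (X.edgeCob b')) ≠ 0 := by
  have hw : ∑ n : Fin 4, (-1 : ℂ) ^ (n : ℕ) * (fun n => X.res t D.q n ^ 2) n = 0 :=
    X.isTetCocycle_res D.sq_mem t
  have h1 := edgeVec_wedge hw (a := 0) (b := 1) (c := 2) (by decide) (by decide) (by decide)
  have h2 := tetForm_sub_swap_mul (X.res t D.q) (edgeVec 0 1) (edgeVec 0 2)
    (fun n => D.q_ne_zero _)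
  by_contra! h
  have e1 := X.res_edgeCob t (a := 0) (b := 1) (by decide)
  have e2 := X.res_edgeCob t (a := 0) (b := 2) (by decide)
  rw [← e1, ← e2, h, h] at h2
  rw [← e1, ← e2, ← h2] at h1
  have h3 : X.res t D.q 0 ≠ 0 := D.q_ne_zero _
  have h4 := pow_ne_zero 2 (pow_ne_zero 2 h3)
  rw [← h1] at h4
  simp at h4

theorem exists_γ_ne_zero (t : X.Simp 3) : ∃ b : X.Simp 1, D.γ t (X.res t (X.edgeCob b)) ≠ 0 := by
  obtain ⟨b, b', h⟩ := D.exists_tetForm_ne_zero t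
  refine ⟨b', fun h' => h ?_⟩
  rw [← D.β_mul_γ t _ _ (X.isTetCocycle_res (X.edgeCob_mem_Z2 _) t)
    (X.isTetCocycle_res (X.edgeCob_mem_Z2 _) t), h', mul_zero]

/-- For `c = ω` all ratios `x n` are one: the area term telescopes to zero, and the symmetric part
is the cocycle condition for the other argument. As `γ_t` is nonzero on some edge, `β_t` kills `ω`.
-/
theorem f2_ω : D.f2 D.ω = 0 := by
  ext t
  obtain ⟨b, hb⟩ := D.exists_γ_ne_zero t
  have hc := X.isTetCocycle_res (X.edgeCob_mem_Z2 b) t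
  have h := D.β_mul_γ t (X.res t D.ω) _ (X.isTetCocycle_res D.ω.2 t) hc
  have hq : ∀ n, X.res t D.q n ≠ 0 := fun n => D.q_ne_zero _
  have hω : X.res t (D.ω : X.Simp 2 → ℂ) = fun n => X.res t D.q n ^ 2 := rfl
  have h0 : tetForm (X.res t D.q) (X.res t D.ω) (X.res t (X.edgeCob b)) = 0 := by
    rw [hω]
    generalize X.res t D.q = q at hq
    generalize X.res t (X.edgeCob b) = c at hc
    simp only [tetForm]
    have h1 : ∀ n, q n ^ 2 / q n ^ 2 = 1 := fun n => div_self (pow_ne_zero 2 (hq n))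
    simp only [h1]
    have h2 : ∑ n : Fin 4, (-1 : ℂ) ^ (n : ℕ) * (q n ^ 2 * 1 * (c n / q n ^ 2)) = 0 := by
      rw [← hc]
      refine Finset.sum_congr rfl fun n _ => ?_
      have := hq n
      field_simp
    rw [h2]
    ring
  rw [h0] at h
  exact (mul_eq_zero.1 h).resolve_right hb

theorem f1_apply (z : ℂ) : D.f1 z = z • D.ω := rfl

/-- The complex is self-dual, as `f₄`, `f₅` are the transposes of `f₂`, `f₁` and `f₃` is skew.
Exactness of the left half thus gives the right half, by factoring functionals that vanish on a
kernel. -/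
theorem isAcyclic_of (hω : D.ω ≠ 0) (hker : ∀ v, D.f2 v = 0 → ∃ s : ℂ, v = s • D.ω)
    (hex : ∀ x, D.f3Matrix *ᵥ x = 0 → ∃ v, D.f2 v = x) (hAf : ∀ v, D.f3Matrix *ᵥ D.f2 v = 0) :
    D.IsAcyclic := by
  refine ⟨fun a b h => smul_left_injective ℂ hω h, fun v => ⟨fun h => ?_, ?_⟩,
    fun x => ⟨fun h => hex x h, ?_⟩, fun w => ⟨fun h => ?_, ?_⟩, fun φ => ⟨fun h => ?_, ?_⟩, fun z => ?_⟩
  · obtain ⟨s, rfl⟩ := hker v h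
    exact ⟨s, rfl⟩
  · rintro ⟨s, rfl⟩
    rw [f1_apply, map_smul, f2_ω, smul_zero]
  · rintro ⟨v, rfl⟩
    exact hAf v
  · obtain ⟨x, hx⟩ := exists_dotProduct_of_ker D.f3 (dotProductBilin ℂ ℂ w) fun y hy => by
      obtain ⟨v, rfl⟩ := hex y hy
      have := D.f4_apply w v
      rw [h] at this
      exact this.symm
    refine ⟨-x, ?_⟩
    have h1 : ∀ y, w ⬝ᵥ y = D.f3 (-x) ⬝ᵥ y := by
      intro y
      have h2 : w ⬝ᵥ y = x ⬝ᵥ D.f3Matrix *ᵥ y := hx y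
      rw [h2, D.form_skew, dotProduct_comm (D.f3 (-x)) y]
      change _ = y ⬝ᵥ D.f3Matrix *ᵥ (-x)
      rw [mulVec_neg, dotProduct_neg]
    exact (dotProduct_eq _ _ h1).symm
  · rintro ⟨x, rfl⟩
    ext v
    rw [f4_apply, LinearMap.zero_apply, dotProduct_comm]
    change D.f2 v ⬝ᵥ D.f3Matrix *ᵥ x = 0
    rw [D.form_skew, hAf, dotProduct_zero, neg_zero]
  · obtain ⟨w, hw⟩ := exists_dotProduct_of_ker D.f2 φ fun v hv => by
      obtain ⟨s, rfl⟩ := hker v hv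
      have : φ D.ω = 0 := h
      rw [map_smul, this, smul_zero]
    exact ⟨w, LinearMap.ext fun v => by rw [f4_apply, hw]⟩
  · rintro ⟨w, rfl⟩
    change D.f4 w D.ω = 0
    rw [f4_apply, f2_ω, dotProduct_zero]
  · have h1 : ∃ φ : Module.Dual ℂ X.Z2, φ D.ω ≠ 0 := by
      by_contra! h
      exact hω ((Module.forall_dual_apply_eq_zero_iff ℂ D.ω).1 h)
    obtain ⟨φ, hφ⟩ := h1
    refine ⟨(z / φ D.ω) • φ, ?_⟩
    change z / φ D.ω * φ D.ω = z
    exact div_mul_cancel₀ z hφ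

variable {D}

theorem IsAcyclic.ω_ne_zero (h : D.IsAcyclic) : D.ω ≠ 0 := by
  intro h0
  have := h.1 (a₁ := 1) (a₂ := 0) (by simp [f1_apply, h0])
  exact one_ne_zero this

theorem IsAcyclic.exists_smul_ω (h : D.IsAcyclic) {v : X.Z2} (hv : D.f2 v = 0) :
    ∃ s : ℂ, v = s • D.ω := by
  obtain ⟨s, hs⟩ := (h.2.1 v).1 hv
  exact ⟨s, hs.symm⟩

theorem IsAcyclic.mulVec_f2 (h : D.IsAcyclic) (v : X.Z2) : D.f3Matrix *ᵥ D.f2 v = 0 :=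
  (h.2.2.1 _).2 ⟨v, rfl⟩

open Classical in
/-- The square of the torsion can be computed from arbitrary frames. -/
theorem IsSqrtTorsion.sq_mul {r : ℕ} {Z : X.CocycleBasis r} {y : ℂ} (h : D.IsSqrtTorsion Z y)
    (hω : D.ω ≠ 0) (hAf : ∀ v, D.f3Matrix *ᵥ D.f2 v = 0)
    {ι κ : Type*} [Fintype ι] [Fintype κ] [DecidableEq ι] [DecidableEq κ] {c : ι → X.Z2}
    {B : κ → X.Simp 3 → ℂ} (eJ : Unit ⊕ ι ≃ {b : X.Simp 1 // b ∉ Z.tree} ⊕ Fin r)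
    (eT : ι ⊕ κ ≃ X.Simp 3) (hF : (frame D.f2 c B eT).det ≠ 0) :
    y ^ 2 * (frame D.f2 c B eT).det ^ 2 =
      (coordMatrix Z.basis D.ω c eJ).det ^ 2 * (formGram D.f3Matrix B).det := by
  obtain ⟨i₀, R, k, m, col, row, rest, h1, h2, h3, rfl⟩ := h
  have h4 := torsion_indep Z.basis hω D.f2_ω D.f3Matrix_transpose hAf eJ eT (colEquiv col)
    ((row.sumCongr rest).trans (Equiv.sumCompl (· ∈ R))) hF
    (c' := fun a => Z.basis (col a).1) (B' := fun a => Pi.single (rest a).1 1)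
  rw [frame_row_det, coordMatrix_col_det, formGram_single] at h4
  have h5 := pfaffian_sq (D.f3Matrix.submatrix (fun a => (rest a).1) (fun a => (rest a).1))
    (by rw [Matrix.transpose_submatrix, f3Matrix_transpose]; rfl) h3
  rw [← h5] at h4
  rw [div_pow, div_mul_eq_mul_div, div_eq_iff (pow_ne_zero 2 h2)]
  linear_combination h4

theorem IsAcyclic.exists_isSqrtTorsion (h : D.IsAcyclic) {r : ℕ} (Z : X.CocycleBasis r) :
    ∃ y, D.IsSqrtTorsion Z y := by
  classical
  obtain ⟨i₀, R, k, m, col, row, rest, h1, h2, h3⟩ := exists_torsion_minors Z.basis h.ω_ne_zero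
    D.f2_ω (fun v => h.exists_smul_ω) D.f3Matrix_transpose (fun x hx => (h.2.2.1 x).1 hx) h.mulVec_f2
  exact ⟨_, i₀, R, k, m, col, row, rest, h1, h2, h3, rfl⟩

/-- The frames given by minors. -/
theorem IsAcyclic.exists_frame (h : D.IsAcyclic) {r : ℕ} (Z : X.CocycleBasis r) :
    ∃ (k l : ℕ) (c : Fin k → X.Z2) (B : Fin l → X.Simp 3 → ℂ)
      (_ : Unit ⊕ Fin k ≃ {b : X.Simp 1 // b ∉ Z.tree} ⊕ Fin r) (eT : Fin k ⊕ Fin l ≃ X.Simp 3),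
      (frame D.f2 c B eT).det ≠ 0 ∧ (formGram D.f3Matrix B).det ≠ 0 := by
  classical
  obtain ⟨i₀, R, k, m, col, row, rest, h1, h2, h3⟩ := exists_torsion_minors Z.basis h.ω_ne_zero
    D.f2_ω (fun v => h.exists_smul_ω) D.f3Matrix_transpose (fun x hx => (h.2.2.1 x).1 hx) h.mulVec_f2
  refine ⟨k, 2 * m, fun a => Z.basis (col a).1, fun a => Pi.single (rest a).1 1, colEquiv col,
    (row.sumCongr rest).trans (Equiv.sumCompl (· ∈ R)), ?_, ?_⟩
  · rw [frame_row_det]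
    exact h2
  · rw [formGram_single]
    exact h3

/-- The other side of the relation for `η ^ 2` is nonzero wherever an edge component is. -/
theorem η_ne_zero (p : X.Simp 4) : D.η p ≠ 0 := by
  obtain ⟨e, m, he⟩ := D.exists_bEdge_ne_zero p
  have hcard : e.card = 2 := by
    by_contra h
    exact he (by rw [bEdge, dif_neg h])
  have hm : m ∉ e := fun h => he (D.bEdge_eq_zero p h)
  obtain ⟨x, y, hxy, rfl⟩ := Finset.card_eq_two.1 hcard
  simp only [Finset.mem_insert, Finset.mem_singleton, not_or] at hm
  obtain ⟨σ, rfl, rfl, rfl⟩ := exists_perm x y m hxy (Ne.symm hm.1) (Ne.symm hm.2)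
  intro h
  have e1 := D.η_sq_perm p σ
  rw [h, zero_pow two_ne_zero, zero_mul] at e1
  have hσ : ∀ {x y : Fin 5}, x ≠ y → D.qOpp p (σ x) (σ y) ≠ 0 := fun h =>
    D.qOpp_ne_zero p (σ.injective.ne h)
  have h3 : ((Equiv.Perm.sign σ : ℤ) : ℂ) ≠ 0 := by
    rcases Int.units_eq_one_or (Equiv.Perm.sign σ) with h | h <;> simp [h]
  exact absurd e1.symm (mul_ne_zero h3 (mul_ne_zero he (mul_ne_zero (mul_ne_zero (mul_ne_zero
    (hσ (by decide)) (hσ (by decide))) (hσ (by decide))) (hσ (by decide)))))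

end Coloring

/-! ### Integral relations between the edge coboundaries. -/

theorem mem_of_sum_eq_zero {I M : Type*} [Fintype I] [AddCommGroup M] (S : Submodule ℤ M) {k : I → ℤ} {v : I → M}
    (h : ∑ i, k i • v i = 0) {j : I} (hj : IsUnit (k j)) (hS : ∀ i, i ≠ j → k i = 0 ∨ v i ∈ S) :
    v j ∈ S := by
  classical
  rw [← Finset.add_sum_erase _ _ (Finset.mem_univ j)] at h
  have h1 : ∑ i ∈ Finset.univ.erase j, k i • v i ∈ S := by
    refine S.sum_mem fun i hi => ?_
    rcases hS i (Finset.ne_of_mem_erase hi) with h | h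
    · rw [h, zero_smul]; exact S.zero_mem
    · exact S.smul_mem _ h
  have h2 : k j • v j ∈ S := by
    rw [eq_neg_of_add_eq_zero_left h]
    exact S.neg_mem h1
  rcases Int.isUnit_iff.1 hj with h | h
  · rwa [h, one_smul] at h2
  · rw [h, neg_smul, one_smul] at h2
    simpa using S.neg_mem h2

/-- The coboundary of an edge, as a cocycle. -/
noncomputable def edgeZ (X : TriComplex.{u} Λ) (b : X.Simp 1) : X.Z2 := ⟨X.edgeCob b, X.edgeCob_mem_Z2 b⟩

theorem sum_smul_edgeZ_eq_zero (χ : X.Simp 0 → ℤ) :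
    ∑ e, (χ (X.d e 0) - χ (X.d e 1)) • X.edgeZ e = 0 := by
  refine Subtype.ext ?_
  rw [ZeroMemClass.coe_zero, ← X.sum_smul_edgeCob_eq_zero χ]
  push_cast
  rfl

/-- The relation given by a cut of the tree has coefficient one at the edge `b` and zero at all
other tree edges, so it expresses `b` integrally through the edges outside of the tree. -/
theorem IsSpanningTree.edgeZ_mem {T : Set (X.Simp 1)} (hT : X.IsSpanningTree T)
    (S : Submodule ℤ X.Z2) (h : ∀ b ∉ T, X.edgeZ b ∈ S) (b : X.Simp 1) : X.edgeZ b ∈ S := by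
  by_cases hb : b ∈ T
  · obtain ⟨χ, h1, h2⟩ := hT.exists_cut hb
    refine mem_of_sum_eq_zero S (sum_smul_edgeZ_eq_zero χ) (h1 ▸ isUnit_one) fun e he => ?_
    by_cases heT : e ∈ T
    · exact Or.inl (h2 e heT he)
    · exact Or.inr (h e heT)
  · exact h b hb

theorem CocycleBasis.basis_inl' {r : ℕ} (Z : X.CocycleBasis r) (b : {b : X.Simp 1 // b ∉ Z.tree}) :
    Z.basis (Sum.inl b) = X.edgeZ b.1 := Subtype.ext (Z.basis_inl b)

theorem CocycleBasis.edgeZ_mem {r : ℕ} (Z : X.CocycleBasis r) (b : X.Simp 1) :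
    X.edgeZ b ∈ Submodule.span ℤ (Set.range Z.basis) :=
  Z.isSpanningTree.edgeZ_mem _ (fun e he => by
    rw [← Z.basis_inl' ⟨e, he⟩]
    exact Submodule.subset_span ⟨_, rfl⟩) b

/-- Coboundaries are combinations of edge coboundaries, and these lie in the span of the first group
of basis vectors. -/
theorem CocycleBasis.repr_coboundary {r : ℕ} (Z : X.CocycleBasis r) (y : X.Simp 1 → ℂ) (k : Fin r) :
    Z.basis.repr (⟨X.coboundary 1 y, X.coboundary_mem_Z2 y⟩ : X.Z2) (Sum.inr k) = 0 := by
  have h1 : (⟨X.coboundary 1 y, X.coboundary_mem_Z2 y⟩ : X.Z2) = ∑ b, y b • X.edgeZ b := by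
    refine Subtype.ext ?_
    push_cast
    exact X.coboundary_eq_sum y
  have h2 : ∀ b, Z.basis.coord (Sum.inr k) (X.edgeZ b) = 0 := by
    refine Z.isSpanningTree.edgeZ_mem ((LinearMap.ker (Z.basis.coord (Sum.inr k))).restrictScalars ℤ)
      fun b hb => ?_
    rw [← Z.basis_inl' ⟨b, hb⟩]
    simp
  rw [h1, ← Module.Basis.coord_apply, map_sum]
  refine Finset.sum_eq_zero fun b _ => ?_
  rw [map_smul, h2, smul_zero]

end TriComplex

/-! ### Comparison of the colourings before and after the move. -/

namespace TriComplex

variable {Λ : Type v} [LinearOrder Λ]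

namespace Site

variable {X : TriComplex.{u} Λ} (P : X.Site)

theorem res_oldSimp (t : X.Simp 3) (c : P.inflate.Simp 2 → ℂ) :
    P.inflate.res (P.oldSimp t) c = X.res t (c ∘ P.oldSimp) :=
  funext fun n => congrArg c (P.d_oldSimp t n le_rfl)

theorem res_copySimp (c : P.inflate.Simp 2 → ℂ) :
    P.inflate.res P.copySimp c = X.res P.t (c ∘ P.oldSimp) :=
  funext fun n => congrArg c (P.d_copySimp n)

theorem coboundary_comp_oldSimp {k : ℕ} (hk : k ≤ 2) (c : P.inflate.Simp k → ℂ) :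
    P.inflate.coboundary k c ∘ P.oldSimp = X.coboundary k (c ∘ P.oldSimp) := by
  ext σ
  change ∑ n : Fin (k + 2), (-1 : ℂ) ^ (n : ℕ) * c (P.inflate.d (P.oldSimp σ) n) =
    ∑ n : Fin (k + 2), (-1 : ℂ) ^ (n : ℕ) * c (P.oldSimp (X.d σ n))
  exact Finset.sum_congr rfl fun n _ => by rw [P.d_oldSimp σ n hk]

/-- The restriction of cocycles to the old 2-faces. -/
noncomputable def restrict : P.inflate.Z2 →ₗ[ℂ] X.Z2 where
  toFun c := ⟨(c : P.inflate.Simp 2 → ℂ) ∘ P.oldSimp, by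
    have h : P.inflate.coboundary 2 c = 0 := c.2
    change X.coboundary 2 _ = 0
    rw [← P.coboundary_comp_oldSimp le_rfl, h]
    rfl⟩
  map_add' _ _ := rfl
  map_smul' _ _ := rfl

theorem restrict_edgeZ_oldSimp (b : X.Simp 1) :
    P.restrict (P.inflate.edgeZ (P.oldSimp b)) = X.edgeZ b := by
  classical
  refine Subtype.ext ((P.coboundary_comp_oldSimp (by omega) _).trans (congrArg (X.coboundary 1) ?_))
  ext e
  simp only [Function.comp, Pi.single_apply, P.oldSimp_injective.eq_iff]

theorem restrict_edgeZ_newEdge (x : Fin 4) : P.restrict (P.inflate.edgeZ (P.newEdge x)) = 0 := by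
  classical
  refine Subtype.ext ((P.coboundary_comp_oldSimp (by omega) _).trans ?_)
  have h : (Pi.single (P.newEdge x) 1 : P.inflate.Simp 1 → ℂ) ∘ P.oldSimp = 0 := by
    ext e
    refine Pi.single_eq_of_ne (Ne.symm ?_) _
    exact P.sub_sndPent_ne_oldSimp (by simp) e
  rw [h, map_zero]
  rfl

variable {P} {ε : X.Simp 4 → ℤˣ} {D : X.Coloring ε} {D' : P.inflate.Coloring (P.newSign ε)}

theorem Extends.restrict_ω (hD : P.Extends D D') : P.restrict D'.ω = D.ω :=
  Subtype.ext (funext fun s => congrArg (· ^ 2) (hD s))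

variable (P D D') in
/-- The rescaling of the Grassmann generators at the old tetrahedra and at the copy that compares
the two colourings. -/
structure Gauge where
  scale : X.Simp 3 → ℂ
  copyScale : ℂ
  scale_ne_zero : ∀ t, scale t ≠ 0
  copyScale_ne_zero : copyScale ≠ 0
  β_old : ∀ t c, IsTetCocycle c → D'.β (P.oldSimp t) c = scale t * D.β t c
  γ_old : ∀ t c, IsTetCocycle c → scale t * D'.γ (P.oldSimp t) c = D.γ t c
  β_copy : ∀ c, IsTetCocycle c → D'.β P.copySimp c = copyScale * D.β P.t c
  γ_copy : ∀ c, IsTetCocycle c → copyScale * D'.γ P.copySimp c = D.γ P.t c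

/-- An old tetrahedron, and likewise the copy of `t`, keeps its 2-faces and their colours, hence its
form; the factors of a form are unique up to rescaling. -/
theorem Extends.nonempty_gauge (hD : P.Extends D D') : Nonempty (P.Gauge D D') := by
  have hq : D'.q ∘ P.oldSimp = D.q := funext hD
  have h1 : ∀ t, ∃ l : ℂ, l ≠ 0 ∧ ∀ c, IsTetCocycle c →
      D'.β (P.oldSimp t) c = l * D.β t c ∧ l * D'.γ (P.oldSimp t) c = D.γ t c := fun t =>
    exists_rescaling (q := X.res t D.q) (fun n => D.q_ne_zero _) (D.β_mul_γ t) (by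
      have := D'.β_mul_γ (P.oldSimp t)
      rwa [P.res_oldSimp, hq] at this)
  obtain ⟨l, hl, h2⟩ : ∃ l : ℂ, l ≠ 0 ∧ ∀ c, IsTetCocycle c →
      D'.β P.copySimp c = l * D.β P.t c ∧ l * D'.γ P.copySimp c = D.γ P.t c :=
    exists_rescaling (q := X.res P.t D.q) (fun n => D.q_ne_zero _) (D.β_mul_γ P.t) (by
      have := D'.β_mul_γ P.copySimp
      rwa [P.res_copySimp, hq] at this)
  choose L hL h1 using h1
  exact ⟨⟨L, l, hL, hl, fun t c hc => (h1 t c hc).1, fun t c hc => (h1 t c hc).2,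
    fun c hc => (h2 c hc).1, fun c hc => (h2 c hc).2⟩⟩

namespace Gauge

variable (G : P.Gauge D D')

open Classical in
/-- The rescaling at the `m`-th 3-face of an old pentachoron. -/
noncomputable def faceScale (p : X.Simp 4) (m : Fin 5) : ℂ :=
  if p = P.p ∧ X.d p m = P.t then G.copyScale else G.scale (X.d p m)

theorem β_d_oldSimp (c : P.inflate.Z2) (p : X.Simp 4) (m : Fin 5) :
    D'.β (P.inflate.d (P.oldSimp p) m) (P.inflate.res (P.inflate.d (P.oldSimp p) m) c) =
      G.faceScale p m * D.β (X.d p m) (X.res (X.d p m) (P.restrict c)) := by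
  rw [P.d_oldSimp_pent]
  unfold faceScale
  split_ifs with h
  · rw [h.2, P.res_copySimp]
    exact G.β_copy _ (X.isTetCocycle_res (P.restrict c).2 _)
  · rw [P.res_oldSimp]
    exact G.β_old _ _ (X.isTetCocycle_res (P.restrict c).2 _)

theorem γ_d_oldSimp (c : P.inflate.Z2) (p : X.Simp 4) (m : Fin 5) :
    G.faceScale p m * D'.γ (P.inflate.d (P.oldSimp p) m)
      (P.inflate.res (P.inflate.d (P.oldSimp p) m) c) =
      D.γ (X.d p m) (X.res (X.d p m) (P.restrict c)) := by
  rw [P.d_oldSimp_pent]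
  unfold faceScale
  split_ifs with h
  · rw [h.2, P.res_copySimp]
    exact G.γ_copy _ (X.isTetCocycle_res (P.restrict c).2 _)
  · rw [P.res_oldSimp]
    exact G.γ_old _ _ (X.isTetCocycle_res (P.restrict c).2 _)

theorem F_oldSimp (p : X.Simp 4) (m n : Fin 5) :
    G.faceScale p m * G.faceScale p n * D'.F (P.oldSimp p) m n = D.F p m n := by
  have h := gaussian_rescaling (D.span_eq_top p) (fun b n => D.annihilate p b n)
    (fun b n => D'.annihilate (P.oldSimp p) (P.oldSimp b) n)
    (l := G.faceScale p) (s := 1) (fun b m => ?_) (fun b n => ?_) m n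
  · rw [h, one_mul]
  · have := G.β_d_oldSimp (P.inflate.edgeZ (P.oldSimp b)) p m
    rwa [P.restrict_edgeZ_oldSimp] at this
  · have := G.γ_d_oldSimp (P.inflate.edgeZ (P.oldSimp b)) p n
    rw [P.restrict_edgeZ_oldSimp] at this
    have hs : P.newSign ε (P.oldSimp p) = ε p := rfl
    rw [hs, one_mul, mul_left_comm]
    exact congrArg _ this

theorem η_oldSimp (hD : P.Extends D D') (p : X.Simp 4) :
    D'.η (P.oldSimp p) ^ 2 = D.η p ^ 2 * ∏ m, G.faceScale p m := by
  refine D.η_rescaling D' (s := 1) (one_pow 2) (fun m n => ?_) (fun e m => ?_) fun x y => ?_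
  · rw [G.F_oldSimp, one_mul]
  · unfold Coloring.bEdge
    split_ifs with h
    · rw [P.sub_oldSimp_of_le p e h (by omega)]
      have := G.β_d_oldSimp (P.inflate.edgeZ (P.oldSimp (X.sub p e h))) p m
      rwa [P.restrict_edgeZ_oldSimp] at this
    · rw [mul_zero]
  · unfold Coloring.qOpp ev
    split_ifs with h
    · rw [P.sub_oldSimp_of_le p _ h le_rfl, hD]
    · rfl

/-- The rescaling between the two new pentachora. -/
noncomputable def pentScale (m : Fin 5) : ℂ :=
  if m = P.apex then G.scale P.t / G.copyScale else 1

theorem pentScale_apex : G.pentScale P.apex = G.scale P.t / G.copyScale := if_pos rfl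

theorem pentScale_succAbove (x : Fin 4) : G.pentScale (P.apex.succAbove x) = 1 :=
  if_neg (Fin.succAbove_ne _ _)

theorem prod_pentScale : ∏ m, G.pentScale m = G.scale P.t / G.copyScale := by
  rw [Fin.prod_univ_succAbove _ P.apex, pentScale_apex]
  simp [pentScale_succAbove]

theorem β_d_fstPent (c : P.inflate.Z2) (m : Fin 5) :
    D'.β (P.inflate.d P.fstPent m) (P.inflate.res (P.inflate.d P.fstPent m) c) =
      G.pentScale m * D'.β (P.inflate.d P.sndPent m) (P.inflate.res (P.inflate.d P.sndPent m) c) := by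
  by_cases hm : m = P.apex
  · subst hm
    have hc := X.isTetCocycle_res (P.restrict c).2 P.t
    have h1 : D'.β (P.oldSimp P.t) (X.res P.t (c ∘ P.oldSimp)) = _ := G.β_old P.t _ hc
    have h2 : D'.β P.copySimp (X.res P.t (c ∘ P.oldSimp)) = _ := G.β_copy _ hc
    rw [P.d_fstPent_apex, P.d_sndPent_apex, P.res_oldSimp, P.res_copySimp, G.pentScale_apex, h1, h2,
      ← mul_assoc, div_mul_cancel₀ _ G.copyScale_ne_zero]
  · obtain ⟨x, rfl⟩ := Fin.exists_succAbove_eq hm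
    rw [P.d_fstPent, G.pentScale_succAbove, one_mul]
    rfl

theorem γ_d_fstPent (c : P.inflate.Z2) (m : Fin 5) :
    G.pentScale m * D'.γ (P.inflate.d P.fstPent m) (P.inflate.res (P.inflate.d P.fstPent m) c) =
      D'.γ (P.inflate.d P.sndPent m) (P.inflate.res (P.inflate.d P.sndPent m) c) := by
  by_cases hm : m = P.apex
  · subst hm
    have hc := X.isTetCocycle_res (P.restrict c).2 P.t
    have h1 := G.γ_old P.t _ hc
    have h2 := G.γ_copy _ hc
    rw [P.d_fstPent_apex, P.d_sndPent_apex, P.res_oldSimp, P.res_copySimp, G.pentScale_apex,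
      div_mul_eq_mul_div, div_eq_iff G.copyScale_ne_zero, mul_comm _ G.copyScale]
    exact h1.trans h2.symm
  · obtain ⟨x, rfl⟩ := Fin.exists_succAbove_eq hm
    rw [P.d_fstPent, G.pentScale_succAbove, one_mul]
    rfl

/-- The two new pentachora carry the same functionals up to the scalar at the apex, but opposite
boundary signs; the edge operators determine the matrix. -/
theorem F_fstPent (m n : Fin 5) : G.pentScale m * G.pentScale n * D'.F P.fstPent m n =
    -D'.F P.sndPent m n := by
  have h := gaussian_rescaling (D'.span_eq_top P.sndPent) (fun b n => D'.annihilate P.sndPent b n)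
    (fun b n => D'.annihilate P.fstPent b n)
    (l := G.pentScale) (s := -1) (fun b m => ?_) (fun b n => ?_) m n
  · rw [h, neg_one_mul]
  · exact G.β_d_fstPent (P.inflate.edgeZ b) m
  · have := G.γ_d_fstPent (P.inflate.edgeZ b) n
    have hs := P.bdSign_fstPent ε n
    unfold Coloring.bdSign at hs
    rw [hs, mul_left_comm]
    refine (congrArg _ this).trans ?_
    rw [neg_mul, neg_one_mul]
    rfl

theorem η_fstPent : D'.η P.fstPent ^ 2 = D'.η P.sndPent ^ 2 * (G.scale P.t / G.copyScale) := by
  rw [← G.prod_pentScale]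
  refine D'.η_rescaling D' (s := -1) (by ring) (fun m n => ?_) (fun e m => ?_) fun x y => ?_
  · rw [G.F_fstPent, neg_one_mul]
  · unfold Coloring.bEdge
    split_ifs with h
    · rw [P.sub_fstPent_eq_sub_sndPent e h (by omega) (Or.inr (by omega))]
      exact G.β_d_fstPent (P.inflate.edgeZ _) m
    · rw [mul_zero]
  · unfold Coloring.qOpp ev
    split_ifs with h
    · rw [P.sub_fstPent_eq_sub_sndPent _ h (by omega) (Or.inr le_rfl)]
    · rfl

/-- Each tetrahedron contributes its scalar twice, except that at the 3-face `t` of `p` the scalar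
of `t` is exchanged for that of the copy. -/
theorem prod_faceScale (hX : X.IsClosedOriented ε) :
    ∏ p, ∏ m, G.faceScale p m = (∏ t, G.scale t) ^ 2 * (G.copyScale / G.scale P.t) := by
  classical
  rw [← hX.prod_d G.scale]
  obtain ⟨m₀, hm₀⟩ := P.exists_d_p_eq
  have h1 : ∀ p m, G.faceScale p m = G.scale (X.d p m) *
      (if p = P.p then if m = m₀ then G.copyScale / G.scale P.t else 1 else 1) := by
    intro p m
    unfold faceScale
    by_cases hp : p = P.p
    · subst hp
      by_cases hm : m = m₀
      · subst hm
        rw [if_pos ⟨rfl, hm₀⟩, if_pos rfl, if_pos rfl, hm₀, mul_div_cancel₀ _ (G.scale_ne_zero _)]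
      · rw [if_neg fun h => hm (X.d_injective _ (h.2.trans hm₀.symm)), if_pos rfl, if_neg hm, mul_one]
    · rw [if_neg fun h => hp h.1, if_neg hp, mul_one]
  simp only [h1, Finset.prod_mul_distrib]
  congr 1
  rw [Finset.prod_eq_single (f := fun p => ∏ m : Fin 5, if p = P.p then _ else _) P.p
    (fun p _ hp => by simp only [if_neg hp, Finset.prod_const_one])
    (fun h => absurd (Finset.mem_univ _) h)]
  simp only [if_true, Finset.prod_ite_eq', Finset.mem_univ]

/-- The product of the quantities `η ^ 2` after the move. -/
theorem prod_η_sq (hX : X.IsClosedOriented ε) (hD : P.Extends D D') :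
    (∏ p, D'.η p) ^ 2 = (∏ p, D.η p) ^ 2 * (∏ t, G.scale t) ^ 2 * D'.η P.sndPent ^ 4 := by
  have h1 : (∏ p, D'.η (P.oldSimp p)) ^ 2 =
      (∏ p, D.η p) ^ 2 * ((∏ t, G.scale t) ^ 2 * (G.copyScale / G.scale P.t)) := by
    rw [← Finset.prod_pow, ← Finset.prod_pow, ← G.prod_faceScale hX, ← Finset.prod_mul_distrib]
    exact Finset.prod_congr rfl fun p _ => G.η_oldSimp hD p
  -- The ratio of the scalars of the copy and of `t`, coming from `p`, cancels with the inverse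
  -- ratio coming from the first new pentachoron.
  rw [P.prod_pents, mul_pow, mul_pow, h1, G.η_fstPent]
  have := G.scale_ne_zero P.t
  have := G.copyScale_ne_zero
  field_simp

/-- Columns over the old tetrahedra, lifted to the tetrahedra after the move. -/
noncomputable def lift (x : X.Simp 3 → ℂ) (t : P.inflate.Simp 3) : ℂ :=
  Sum.elim (fun t => G.scale t * x t) (Sum.elim (fun _ => G.copyScale * x P.t) 0) (P.tetEquiv.symm t)

theorem lift_oldSimp (x : X.Simp 3 → ℂ) (t : X.Simp 3) :
    G.lift x (P.oldSimp t) = G.scale t * x t := by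
  have : P.tetEquiv.symm (P.oldSimp t) = Sum.inl t := P.tetEquiv.symm_apply_eq.2 rfl
  rw [lift, this]
  rfl

theorem lift_copySimp (x : X.Simp 3 → ℂ) : G.lift x P.copySimp = G.copyScale * x P.t := by
  have : P.tetEquiv.symm P.copySimp = Sum.inr (Sum.inl ()) := P.tetEquiv.symm_apply_eq.2 rfl
  rw [lift, this]
  rfl

theorem lift_newTet (x : X.Simp 3 → ℂ) (y : Fin 4) : G.lift x (P.newTet y) = 0 := by
  have : P.tetEquiv.symm (P.newTet y) = Sum.inr (Sum.inr y) := P.tetEquiv.symm_apply_eq.2 rfl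
  rw [lift, this]
  rfl

theorem f2_oldSimp (c : P.inflate.Z2) (t : X.Simp 3) :
    D'.f2 c (P.oldSimp t) = G.scale t * D.f2 (P.restrict c) t := by
  rw [D'.f2_apply, P.res_oldSimp]
  exact G.β_old _ _ (X.isTetCocycle_res (P.restrict c).2 _)

theorem f2_copySimp (c : P.inflate.Z2) :
    D'.f2 c P.copySimp = G.copyScale * D.f2 (P.restrict c) P.t := by
  rw [D'.f2_apply, P.res_copySimp]
  exact G.β_copy _ (X.isTetCocycle_res (P.restrict c).2 _)

theorem lift_d_oldSimp (x : X.Simp 3 → ℂ) (p : X.Simp 4) (m : Fin 5) :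
    G.lift x (P.inflate.d (P.oldSimp p) m) = G.faceScale p m * x (X.d p m) := by
  rw [P.d_oldSimp_pent]
  unfold faceScale
  split_ifs with h
  · rw [lift_copySimp, h.2]
  · rw [lift_oldSimp]

/-- Lifts vanish on the interior tetrahedra, so a new pentachoron can contribute only through a
diagonal entry of its skew matrix. On the old pentachora the scalars cancel. -/
theorem form_lift_lift (x y : X.Simp 3 → ℂ) :
    G.lift x ⬝ᵥ D'.f3Matrix *ᵥ G.lift y = x ⬝ᵥ D.f3Matrix *ᵥ y := by
  rw [D'.f3Matrix_form, D.f3Matrix_form, P.sum_pents]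
  have h1 : ∀ p, ∑ m, ∑ n, G.lift x (P.inflate.d (P.oldSimp p) m) * D'.F (P.oldSimp p) m n *
      G.lift y (P.inflate.d (P.oldSimp p) n) = ∑ m, ∑ n, x (X.d p m) * D.F p m n * y (X.d p n) :=
    fun p => Finset.sum_congr rfl fun m _ => Finset.sum_congr rfl fun n _ => by
      rw [lift_d_oldSimp, lift_d_oldSimp, ← G.F_oldSimp p m n]
      ring
  have h2 : ∑ m, ∑ n, G.lift x (P.inflate.d P.fstPent m) * D'.F P.fstPent m n *
      G.lift y (P.inflate.d P.fstPent n) = 0 := by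
    rw [Fin.sum_univ_succAbove _ P.apex, Fin.sum_univ_succAbove _ P.apex]
    simp [P.d_fstPent, lift_newTet, D'.F_self]
  have h3 : ∑ m, ∑ n, G.lift x (P.inflate.d P.sndPent m) * D'.F P.sndPent m n *
      G.lift y (P.inflate.d P.sndPent n) = 0 := by
    have h4 : ∀ z w, G.lift z (P.inflate.d P.sndPent (P.apex.succAbove w)) = 0 := G.lift_newTet
    rw [Fin.sum_univ_succAbove _ P.apex, Fin.sum_univ_succAbove _ P.apex]
    simp [h4, D'.F_self]
  rw [h2, h3, add_zero, add_zero]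
  exact Finset.sum_congr rfl fun p _ => h1 p

end Gauge

theorem newTet_ne_oldSimp (x : Fin 4) (t : X.Simp 3) : P.newTet x ≠ P.oldSimp t :=
  P.sub_sndPent_ne_oldSimp (hs := by simp) (by simp [(Fin.succAbove_ne _ _).symm]) t

theorem newTet_ne_copySimp (x : Fin 4) : P.newTet x ≠ P.copySimp :=
  P.sub_sndPent_ne_copySimp (hs := by simp) (by simp [(Fin.succAbove_ne _ _).symm])

theorem d_oldSimp_ne_newTet (p : X.Simp 4) (m : Fin 5) (x : Fin 4) :
    P.inflate.d (P.oldSimp p) m ≠ P.newTet x := by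
  rw [P.d_oldSimp_pent]
  split_ifs
  · exact (newTet_ne_copySimp x).symm
  · exact (newTet_ne_oldSimp x _).symm

open Classical in
theorem form_single_newTet (x : P.inflate.Simp 3 → ℂ) (f : Fin 4) :
    x ⬝ᵥ D'.f3Matrix *ᵥ Pi.single (P.newTet f) 1 =
      ∑ m, x (P.inflate.d P.fstPent m) * D'.F P.fstPent m (P.apex.succAbove f) +
      ∑ m, x (P.inflate.d P.sndPent m) * D'.F P.sndPent m (P.apex.succAbove f) := by
  rw [D'.f3Matrix_form, P.sum_pents]
  have h1 : ∀ p m n, (Pi.single (P.newTet f) 1 : P.inflate.Simp 3 → ℂ) (P.inflate.d (P.oldSimp p) n) *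
      x (P.inflate.d (P.oldSimp p) m) * D'.F (P.oldSimp p) m n = 0 := by
    intro p m n
    rw [Pi.single_eq_of_ne (d_oldSimp_ne_newTet p n f), zero_mul, zero_mul]
  have h2 : ∀ n, (Pi.single (P.newTet f) 1 : P.inflate.Simp 3 → ℂ) (P.inflate.d P.sndPent n) =
      if n = P.apex.succAbove f then 1 else 0 := by
    intro n
    rw [Pi.single_apply]
    exact if_congr (P.inflate.d_injective P.sndPent).eq_iff rfl rfl
  have h3 : ∀ n, (Pi.single (P.newTet f) 1 : P.inflate.Simp 3 → ℂ) (P.inflate.d P.fstPent n) =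
      if n = P.apex.succAbove f then 1 else 0 := by
    intro n
    rw [Pi.single_apply, ← P.d_fstPent]
    exact if_congr (P.inflate.d_injective P.fstPent).eq_iff rfl rfl
  have h4 : ∑ p, ∑ m, ∑ n, x (P.inflate.d (P.oldSimp p) m) * D'.F (P.oldSimp p) m n *
      (Pi.single (P.newTet f) 1 : P.inflate.Simp 3 → ℂ) (P.inflate.d (P.oldSimp p) n) = 0 :=
    Finset.sum_eq_zero fun p _ => Finset.sum_eq_zero fun m _ => Finset.sum_eq_zero fun n _ => by
      rw [← h1 p m n]; ring
  rw [h4, zero_add]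
  simp only [h2, h3, mul_ite, mul_one, mul_zero, Finset.sum_ite_eq', Finset.mem_univ, if_true]

-- An interior tetrahedron lies in the two new pentachora only. A lift meets the first at `t` and
-- the second at the copy, with values matched so that the opposite matrices cancel.
open Classical in
theorem Gauge.form_lift_newTet (G : P.Gauge D D') (x : X.Simp 3 → ℂ) (f : Fin 4) :
    G.lift x ⬝ᵥ D'.f3Matrix *ᵥ Pi.single (P.newTet f) 1 = 0 := by
  have h4 : ∀ w, G.lift x (P.inflate.d P.sndPent (P.apex.succAbove w)) = 0 := G.lift_newTet x
  have h := G.F_fstPent P.apex (P.apex.succAbove f)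
  rw [G.pentScale_apex, G.pentScale_succAbove] at h
  have := G.copyScale_ne_zero
  field_simp at h
  rw [form_single_newTet, Fin.sum_univ_succAbove _ P.apex, Fin.sum_univ_succAbove _ P.apex]
  simp only [P.d_fstPent, G.lift_newTet, h4, P.d_fstPent_apex, P.d_sndPent_apex, G.lift_oldSimp,
    G.lift_copySimp, zero_mul, Finset.sum_const_zero, add_zero]
  linear_combination x P.t * h

theorem d_fstPent_ne_copySimp (m : Fin 5) : P.inflate.d P.fstPent m ≠ P.copySimp := by
  by_cases hm : m = P.apex
  · subst hm
    rw [P.d_fstPent_apex]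
    intro h
    have := congrArg Subtype.val h
    injection this
  · obtain ⟨x, rfl⟩ := Fin.exists_succAbove_eq hm
    rw [P.d_fstPent]
    exact newTet_ne_copySimp x

open Classical in
theorem form_copySimp_newTet (f : Fin 4) :
    (Pi.single P.copySimp 1 : P.inflate.Simp 3 → ℂ) ⬝ᵥ D'.f3Matrix *ᵥ Pi.single (P.newTet f) 1 =
      D'.F P.sndPent P.apex (P.apex.succAbove f) := by
  rw [form_single_newTet]
  have h1 : ∀ m, (Pi.single P.copySimp 1 : P.inflate.Simp 3 → ℂ) (P.inflate.d P.fstPent m) = 0 :=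
    fun m => Pi.single_eq_of_ne (d_fstPent_ne_copySimp m) _
  have h2 : ∀ n, (Pi.single P.copySimp 1 : P.inflate.Simp 3 → ℂ) (P.inflate.d P.sndPent n) =
      if n = P.apex then 1 else 0 := by
    intro n
    rw [Pi.single_apply, ← P.d_sndPent_apex]
    exact if_congr (P.inflate.d_injective P.sndPent).eq_iff rfl rfl
  simp only [h1, h2, zero_mul, Finset.sum_const_zero, zero_add, ite_mul, one_mul,
    Finset.sum_ite_eq', Finset.mem_univ, if_true]

-- Otherwise the apex column of the matrix would vanish, and with it the functional `γ` of the copy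
-- on all edge coboundaries, whereas the form of a tetrahedron is nonzero on them.
variable (D') in
theorem exists_F_ne_zero : ∃ f, D'.F P.sndPent P.apex (P.apex.succAbove f) ≠ 0 := by
  by_contra! h
  have h1 : ∀ m, D'.F P.sndPent m P.apex = 0 := by
    intro m
    by_cases hm : m = P.apex
    · rw [hm, D'.F_self]
    · obtain ⟨x, rfl⟩ := Fin.exists_succAbove_eq hm
      rw [D'.F_skew, h, neg_zero]
  obtain ⟨b, hb⟩ := D'.exists_γ_ne_zero (P.inflate.d P.sndPent P.apex)
  have h2 := D'.annihilate_of_mem_Z2 (P.inflate.edgeCob_mem_Z2 b) P.sndPent P.apex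
  simp only [h1, mul_zero, Finset.sum_const_zero] at h2
  refine hb ((mul_eq_zero.1 h2).resolve_left fun h3 => ?_)
  have := Coloring.bdSign_sq (ε := P.newSign ε) P.sndPent P.apex
  rw [h3] at this
  norm_num at this

end Site

end TriComplex

/-! ### Determinants of extended Gram and coordinate matrices. -/

/-- The two extra vectors span a hyperbolic plane whose second vector is orthogonal to all the
others. The Schur complement of this plane brings no correction, because the inverse of its block
has zero in the corner that corresponds to the first vector. -/
theorem det_eq_sq_mul_det {κ : Type*} [Fintype κ] [DecidableEq κ]
    (M : Matrix (κ ⊕ Fin 2) (κ ⊕ Fin 2) ℂ) {v : ℂ} (hv : v ≠ 0)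
    (h1 : ∀ k, M (Sum.inl k) (Sum.inr 1) = 0) (h2 : ∀ k, M (Sum.inr 1) (Sum.inl k) = 0)
    (h3 : M (Sum.inr 0) (Sum.inr 1) = v) (h4 : M (Sum.inr 1) (Sum.inr 0) = -v)
    (h5 : M (Sum.inr 1) (Sum.inr 1) = 0) : M.det = v ^ 2 * M.toBlocks₁₁.det := by
  have hD : M.toBlocks₂₂ = !![M (Sum.inr 0) (Sum.inr 0), v; -v, 0] := by
    ext i j
    fin_cases i <;> fin_cases j <;> simp [toBlocks₂₂, h3, h4, h5]
  have hinv : !![0, -v⁻¹; v⁻¹, M (Sum.inr 0) (Sum.inr 0) * v⁻¹ ^ 2] * M.toBlocks₂₂ = 1 := by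
    rw [hD]
    ext i j
    fin_cases i <;> fin_cases j <;> simp [Matrix.mul_apply, Fin.sum_univ_two, hv]
    field_simp
    ring
  let _ : Invertible M.toBlocks₂₂ := ⟨_, hinv, mul_eq_one_comm.1 hinv⟩
  have hi : ⅟ M.toBlocks₂₂ = !![0, -v⁻¹; v⁻¹, M (Sum.inr 0) (Sum.inr 0) * v⁻¹ ^ 2] := rfl
  conv_lhs => rw [← Matrix.fromBlocks_toBlocks M]
  rw [Matrix.det_fromBlocks₂₂, hi]
  have h6 : M.toBlocks₁₂ * !![0, -v⁻¹; v⁻¹, M (Sum.inr 0) (Sum.inr 0) * v⁻¹ ^ 2] * M.toBlocks₂₁ = 0 := by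
    ext k l
    simp [Matrix.mul_apply, Fin.sum_univ_two, toBlocks₁₂, toBlocks₂₁, h1, h2]
  rw [h6, sub_zero, hD, Matrix.det_fin_two_of]
  ring

/-- As `ρ` kills the extra basis vectors, the old coordinates are read off through `ρ`; the matrix
is block triangular with an identity block. -/
theorem coordMatrix_extend_det {V V' J K ι : Type*} [AddCommGroup V] [Module ℂ V]
    [AddCommGroup V'] [Module ℂ V'] [Fintype J] [Fintype K] [Fintype ι] [DecidableEq J]
    [DecidableEq K] [DecidableEq ι] (e : Module.Basis J ℂ V) (g : Module.Basis (J ⊕ K) ℂ V')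
    (ρ : V' →ₗ[ℂ] V) (h : ∀ j, ρ (g (Sum.inl j)) = e j) (h' : ∀ x, ρ (g (Sum.inr x)) = 0)
    (ω : V') (c : ι → V') (eJ : Unit ⊕ ι ≃ J) :
    (coordMatrix g ω (Sum.elim c fun x => g (Sum.inr x))
      ((Equiv.sumAssoc Unit ι K).symm.trans (eJ.sumCongr (Equiv.refl K)))).det =
      (coordMatrix e (ρ ω) (fun i => ρ (c i)) eJ).det := by
  have hr : ∀ v j, g.repr v (Sum.inl j) = e.repr (ρ v) j := by
    intro v j
    conv_rhs => rw [← g.sum_repr v, Fintype.sum_sum_type]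
    simp [h, h', Finsupp.single_apply]
  have hM : coordMatrix g ω (Sum.elim c fun x => g (Sum.inr x))
      ((Equiv.sumAssoc Unit ι K).symm.trans (eJ.sumCongr (Equiv.refl K))) =
      (Matrix.fromBlocks (coordMatrix e (ρ ω) (fun i => ρ (c i)) eJ) 0
        (Matrix.of fun x b => g.repr (Sum.elim (fun _ => ω) c b) (Sum.inr x)) 1).submatrix
        (Equiv.sumAssoc Unit ι K).symm (Equiv.sumAssoc Unit ι K).symm := by
    ext a b
    rcases a with a | a | a <;> rcases b with b | b | b <;>
      simp [coordMatrix, hr, Finsupp.single_apply, Matrix.one_apply, eq_comm]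
  rw [hM, Matrix.det_submatrix_equiv_self, Matrix.det_fromBlocks_zero₁₂, Matrix.det_one, mul_one]

/-! ### Cocycle bases and frames after the move. -/

namespace TriComplex

variable {Λ : Type v} [LinearOrder Λ]

theorem verts_d (X : TriComplex.{u} Λ) {k : ℕ} (σ : X.Simp (k + 1)) (n : Fin (k + 2)) :
    X.verts (X.d σ n).1 = (Finset.univ.erase n).map (X.vtx σ).toEmbedding :=
  X.verts_sub _ _ _

namespace Site

variable {X : TriComplex.{u} Λ} (P : X.Site)

/-- Exactly one end of a new edge is the new vertex, so the indicator of that vertex has coboundary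
`±1` on it. -/
theorem isUnit_newEdge (x : Fin 4) :
    IsUnit ((if P.a ∈ P.inflate.verts (P.inflate.d (P.newEdge x) 0).1 then (1 : ℤ) else 0) -
      (if P.a ∈ P.inflate.verts (P.inflate.d (P.newEdge x) 1).1 then (1 : ℤ) else 0)) := by
  have h : P.a ∈ P.inflate.verts (P.newEdge x).1 := by
    rw [newEdge, verts_sub, P.a_mem_map_iff]
    simp
  have h1 : P.a ∈ Set.range (P.inflate.vtx (P.newEdge x)) := by
    unfold vtx
    rw [Finset.range_orderEmbOfFin]
    exact h
  obtain ⟨i, hi⟩ := h1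
  have h2 : ∀ n, P.a ∈ P.inflate.verts (P.inflate.d (P.newEdge x) n).1 ↔ i ≠ n := by
    intro n
    rw [verts_d, ← hi]
    refine (Finset.mem_map' _).trans ?_
    simp
  simp only [h2]
  fin_cases i <;> simp

/-- A submodule that contains the coboundaries of the old edges outside of a maximal tree and of
three new edges contains the coboundaries of all the edges. -/
theorem edgeZ_mem {T : Set (X.Simp 1)} (hT : X.IsSpanningTree T) (f : Fin 4)
    (S : Submodule ℤ P.inflate.Z2) (h1 : ∀ b ∉ T, P.inflate.edgeZ (P.oldSimp b) ∈ S)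
    (h2 : ∀ x, P.inflate.edgeZ (P.newEdge (f.succAbove x)) ∈ S) (e : P.inflate.Simp 1) :
    P.inflate.edgeZ e ∈ S := by
  classical
  -- A cut of the old tree is extended by zero to the new vertex. It may have nonzero coefficients
  -- at the new edges, which is harmless once `hnew` has placed these in `S`.
  have hold : ∀ b ∈ T, ∃ χ : P.inflate.Simp 0 → ℤ,
      χ (P.inflate.d (P.oldSimp b) 0) - χ (P.inflate.d (P.oldSimp b) 1) = 1 ∧
        ∀ e ∈ T, e ≠ b → χ (P.inflate.d (P.oldSimp e) 0) - χ (P.inflate.d (P.oldSimp e) 1) = 0 := by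
    intro b hb
    obtain ⟨χ, h3, h4⟩ := hT.exists_cut hb
    have h5 : ∀ e n, Function.extend P.oldSimp χ 0 (P.inflate.d (P.oldSimp e) n) = χ (X.d e n) :=
      fun e n => by rw [P.d_oldSimp e n (by omega), P.oldSimp_injective.extend_apply]
    refine ⟨Function.extend P.oldSimp χ 0, ?_, fun e he hne => ?_⟩
    · rw [h5, h5, h3]
    · rw [h5, h5, h4 e he hne]
  have hnew : ∀ x, P.inflate.edgeZ (P.newEdge x) ∈ S := by
    intro x
    by_cases hx : x = f
    · subst hx
      -- The indicator of the new vertex gives a relation between the four new edges with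
      -- coefficients `±1`, which recovers the omitted one.
      refine mem_of_sum_eq_zero S (sum_smul_edgeZ_eq_zero fun v =>
        if P.a ∈ P.inflate.verts v.1 then 1 else 0) (P.isUnit_newEdge x) fun e he => ?_
      obtain ⟨e | y, rfl⟩ := P.edge_bijective.2 e
      · left
        have h3 : ∀ n, (if P.a ∈ P.inflate.verts (P.inflate.d (P.oldSimp e) n).1 then (1 : ℤ)
            else 0) = 0 := fun n => by
          rw [P.d_oldSimp e n (Nat.zero_le 2)]
          exact if_neg (P.a_notMem _)
        exact (congrArg₂ (· - ·) (h3 0) (h3 1)).trans (sub_zero 0)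
      · right
        have hy : y ≠ x := fun h => he (by rw [h]; rfl)
        obtain ⟨z, rfl⟩ := Fin.exists_succAbove_eq hy
        exact h2 z
    · obtain ⟨z, rfl⟩ := Fin.exists_succAbove_eq hx
      exact h2 z
  obtain ⟨b | x, rfl⟩ := P.edge_bijective.2 e
  · by_cases hb : b ∈ T
    · obtain ⟨χ, h3, h4⟩ := hold b hb
      refine mem_of_sum_eq_zero S (j := P.oldSimp b) (sum_smul_edgeZ_eq_zero χ) (h3 ▸ isUnit_one)
        fun e he => ?_
      obtain ⟨e | x, rfl⟩ := P.edge_bijective.2 e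
      · have hne : e ≠ b := fun h => he (by rw [h]; rfl)
        by_cases heT : e ∈ T
        · exact Or.inl (h4 e heT hne)
        · exact Or.inr (h1 e heT)
      · exact Or.inr (hnew x)
    · exact h1 b hb
  · exact hnew x

variable {P} {ε : X.Simp 4 → ℤˣ} {D : X.Coloring ε} {D' : P.inflate.Coloring (P.newSign ε)}

variable (D') in
/-- The values of the differentiation parts of three new edge operators on three of the new
tetrahedra. -/
noncomputable def coneMatrix (f : Fin 4) : Matrix (Fin 3) (Fin 3) ℂ :=
  Matrix.of fun x y =>
    D'.f2 (P.inflate.edgeZ (P.newEdge (f.succAbove y))) (P.newTet (f.succAbove x))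

variable (D') in
theorem coneMatrix_apply (f : Fin 4) (x y : Fin 3) : coneMatrix D' f x y =
    D'.bEdge P.sndPent {P.apex, P.apex.succAbove (f.succAbove y)}
      (P.apex.succAbove (f.succAbove x)) := by
  rw [Coloring.bEdge, dif_pos (Finset.card_pair (Fin.succAbove_ne _ _).symm)]
  rfl

/-- The arrangement in which `local_identity` is applied: the apex has the place `1`, and the
distinguished vertex `f` the place `3`. -/
theorem bijective_perm (α : Fin 5) (f : Fin 4) : Function.Bijective
    ![α.succAbove (f.succAbove 0), α, α.succAbove (f.succAbove 1), α.succAbove f,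
      α.succAbove (f.succAbove 2)] := by
  revert α f
  decide

theorem prod_filter_mem {M : Type*} [CommMonoid M] (g : Finset (Fin 5) → M)
    (σ : Equiv.Perm (Fin 5)) :
    ∏ s : {s : Finset (Fin 5) // s.card = 2 + 1 ∧ σ 1 ∈ s}, g s.1 =
      g ((Finset.univ.erase (σ 0)).erase (σ 2)) * g ((Finset.univ.erase (σ 0)).erase (σ 3)) *
      g ((Finset.univ.erase (σ 0)).erase (σ 4)) * g ((Finset.univ.erase (σ 2)).erase (σ 3)) *
      g ((Finset.univ.erase (σ 2)).erase (σ 4)) * g ((Finset.univ.erase (σ 3)).erase (σ 4)) := by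
  have h1 : ∏ s : {s : Finset (Fin 5) // s.card = 2 + 1 ∧ σ 1 ∈ s}, g s.1 =
      ∏ s ∈ Finset.univ.filter (fun s : Finset (Fin 5) => s.card = 2 + 1 ∧ σ 1 ∈ s), g s :=
    (Finset.prod_subtype _ (by simp) g).symm
  have h2 : Finset.univ.filter (fun s : Finset (Fin 5) => s.card = 2 + 1 ∧ σ 1 ∈ s) =
      (Finset.univ.filter (fun s : Finset (Fin 5) => s.card = 2 + 1 ∧ 1 ∈ s)).map
        σ.finsetCongr.toEmbedding := by
    ext s
    constructor
    · intro hs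
      obtain ⟨h3, h4⟩ := (Finset.mem_filter.1 hs).2
      refine Finset.mem_map.2 ⟨s.map σ.symm.toEmbedding, ?_, ?_⟩
      · simp only [Finset.mem_filter, Finset.mem_univ, true_and, Finset.card_map]
        refine ⟨h3, Finset.mem_map.2 ⟨σ 1, h4, by simp⟩⟩
      · simp [Equiv.finsetCongr, Finset.map_map]
    · intro hs
      obtain ⟨s', h3, rfl⟩ := Finset.mem_map.1 hs
      obtain ⟨h4, h5⟩ := (Finset.mem_filter.1 h3).2
      simp only [Finset.mem_filter, Finset.mem_univ, true_and]
      exact ⟨by simpa using h4, Finset.mem_map.2 ⟨1, h5, rfl⟩⟩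
  have h3 : Finset.univ.filter (fun s : Finset (Fin 5) => s.card = 2 + 1 ∧ 1 ∈ s) =
      {(Finset.univ.erase 0).erase 2, (Finset.univ.erase 0).erase 3, (Finset.univ.erase 0).erase 4,
       (Finset.univ.erase 2).erase 3, (Finset.univ.erase 2).erase 4,
       (Finset.univ.erase 3).erase 4} := by decide
  rw [h1, h2, Finset.prod_map, h3]
  have h4 : ∀ x y, σ.finsetCongr.toEmbedding ((Finset.univ.erase x).erase y) =
      (Finset.univ.erase (σ x)).erase (σ y) := fun x y => Coloring.map_eq_erase σ rfl
  rw [Finset.prod_insert (by decide), Finset.prod_insert (by decide), Finset.prod_insert (by decide),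
    Finset.prod_insert (by decide), Finset.prod_insert (by decide), Finset.prod_singleton]
  simp only [h4, mul_assoc]

variable (D') in
/-- The contribution of the second new pentachoron. -/
theorem sndPent_identity (f : Fin 4) :
    (D'.η P.sndPent ^ 2 * D'.F P.sndPent P.apex (P.apex.succAbove f)) ^ 2 =
      (∏ s : {s : Finset (Fin 5) // s.card = 2 + 1 ∧ P.apex ∈ s},
        D'.q (P.inflate.sub P.sndPent s.1 s.2.1)) ^ 2 * (coneMatrix D' f).det ^ 2 := by
  let σ : Equiv.Perm (Fin 5) := Equiv.ofBijective _ (bijective_perm P.apex f)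
  have s1 : P.apex = σ 1 := rfl
  have hq : ∏ s : {s : Finset (Fin 5) // s.card = 2 + 1 ∧ P.apex ∈ s},
      D'.q (P.inflate.sub P.sndPent s.1 s.2.1) =
      ∏ s : {s : Finset (Fin 5) // s.card = 2 + 1 ∧ σ 1 ∈ s},
        P.inflate.ev P.sndPent D'.q s.1 :=
    Finset.prod_congr rfl fun s _ => (P.inflate.ev_of_card P.sndPent D'.q s.2.1).symm
  rw [hq, prod_filter_mem (fun s => P.inflate.ev P.sndPent D'.q s)]
  have h := D'.local_identity P.sndPent σ
  have hdet : (coneMatrix D' f).det = D'.bEdge P.sndPent {σ 1, σ 2} (σ 0) *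
      D'.bEdge P.sndPent {σ 1, σ 4} (σ 2) * D'.bEdge P.sndPent {σ 1, σ 0} (σ 4) +
      D'.bEdge P.sndPent {σ 1, σ 4} (σ 0) * D'.bEdge P.sndPent {σ 1, σ 2} (σ 4) *
        D'.bEdge P.sndPent {σ 1, σ 0} (σ 2) := by
    -- The edge from the apex to a vertex is not contained in the tetrahedron opposite to this
    -- vertex. With a zero diagonal, the determinant reduces to the two cyclic terms of
    -- `local_identity`.
    have hd : ∀ x, coneMatrix D' f x x = 0 := fun x => by
      rw [coneMatrix_apply, D'.bEdge_eq_zero _ (by simp)]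
    rw [Matrix.det_fin_three, hd, hd, hd]
    simp only [coneMatrix_apply]
    change _ = D'.bEdge P.sndPent {P.apex, P.apex.succAbove (f.succAbove 1)} (P.apex.succAbove (f.succAbove 0)) *
      D'.bEdge P.sndPent {P.apex, P.apex.succAbove (f.succAbove 2)} (P.apex.succAbove (f.succAbove 1)) *
      D'.bEdge P.sndPent {P.apex, P.apex.succAbove (f.succAbove 0)} (P.apex.succAbove (f.succAbove 2)) +
      D'.bEdge P.sndPent {P.apex, P.apex.succAbove (f.succAbove 2)} (P.apex.succAbove (f.succAbove 0)) *
      D'.bEdge P.sndPent {P.apex, P.apex.succAbove (f.succAbove 1)} (P.apex.succAbove (f.succAbove 2)) *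
      D'.bEdge P.sndPent {P.apex, P.apex.succAbove (f.succAbove 0)} (P.apex.succAbove (f.succAbove 1))
    ring
  rw [← hdet] at h
  have hF : D'.F P.sndPent P.apex (P.apex.succAbove f) = -D'.F P.sndPent (σ 3) (σ 1) :=
    D'.F_skew _ _ _
  rw [hF, mul_neg, neg_sq, h]
  rfl

theorem prod_q_ne_zero : ∏ s : {s : Finset (Fin 5) // s.card = 2 + 1 ∧ P.apex ∈ s},
    D'.q (P.inflate.sub P.sndPent s.1 s.2.1) ≠ 0 :=
  Finset.prod_ne_zero_iff.2 fun _ _ => D'.q_ne_zero _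

/-- By the local identity, this determinant vanishes only together with `η` or with the chosen entry
of `F`. -/
theorem coneMatrix_det_ne_zero {f : Fin 4}
    (hf : D'.F P.sndPent P.apex (P.apex.succAbove f) ≠ 0) : (coneMatrix D' f).det ≠ 0 := by
  intro h
  have h1 := sndPent_identity D' f
  rw [h, zero_pow two_ne_zero, mul_zero] at h1
  exact pow_ne_zero 2 (mul_ne_zero (pow_ne_zero 2 (D'.η_ne_zero _)) hf) h1

variable (D') in
/-- Compatible bases of the spaces of cocycles before and after the move. -/
theorem exists_bases {r : ℕ} (Z : X.CocycleBasis r) (Z' : P.inflate.CocycleBasis r)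
    (hZ : P.SameClasses Z Z') {f : Fin 4} (hf : (coneMatrix D' f).det ≠ 0) (k : ℕ) :
    ∃ (e : Module.Basis ({b : X.Simp 1 // b ∉ Z.tree} ⊕ Fin r) ℂ X.Z2)
      (g : Module.Basis (({b : X.Simp 1 // b ∉ Z.tree} ⊕ Fin r) ⊕ Fin 3) ℂ P.inflate.Z2),
      (∀ (ω : X.Z2) (c : Fin k → X.Z2) (eJ : Unit ⊕ Fin k ≃ {b : X.Simp 1 // b ∉ Z.tree} ⊕ Fin r),
        (coordMatrix Z.basis ω c eJ).det = (coordMatrix e ω c eJ).det) ∧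
      (∀ j, P.restrict (g (Sum.inl j)) = e j) ∧
      (∀ x, g (Sum.inr x) = P.inflate.edgeZ (P.newEdge (f.succAbove x))) ∧
      (∀ j, g j ∈ Submodule.span ℤ (Set.range Z'.basis)) ∧
      ∀ j, Z'.basis j ∈ Submodule.span ℤ (Set.range g) := by
  classical
  choose y hy using hZ
  -- The old further cocycles are corrected by coboundaries, so as to become the restrictions of the
  -- new ones.
  obtain ⟨e, he1, he2, he3⟩ := exists_unipotent_basis (ι := Fin k) Z.basis
    (fun l => (⟨X.coboundary 1 (y l), X.coboundary_mem_Z2 _⟩ : X.Z2))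
    fun l l' => Z.repr_coboundary (y l) l'
  let g : ({b : X.Simp 1 // b ∉ Z.tree} ⊕ Fin r) ⊕ Fin 3 → P.inflate.Z2 :=
    Sum.elim (Sum.elim (fun b => P.inflate.edgeZ (P.oldSimp b.1)) fun l => Z'.basis (Sum.inr l))
      fun x => P.inflate.edgeZ (P.newEdge (f.succAbove x))
  have hρ : ∀ j, P.restrict (g (Sum.inl j)) = e j := by
    rintro (b | l)
    · rw [he1, Z.basis_inl']
      exact P.restrict_edgeZ_oldSimp b.1
    · rw [he2]
      exact Subtype.ext (funext fun s => hy l s)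
  have hli : LinearIndependent ℂ g := by
    rw [Fintype.linearIndependent_iff]
    intro a ha
    rw [Fintype.sum_sum_type] at ha
    have h1 : ∀ j, a (Sum.inl j) = 0 := by
      have h2 := congrArg P.restrict ha
      have h3 : ∀ x, P.restrict (g (Sum.inr x)) = 0 := fun x => P.restrict_edgeZ_newEdge _
      rw [map_add, map_sum, map_sum, map_zero] at h2
      simp only [map_smul, hρ, h3, smul_zero, Finset.sum_const_zero, add_zero] at h2
      exact Fintype.linearIndependent_iff.1 e.linearIndependent _ h2
    simp only [h1, zero_smul, Finset.sum_const_zero, zero_add] at ha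
    -- After restriction has removed the old coefficients, `f₂` at three interior tetrahedra
    -- separates the three new edges.
    have h4 : coneMatrix D' f *ᵥ (fun x => a (Sum.inr x)) = 0 := by
      ext x
      have h5 := congrFun (congrArg D'.f2 ha) (P.newTet (f.succAbove x))
      rw [map_sum] at h5
      simp only [map_smul, map_zero, Finset.sum_apply, Pi.smul_apply, Pi.zero_apply, smul_eq_mul] at h5
      rw [Pi.zero_apply, ← h5]
      change ∑ y, coneMatrix D' f x y * a (Sum.inr y) = ∑ y, a (Sum.inr y) * coneMatrix D' f x y
      exact Finset.sum_congr rfl fun y _ => mul_comm (coneMatrix D' f x y) (a (Sum.inr y))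
    have h6 := Matrix.eq_zero_of_mulVec_eq_zero hf h4
    rintro (j | x)
    · exact h1 j
    · exact congrFun h6 x
  have hmem : ∀ b, P.inflate.edgeZ b ∈ Submodule.span ℤ (Set.range g) :=
    P.edgeZ_mem Z.isSpanningTree f _
      (fun b hb => Submodule.subset_span ⟨Sum.inl (Sum.inl ⟨b, hb⟩), rfl⟩)
      (fun x => Submodule.subset_span ⟨Sum.inr x, rfl⟩)
  have hZ' : ∀ j, Z'.basis j ∈ Submodule.span ℤ (Set.range g) := by
    rintro (b | l)
    · rw [Z'.basis_inl']
      exact hmem _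
    · exact Submodule.subset_span ⟨Sum.inl (Sum.inr l), rfl⟩
  have hspan : ⊤ ≤ Submodule.span ℂ (Set.range g) := by
    rw [← Z'.basis.span_eq, Submodule.span_le]
    rintro _ ⟨j, rfl⟩
    exact Submodule.span_le_restrictScalars ℤ ℂ _ (hZ' j)
  have hg : ∀ j, Module.Basis.mk hli hspan j = g j := fun j => Module.Basis.mk_apply _ _ _
  have hgf : (Module.Basis.mk hli hspan : _ → P.inflate.Z2) = g := funext hg
  refine ⟨e, Module.Basis.mk hli hspan, he3, fun j => by rw [hg, hρ], fun x => hg _, fun j => ?_,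
    fun j => ?_⟩
  · rw [hg]
    rcases j with (b | l) | x
    · exact Z'.edgeZ_mem _
    · exact Submodule.subset_span ⟨Sum.inr l, rfl⟩
    · exact Z'.edgeZ_mem _
  · rw [hgf]
    exact hZ' j

/-- Three of the interior tetrahedra are matched with the new edges; the copy of `t` and the
interior tetrahedron numbered `f` are matched with the two additional vectors. -/
theorem bijective_newRows (f : Fin 4) : Function.Bijective
    (Sum.elim (fun x => Sum.inr (f.succAbove x)) ![Sum.inl (), Sum.inr f] :
      Fin 3 ⊕ Fin 2 → Unit ⊕ Fin 4) := by
  revert f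
  decide

variable (P) in
/-- The tetrahedra after the move, arranged according to a frame before the move. -/
noncomputable def rowEquiv {ι κ : Type*} (eT : ι ⊕ κ ≃ X.Simp 3) (f : Fin 4) :
    (ι ⊕ Fin 3) ⊕ (κ ⊕ Fin 2) ≃ P.inflate.Simp 3 :=
  (Equiv.sumSumSumComm ι (Fin 3) κ (Fin 2)).trans
    ((eT.sumCongr (Equiv.ofBijective _ (bijective_newRows f))).trans P.tetEquiv)

namespace Gauge

variable (G : P.Gauge D D') {ι κ : Type*} [Fintype ι] [Fintype κ] [DecidableEq ι] [DecidableEq κ]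

open Classical in
/-- The cochains after the move that complement the image of `f₂`. -/
noncomputable def liftFrame (B : κ → X.Simp 3 → ℂ) (f : Fin 4) :
    κ ⊕ Fin 2 → P.inflate.Simp 3 → ℂ :=
  Sum.elim (fun k => G.lift (B k)) ![Pi.single P.copySimp 1, Pi.single (P.newTet f) 1]

/-- At the old tetrahedra the new edges and both unit vectors vanish, so the matrix is block
triangular. The old block is the old frame with rescaled rows; the new block is again triangular,
with the blocks `coneMatrix` and the identity. -/
theorem frame_lift_det (c : ι → P.inflate.Z2) (B : κ → X.Simp 3 → ℂ) (eT : ι ⊕ κ ≃ X.Simp 3)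
    (f : Fin 4) :
    (frame D'.f2 (Sum.elim c fun x => P.inflate.edgeZ (P.newEdge (f.succAbove x)))
      (G.liftFrame B f) (P.rowEquiv eT f)).det =
      (∏ t, G.scale t) * (frame D.f2 (fun i => P.restrict (c i)) B eT).det *
        (coneMatrix D' f).det := by
  classical
  have e0 : ∀ (x : X.Simp 3 → ℂ) t, G.lift x (P.oldSimp t) = G.scale t * x t := G.lift_oldSimp
  have e1 : P.tetEquiv (Sum.inr (Sum.inl ())) = P.copySimp := rfl
  have e2 : ∀ t, P.tetEquiv (Sum.inl t) = P.oldSimp t := fun _ => rfl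
  have e3 : ∀ x, P.tetEquiv (Sum.inr (Sum.inr x)) = P.newTet x := fun _ => rfl
  have e4 : ∀ x t, P.oldSimp t ≠ P.newTet x := fun x t => (newTet_ne_oldSimp x t).symm
  have e5 : ∀ t, P.oldSimp t ≠ P.copySimp := fun t h => by
    have := congrArg Subtype.val h
    injection this
  have e6 : ∀ x, P.newTet x ≠ P.copySimp := newTet_ne_copySimp
  have e7 : ∀ x y, P.newTet x = P.newTet y ↔ x = y := fun x y =>
    ⟨fun h => by
      have h1 : P.tetEquiv (Sum.inr (Sum.inr x)) = P.tetEquiv (Sum.inr (Sum.inr y)) := h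
      simpa using h1, fun h => by rw [h]⟩
  have e8 : ∀ x, P.copySimp ≠ P.newTet x := fun x => (e6 x).symm
  have e9 : ∀ x t, D'.f2 (P.inflate.edgeZ (P.newEdge x)) (P.oldSimp t) = 0 := fun x t => by
    rw [G.f2_oldSimp, P.restrict_edgeZ_newEdge, map_zero, Pi.zero_apply, mul_zero]
  have e10 : ∀ x, D'.f2 (P.inflate.edgeZ (P.newEdge x)) P.copySimp = 0 := fun x => by
    rw [G.f2_copySimp, P.restrict_edgeZ_newEdge, map_zero, Pi.zero_apply, mul_zero]
  let s := Equiv.sumSumSumComm ι (Fin 3) κ (Fin 2)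
  let M := (frame D'.f2 (Sum.elim c fun x => P.inflate.edgeZ (P.newEdge (f.succAbove x)))
      (G.liftFrame B f) (P.rowEquiv eT f))
  have h1 : (M.submatrix s.symm s.symm).toBlocks₁₁ =
      Matrix.diagonal (fun a => G.scale (eT a)) * frame D.f2 (fun i => P.restrict (c i)) B eT := by
    ext a b
    rw [Matrix.diagonal_mul]
    rcases a with a | a <;> rcases b with b | b <;>
      simp [M, s, toBlocks₁₁, frame, rowEquiv, e2, G.f2_oldSimp, liftFrame, e0]
  have h2 : (M.submatrix s.symm s.symm).toBlocks₁₂ = 0 := by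
    ext a b
    rcases a with a | a <;> rcases b with b | b <;> (try fin_cases b) <;>
      simp [M, s, toBlocks₁₂, frame, rowEquiv, e2, liftFrame, e9, e4, e5]
  have h3 : (M.submatrix s.symm s.symm).toBlocks₂₂ = Matrix.fromBlocks (coneMatrix D' f) 0
      (M.submatrix s.symm s.symm).toBlocks₂₂.toBlocks₂₁ 1 := by
    ext a b
    rcases a with a | a <;> rcases b with b | b <;>
      (try fin_cases b) <;> (try fin_cases a) <;>
      simp [M, s, toBlocks₂₂, toBlocks₂₁, frame, rowEquiv, e1, e3, liftFrame, coneMatrix, e10, e6, e7, e8]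
  have h4 : M.det = (M.submatrix s.symm s.symm).det := (Matrix.det_submatrix_equiv_self _ _).symm
  change M.det = _
  rw [h4, ← Matrix.fromBlocks_toBlocks (M.submatrix s.symm s.symm), h2,
    Matrix.det_fromBlocks_zero₁₂, h1, h3, Matrix.det_fromBlocks_zero₁₂, Matrix.det_one, mul_one,
    Matrix.det_mul, Matrix.det_diagonal, eT.prod_comp]

theorem formGram_lift_det (B : κ → X.Simp 3 → ℂ) {f : Fin 4}
    (hf : D'.F P.sndPent P.apex (P.apex.succAbove f) ≠ 0) :
    (formGram D'.f3Matrix (G.liftFrame B f)).det =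
      D'.F P.sndPent P.apex (P.apex.succAbove f) ^ 2 * (formGram D.f3Matrix B).det := by
  classical
  rw [det_eq_sq_mul_det _ hf]
  · congr 2
    ext a b
    exact G.form_lift_lift _ _
  · intro k
    exact G.form_lift_newTet (B k) f
  · intro k
    refine (D'.form_skew _ _).trans ?_
    rw [neg_eq_zero]
    exact G.form_lift_newTet (B k) f
  · exact form_copySimp_newTet f
  · refine (D'.form_skew _ _).trans ?_
    congr 1
    exact form_copySimp_newTet f
  · have := D'.form_skew (Pi.single (P.newTet f) 1) (Pi.single (P.newTet f) 1)
    exact self_eq_neg.1 this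

end Gauge

end Site

end TriComplex

/-! ### Torsion after the move and the invariance theorem. -/

namespace TriComplex

variable {Λ : Type v} [LinearOrder Λ] {X : TriComplex.{u} Λ} {P : X.Site} {ε : X.Simp 4 → ℤˣ}
  {D : X.Coloring ε} {D' : P.inflate.Coloring (P.newSign ε)}

namespace Site

/-- The complex after the move is acyclic, and its torsion is expressed through that before the
move. -/
theorem torsion_inflate (hX : X.IsClosedOriented ε) (hD : P.Extends D D') (G : P.Gauge D D') {f : Fin 4}
    (hf : D'.F P.sndPent P.apex (P.apex.succAbove f) ≠ 0)
    {r : ℕ} (Z : X.CocycleBasis r) (Z' : P.inflate.CocycleBasis r) (hZ : P.SameClasses Z Z')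
    (hac : D.IsAcyclic) :
    D'.IsAcyclic ∧ ∀ y y', D.IsSqrtTorsion Z y → D'.IsSqrtTorsion Z' y' →
      y' ^ 2 * ((∏ t, G.scale t) ^ 2 * (coneMatrix D' f).det ^ 2) =
        y ^ 2 * D'.F P.sndPent P.apex (P.apex.succAbove f) ^ 2 := by
  classical
  obtain ⟨k, l, c, B, eJ, eT, h1, h2⟩ := hac.exists_frame Z
  have hY := coneMatrix_det_ne_zero hf
  obtain ⟨e, g, he, hg1, hg2, hg3, hg4⟩ := exists_bases D' Z Z' hZ hY k
  have hρ : ∀ c : X.Z2, ∃ c', P.restrict c' = c := fun c => by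
    refine ⟨∑ j, e.repr c j • g (Sum.inl j), ?_⟩
    rw [map_sum]
    simp only [map_smul, hg1]
    exact e.sum_repr c
  choose c' hc' using fun i => hρ (c i)
  have hAf' : ∀ v, D'.f3Matrix *ᵥ D'.f2 v = 0 := D'.f3Matrix_mulVec_f2 (P.inflate_sum_eq_zero ε hX)
  have hω' : D'.ω ≠ 0 := fun h => hac.ω_ne_zero (by rw [← hD.restrict_ω, h, map_zero])
  have hF := G.frame_lift_det c' B eT f
  simp only [hc'] at hF
  have hG := G.formGram_lift_det B hf
  have hF0 : (frame D'.f2 (Sum.elim c' fun x => P.inflate.edgeZ (P.newEdge (f.succAbove x)))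
      (G.liftFrame B f) (P.rowEquiv eT f)).det ≠ 0 := by
    rw [hF]
    exact mul_ne_zero (mul_ne_zero (Finset.prod_ne_zero_iff.2 fun t _ => G.scale_ne_zero t) h1) hY
  have hG0 : (formGram D'.f3Matrix (G.liftFrame B f)).det ≠ 0 := by
    rw [hG]
    exact mul_ne_zero (pow_ne_zero 2 hf) h2
  have hg2' : (fun x => g (Sum.inr x)) = fun x => P.inflate.edgeZ (P.newEdge (f.succAbove x)) :=
    funext hg2
  obtain ⟨eJ', hC⟩ : ∃ eJ' : Unit ⊕ (Fin k ⊕ Fin 3) ≃ ({b : X.Simp 1 // b ∉ Z.tree} ⊕ Fin r) ⊕ Fin 3,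
      (coordMatrix g D'.ω (Sum.elim c' fun x => P.inflate.edgeZ (P.newEdge (f.succAbove x)))
        eJ').det = (coordMatrix Z.basis D.ω c eJ).det := by
    have hC := coordMatrix_extend_det e g P.restrict hg1
      (fun x => by rw [hg2, P.restrict_edgeZ_newEdge]) D'.ω c' eJ
    rw [hD.restrict_ω, funext hc', ← he, hg2'] at hC
    exact ⟨_, hC⟩
  refine ⟨D'.isAcyclic_of hω' (fun v hv => ker_le_of_frame g eJ' hF0 hω' D'.f2_ω hv)
    (fun x hx => mem_range_of_gram hF0 hG0 hAf' hx) hAf', fun y y' hy hy' => ?_⟩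
  -- The basis built from the old tree and the given basis `Z'.basis` are indexed differently; two
  -- bases of one space have equivalent index types.
  have hcard : Nonempty (({b : X.Simp 1 // b ∉ Z.tree} ⊕ Fin r) ⊕ Fin 3 ≃
      {b : P.inflate.Simp 1 // b ∉ Z'.tree} ⊕ Fin r) := ⟨g.indexEquiv Z'.basis⟩
  obtain ⟨s⟩ := hcard
  have a1 := hy.sq_mul hac.ω_ne_zero hac.mulVec_f2 eJ eT h1
  have a2 := hy'.sq_mul hω' hAf' (eJ'.trans s) (P.rowEquiv eT f) hF0
  have a3 := coordMatrix_det_sq_of_integral g Z'.basis hg3 hg4 D'.ω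
    (Sum.elim c' fun x => P.inflate.edgeZ (P.newEdge (f.succAbove x))) eJ' (eJ'.trans s)
  rw [a3, hF, hG, hC] at a2
  refine mul_right_cancel₀ (pow_ne_zero 2 h1) ?_
  have key : ∀ {A C M S Y v y y' : ℂ}, y ^ 2 * A ^ 2 = C ^ 2 * M →
      y' ^ 2 * (S * A * Y) ^ 2 = C ^ 2 * (v ^ 2 * M) →
      y' ^ 2 * (S ^ 2 * Y ^ 2) * A ^ 2 = y ^ 2 * v ^ 2 * A ^ 2 := by
    intro A C M S Y v y y' h h'
    linear_combination h' - v ^ 2 * h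
  exact key a1 a2

end Site

end TriComplex

theorem theorem6p5 {Λ : Type v} [LinearOrder Λ] (X : TriComplex.{u} Λ) (ε : X.Simp 4 → ℤˣ)
    (hX : X.IsClosedOriented ε) (P : X.Site)
    (D : X.Coloring ε) (D' : P.inflate.Coloring (P.newSign ε)) (hD : P.Extends D D')
    {r : ℕ} (Z : X.CocycleBasis r) (Z' : P.inflate.CocycleBasis r) (hZ : P.SameClasses Z Z')
    (hac : D.IsAcyclic) :
    D'.IsAcyclic ∧ (∃ I, D.IsInvariant Z I) ∧ (∃ I', D'.IsInvariant Z' I') ∧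
      ∀ I I', D.IsInvariant Z I → D'.IsInvariant Z' I' → I' = I ∨ I' = -I := by
  obtain ⟨G⟩ := hD.nonempty_gauge
  obtain ⟨f, hf⟩ := TriComplex.Site.exists_F_ne_zero D'
  obtain ⟨hac', hsq⟩ := TriComplex.Site.torsion_inflate hX hD G hf Z Z' hZ hac
  obtain ⟨y, hy⟩ := hac.exists_isSqrtTorsion Z
  obtain ⟨y', hy'⟩ := hac'.exists_isSqrtTorsion Z'
  refine ⟨hac', ⟨_, y, hy, rfl⟩, ⟨_, y', hy', rfl⟩, ?_⟩
  clear hy hy' y y'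
  rintro _ _ ⟨y, hy, rfl⟩ ⟨y', hy', rfl⟩
  -- Equality up to a sign is equality of squares, which also removes all the arbitrary choices of
  -- signs.
  refine sq_eq_sq_iff_eq_or_eq_neg.1 ?_
  have h1 := hsq y y' hy hy'
  have h2 := G.prod_η_sq hX hD
  have h3 := TriComplex.Site.sndPent_identity D' f
  have h4 := P.prod_triangles fun s => (D'.q s)⁻¹
  have h5 : ∏ s, (D'.q (P.oldSimp s))⁻¹ = ∏ s, (D.q s)⁻¹ :=
    Finset.prod_congr rfl fun s _ => by rw [hD s]
  have hQ := TriComplex.Site.prod_q_ne_zero (P := P) (D' := D')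
  have hY := TriComplex.Site.coneMatrix_det_ne_zero hf
  rw [h5, Finset.prod_inv_distrib (s := Finset.univ)
    (f := fun s : {s : Finset (Fin 5) // s.card = 2 + 1 ∧ P.apex ∈ s} =>
      D'.q (P.inflate.sub P.sndPent s.1 s.2.1))] at h4
  rw [h4]
  simp only [mul_pow]
  rw [h2]
  generalize (∏ s : {s : Finset (Fin 5) // s.card = 2 + 1 ∧ P.apex ∈ s},
      D'.q (P.inflate.sub P.sndPent s.1 s.2.1)) = Q at *
  rw [inv_pow]
  -- With the denominators `Q²` and `Y²` cleared, the torsion formula `h1` trades `Y²` for the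
  -- squared entry of `F`, and the local identity `h3` matches that entry and `η ^ 4` against `Q²
  -- Y²`.
  refine mul_right_cancel₀ (mul_ne_zero (pow_ne_zero 2 hQ) (pow_ne_zero 2 hY)) ?_
  have hQ2 : (Q ^ 2)⁻¹ * Q ^ 2 = 1 := inv_mul_cancel₀ (pow_ne_zero 2 hQ)
  linear_combination ((∏ s, (D.q s)⁻¹) ^ 2 * (∏ p, D.η p) ^ 2 * (∏ t, G.scale t) ^ 2 *
    D'.η P.sndPent ^ 4 * y' ^ 2 * (TriComplex.Site.coneMatrix D' f).det ^ 2) * hQ2 +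
    ((∏ s, (D.q s)⁻¹) ^ 2 * (∏ p, D.η p) ^ 2 * D'.η P.sndPent ^ 4) * h1 +
    ((∏ s, (D.q s)⁻¹) ^ 2 * (∏ p, D.η p) ^ 2 * y ^ 2) * h3
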